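/- Identify $\mathbb R^2$ with $\mathbb C$, let $D_R=\{|z|<R\}$, $W(u)=\tfrac14(1-|u|^2)^2$ and, for $0\le\delta<1$, \[ E(u,D_R)=\int_{D_R}\Big[\tfrac{1-\delta}{2}|\nabla u|^2+\delta(\operatorname{div}u)^2+W(u)\Big]. \] Let $d\le -1$ be an integer, $n=1-d$, and fix a sign $\pm$. A map $v$ is called $\mu_d^\pm$-equivariant if $v(e^{i\pi/n}z)=-e^{i\pi/n}v(z)$ and $v(\bar z)=\pm\overline{v(z)}$. Let $\delta\in[0,1)$ and let $u\colon\mathbb R^2\to\mathbb R^2$ be a smooth $\mu_d^\pm$-equivariant solution of \[ (1-\delta)\Delta u+2\delta\nabla(\operatorname{div}u)=\nabla W(u)\quad\text{in }\mathbb R^2 \] such that $2\int_{\mathbb R^2}W(u)\le\pi d^2$, $|u(x)|\to1$ as $|x|\to\infty$, and $u$ is locally minimizing, i.e. $E(u,D_R)\le E(u+\xi,D_R)$ for every $R>0$ and every $\mu_d^\pm$-equivariant $\xi\in H^1_0(D_R;\mathbb R^2)$. If \[ 0\le\delta<\min\Big(\frac{2-2d}{4d^2+10-10d},\ \frac{2}{\sqrt3}-1\Big),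 \] then, for all sufficiently large $r$, $u$ does not vanish on $\partial D_r$ and its winding number there is $\deg(u;\partial D_r)=d$. -/

import Mathlib

open Filter Topology MeasureTheory Laplacian
open scoped ContDiff Gradient ENNReal

noncomputable section

namespace AnisotropicGL

/- The plane `ℝ²` is identified with `ℂ` (as a real inner product space with Lebesgue measure). -/

/-- First partial derivative `∂₁ u`. -/
def dx (u : ℂ → ℂ) (z : ℂ) : ℂ := fderiv ℝ u z 1

/-- Second partial derivative `∂₂ u`. -/
def dy (u : ℂ → ℂ) (z : ℂ) : ℂ := fderiv ℝ u z Complex.I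

/-- Divergence `∂₁ u₁ + ∂₂ u₂` of a planar vector field. -/
def divg (u : ℂ → ℂ) (z : ℂ) : ℝ := (dx u z).re + (dy u z).im

/-- The potential `W(w) = (1 - |w|²)² / 4`. -/
def W (w : ℂ) : ℝ := (1 / 4) * (1 - ‖w‖ ^ 2) ^ 2

/-- The energy density `(1-δ)/2 |∇u|² + δ (div u)² + W(u)` as a function of the value `w` of `u`
and of the values `p`, `q` of its two partial derivatives. -/
def energyDensity (δ : ℝ) (w p q : ℂ) : ℝ :=
  (1 - δ) / 2 * (‖p‖ ^ 2 + ‖q‖ ^ 2) + δ * (p.re + q.im) ^ 2 + W w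

/-- The energy on the disk `D_R` of a map `u` with (weak) partial derivatives `ux`, `uy`.
The density is nonnegative for `0 ≤ δ < 1`, so this is its integral with values in `[0, ∞]`. -/
def energy (δ R : ℝ) (u ux uy : ℂ → ℂ) : ℝ≥0∞ :=
  ∫⁻ z in Metric.ball (0 : ℂ) R, ENNReal.ofReal (energyDensity δ (u z) (ux z) (uy z))

/-- `u` is a pointwise solution of `(1-δ) Δu + 2δ ∇(div u) = ∇W(u)` in the plane. -/
def SolvesGL (δ : ℝ) (u : ℂ → ℂ) : Prop :=
  ∀ z : ℂ, (1 - δ) • (Δ u) z + (2 * δ) • (∇ (divg u)) z = (∇ W) (u z)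

/-- `μ_d^±`-equivariance, where `s = ±1` is the sign: with `n = 1 - d`, the generators of the
dihedral group, the rotation by `π / n` and the reflection `z ↦ conj z`, are sent to the
rotation by `π / n` composed with `-1`, and to `w ↦ ± conj w`. -/
def IsEquivariant (d : ℤ) (s : ℤˣ) (u : ℂ → ℂ) : Prop :=
  (∀ z : ℂ, u (Complex.exp (Complex.I * (Real.pi / (1 - d))) * z)
      = -Complex.exp (Complex.I * (Real.pi / (1 - d))) * u z) ∧
  ∀ z : ℂ, u (starRingEnd ℂ z) = ((s : ℤ) : ℂ) * starRingEnd ℂ (u z)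

/-- `φ ∈ C_c^∞(D_R; ℝ²)`. -/
def IsTestMap (R : ℝ) (φ : ℂ → ℂ) : Prop :=
  ContDiff ℝ ∞ φ ∧ HasCompactSupport φ ∧ tsupport φ ⊆ Metric.ball (0 : ℂ) R

/-- `ξ ∈ H¹₀(D_R; ℝ²)` with weak partial derivatives `ξx`, `ξy`: the closure of `C_c^∞(D_R; ℝ²)`
in the `H¹` norm. The `L²` limits of the partial derivatives of the approximating
test maps are the weak partial derivatives of `ξ`. -/
def MemH10 (R : ℝ) (ξ ξx ξy : ℂ → ℂ) : Prop :=
  MemLp ξ 2 (volume.restrict (Metric.ball (0 : ℂ) R)) ∧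
  MemLp ξx 2 (volume.restrict (Metric.ball (0 : ℂ) R)) ∧
  MemLp ξy 2 (volume.restrict (Metric.ball (0 : ℂ) R)) ∧
  ∃ φ : ℕ → ℂ → ℂ, (∀ k, IsTestMap R (φ k)) ∧
    Tendsto (fun k => eLpNorm (fun z => φ k z - ξ z) 2
      (volume.restrict (Metric.ball (0 : ℂ) R))) atTop (𝓝 0) ∧
    Tendsto (fun k => eLpNorm (fun z => dx (φ k) z - ξx z) 2
      (volume.restrict (Metric.ball (0 : ℂ) R))) atTop (𝓝 0) ∧
    Tendsto (fun k => eLpNorm (fun z => dy (φ k) z - ξy z) 2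
      (volume.restrict (Metric.ball (0 : ℂ) R))) atTop (𝓝 0)

/-- Local minimality: `E(u, D_R) ≤ E(u + ξ, D_R)` for every `R > 0` and every
`μ_d^±`-equivariant `ξ ∈ H¹₀(D_R; ℝ²)`. (Every class that is equivariant almost everywhere in
`D_R` has a representative, zero outside `D_R`, that is equivariant everywhere.) -/
def IsLocallyMinimizing (d : ℤ) (s : ℤˣ) (δ : ℝ) (u : ℂ → ℂ) : Prop :=
  ∀ R : ℝ, 0 < R → ∀ ξ ξx ξy : ℂ → ℂ, MemH10 R ξ ξx ξy → IsEquivariant d s ξ →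
    energy δ R u (dx u) (dy u) ≤
      energy δ R (fun z => u z + ξ z) (fun z => dx u z + ξx z) (fun z => dy u z + ξy z)

/-- The smooth entire `μ_d^±`-equivariant locally minimizing solutions with
`2 ∫ W(u) ≤ π d²` and `|u| → 1` at infinity. -/
structure IsEntireMinimizingSolution (d : ℤ) (s : ℤˣ) (δ : ℝ) (u : ℂ → ℂ) : Prop where
  smooth : ContDiff ℝ ∞ u
  equivariant : IsEquivariant d s u
  solves : SolvesGL δ u
  potential_integrable : Integrable (fun z => W (u z))
  potential_le : 2 * ∫ z, W (u z) ≤ Real.pi * (d : ℝ) ^ 2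
  norm_tendsto : Tendsto (fun z => ‖u z‖) (cocompact ℂ) (𝓝 1)
  minimizing : IsLocallyMinimizing d s δ u

/-- `deg(u; ∂D_r) = k`: the map `u` does not vanish on the circle `∂D_r`, and a continuous phase
`ψ` of `u / |u|` along the circle increases by `2πk` along one turn. -/
def HasDegree (u : ℂ → ℂ) (r : ℝ) (k : ℤ) : Prop :=
  (∀ θ : ℝ, u (r * Complex.exp (Complex.I * θ)) ≠ 0) ∧
  ∃ ψ : ℝ → ℝ, Continuous ψ ∧
    (∀ θ : ℝ, u (r * Complex.exp (Complex.I * θ)) / ‖u (r * Complex.exp (Complex.I * θ))‖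
      = Complex.exp (Complex.I * ψ θ)) ∧
    ψ (2 * Real.pi) - ψ 0 = 2 * Real.pi * k

end AnisotropicGL

end

/-! Put n = 1 - d and p = -d. Because -e^{iπ/n} = e^{iπd/n}, equivariance forces a logarithm of u
along a large circle to gain i(πd/n + 2πk) over each arc of angle π/n, with k an integer. The degree
is therefore D = d + 2nk, and k does not depend on the radius, since it is continuous in the radius
and integer valued (`exists_winding_uniform`). It remains to exclude k ≠ 0, which is done by
comparing two growth rates of F(t) = E(u, D_R), R = e^t.

Lower bound. F'(t) is R² times the angular integral of the energy density over the circle. It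
dominates (1-δ)/2 ∫|∂_θ u|² + R² ∫W(u), and degree D together with |u| → 1 makes this at least c₀,
where c₀ is as close to (1-δ)πD² as desired (`circle_energy_ge`, `integral_norm_tang_sq_ge`). So F
grows at least like c₀ t.

Upper bound. A cheaper map carries a vortex of degree d at the origin and vortices of degree k at
the 2n vertices of a regular polygon of radius R/8. It has the symmetries of u up to a unit constant
and total degree D, and its energy is at most (1+3δ)π(p² + 2nk² + η) log R + O(1) for any η > 0
(`exists_integral_norm_grad_model_le`, `exists_integral_W_model_le`). On the circle u is this model
times a unit constant and e^Λ, where Λ is periodic. The factor e^Λ is switched off in the layer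
e^{-7/10}R < |z| < R. Im Λ is odd and π/n-periodic, so a Poincaré inequality controls it by Λ',
while Re Λ is controlled by W(u). With the bound on δ by 2/√3 - 1, the layer costs at most 9/10
F'(t) + O(1). Minimality then yields F ≤ (9/10)F' + C₁ t + C with C₁ = (1+3δ)π(p² + 2nk² + η)
(`exists_diskEnergy_competitor_le`).

Solutions of this differential inequality either grow like e^{10t/9} or have slope at most C₁. The
first case is excluded by the a priori bound F ≤ C e^t, which follows from a Caccioppoli inequality
and the integrability of W(u) (`exists_diskEnergy_le_linear`, `le_linear_of_le_mul_deriv`). Hence c₀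
≤ C₁. This contradicts `vortex_cost_lt`: for k ≠ 0 the other bound on δ says exactly that splitting
into the model's vortices is strictly cheaper than carrying degree D, the critical case being k = 1.
-/

noncomputable section

namespace AnisotropicGL

/-! ### Gradients, bounds on the energy density, polar integration. -/

/-- The full gradient of a planar map, normed by the Hilbert–Schmidt norm. -/
def grad (u : ℂ → ℂ) (z : ℂ) : EuclideanSpace ℂ (Fin 2) := !₂[dx u z, dy u z]

theorem norm_grad_sq (u : ℂ → ℂ) (z : ℂ) :
    ‖grad u z‖ ^ 2 = ‖dx u z‖ ^ 2 + ‖dy u z‖ ^ 2 := by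
  simp [grad, EuclideanSpace.norm_sq_eq, Fin.sum_univ_two]

theorem grad_mul {f g : ℂ → ℂ} {z : ℂ} (hf : DifferentiableAt ℝ f z)
    (hg : DifferentiableAt ℝ g z) :
    grad (fun w => f w * g w) z = f z • grad g z + g z • grad f z := by
  ext i
  fin_cases i <;> simp [grad, dx, dy, fderiv_fun_mul hf hg]

theorem grad_pow {f : ℂ → ℂ} {z : ℂ} (hf : DifferentiableAt ℝ f z) (m : ℕ) :
    grad (fun w => f w ^ m) z = ((m : ℂ) * f z ^ (m - 1)) • grad f z := by
  ext i
  fin_cases i <;> simp [grad, dx, dy, fderiv_fun_pow m hf]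

theorem grad_cexp {f : ℂ → ℂ} {z : ℂ} (hf : DifferentiableAt ℝ f z) :
    grad (fun w => Complex.exp (f w)) z = Complex.exp (f z) • grad f z := by
  have h := (hf.hasFDerivAt.cexp).fderiv
  ext i
  fin_cases i <;> simp [grad, dx, dy, h]

theorem norm_grad_conj {f : ℂ → ℂ} {z : ℂ} (hf : DifferentiableAt ℝ f z) :
    ‖grad (fun w => starRingEnd ℂ (f w)) z‖ = ‖grad f z‖ := by
  have h : HasFDerivAt (fun w => starRingEnd ℂ (f w))
      ((Complex.conjCLE : ℂ →L[ℝ] ℂ).comp (fderiv ℝ f z)) z :=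
    (Complex.conjCLE : ℂ →L[ℝ] ℂ).hasFDerivAt.comp z hf.hasFDerivAt
  have h2 : ‖grad (fun w => starRingEnd ℂ (f w)) z‖ ^ 2 = ‖grad f z‖ ^ 2 := by
    rw [norm_grad_sq, norm_grad_sq]
    simp [dx, dy, h.fderiv]
  exact (sq_eq_sq₀ (norm_nonneg _) (norm_nonneg _)).1 h2

theorem grad_const_mul {f : ℂ → ℂ} {z : ℂ} (hf : DifferentiableAt ℝ f z) (c : ℂ) :
    grad (fun w => c * f w) z = c • grad f z := by
  ext i
  fin_cases i <;> simp [grad, dx, dy, fderiv_const_mul hf]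

/-- The Hilbert–Schmidt norm computed in the orthogonal frame `z`, `i z`. -/
theorem norm_sq_apply_frame (A : ℂ →L[ℝ] ℂ) (z : ℂ) :
    ‖A z‖ ^ 2 + ‖A (Complex.I * z)‖ ^ 2 = ‖z‖ ^ 2 * (‖A 1‖ ^ 2 + ‖A Complex.I‖ ^ 2) := by
  have h1 : A z = z.re • A 1 + z.im • A Complex.I := by
    rw [← map_smul, ← map_smul, ← map_add]
    congr 1
    apply Complex.ext <;> simp
  have h2 : A (Complex.I * z) = (-z.im) • A 1 + z.re • A Complex.I := by
    rw [← map_smul, ← map_smul, ← map_add]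
    congr 1
    apply Complex.ext <;> simp
  rw [h1, h2]
  simp only [← Complex.normSq_eq_norm_sq, Complex.normSq_apply, Complex.add_re, Complex.add_im,
    Complex.smul_re, Complex.smul_im, smul_eq_mul]
  ring

theorem norm_sq_mul_norm_grad_sq (u : ℂ → ℂ) (z : ℂ) :
    ‖z‖ ^ 2 * ‖grad u z‖ ^ 2
      = ‖fderiv ℝ u z z‖ ^ 2 + ‖fderiv ℝ u z (Complex.I * z)‖ ^ 2 := by
  rw [norm_grad_sq, norm_sq_apply_frame]; rfl

theorem continuous_dx {u : ℂ → ℂ} (hu : ContDiff ℝ ∞ u) : Continuous (dx u) :=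
  (hu.continuous_fderiv (by simp)).clm_apply continuous_const

theorem continuous_dy {u : ℂ → ℂ} (hu : ContDiff ℝ ∞ u) : Continuous (dy u) :=
  (hu.continuous_fderiv (by simp)).clm_apply continuous_const

theorem continuous_norm_grad {u : ℂ → ℂ} (hu : ContDiff ℝ ∞ u) :
    Continuous fun z => ‖grad u z‖ := by
  have : (fun z => ‖grad u z‖) = fun z => √(‖dx u z‖ ^ 2 + ‖dy u z‖ ^ 2) := by
    funext z
    rw [← norm_grad_sq, Real.sqrt_sq (norm_nonneg _)]
  rw [this]
  have := continuous_dx hu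
  have := continuous_dy hu
  fun_prop

theorem W_nonneg (w : ℂ) : 0 ≤ W w := by unfold W; positivity

theorem continuous_W : Continuous W := by unfold W; fun_prop

/-- The energy density of a differentiable map. -/
def density (δ : ℝ) (u : ℂ → ℂ) (z : ℂ) : ℝ := energyDensity δ (u z) (dx u z) (dy u z)

theorem continuous_density (δ : ℝ) {u : ℂ → ℂ} (hu : ContDiff ℝ ∞ u) :
    Continuous (density δ u) := by
  have := continuous_dx hu
  have := continuous_dy hu
  have := hu.continuous
  have := continuous_W
  unfold density energyDensity
  fun_prop

/-- From (div u)² ≤ 2|∇u|² and (1-δ)/2 + 2δ = (1+3δ)/2. The gap between this factor and the (1-δ)/2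
of `le_density` is the loss that both bounds on δ have to absorb. -/
theorem density_le {δ : ℝ} (h0 : 0 ≤ δ) (u : ℂ → ℂ) (z : ℂ) :
    density δ u z ≤ (1 + 3 * δ) / 2 * ‖grad u z‖ ^ 2 + W (u z) := by
  rw [norm_grad_sq]
  unfold density energyDensity
  have h : ((dx u z).re + (dy u z).im) ^ 2 ≤ 2 * (‖dx u z‖ ^ 2 + ‖dy u z‖ ^ 2) := by
    simp only [← Complex.normSq_eq_norm_sq, Complex.normSq_apply]
    nlinarith [sq_nonneg ((dx u z).re - (dy u z).im), sq_nonneg (dx u z).im,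
      sq_nonneg (dy u z).re]
  nlinarith [mul_le_mul_of_nonneg_left h h0]

theorem le_density {δ : ℝ} (h0 : 0 ≤ δ) (u : ℂ → ℂ) (z : ℂ) :
    (1 - δ) / 2 * ‖grad u z‖ ^ 2 + W (u z) ≤ density δ u z := by
  rw [norm_grad_sq]
  unfold density energyDensity
  nlinarith [mul_nonneg h0 (sq_nonneg ((dx u z).re + (dy u z).im))]

theorem density_nonneg {δ : ℝ} (h0 : 0 ≤ δ) (h1 : δ ≤ 1) (u : ℂ → ℂ) (z : ℂ) :
    0 ≤ density δ u z := by
  refine le_trans ?_ (le_density h0 u z)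
  have := W_nonneg (u z)
  have : 0 ≤ (1 - δ) / 2 := by linarith
  positivity

theorem integrableOn_ball {f : ℂ → ℝ} (hf : Continuous f) (R : ℝ) :
    IntegrableOn f (Metric.ball (0 : ℂ) R) :=
  (hf.continuousOn.integrableOn_compact (isCompact_closedBall (0 : ℂ) R)).mono_set
    Metric.ball_subset_closedBall

/-- Integration over a disk in polar coordinates. -/
theorem integral_ball_eq_polar {f : ℂ → ℝ} (hf : Continuous f) {R : ℝ} (hR : 0 ≤ R) :
    ∫ z in Metric.ball (0 : ℂ) R, f z
      = ∫ r in (0 : ℝ)..R, r * ∫ θ in (-Real.pi)..Real.pi, f (r * Complex.exp (Complex.I * θ)) := by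
  rw [← integral_indicator Metric.isOpen_ball.measurableSet,
    ← Complex.integral_comp_polarCoord_symm]
  have hset : ∀ p : ℝ × ℝ, p ∈ polarCoord.target →
      p.1 • (Metric.ball (0 : ℂ) R).indicator f (Complex.polarCoord.symm p)
        = (Set.Ioo 0 R ×ˢ Set.Ioo (-Real.pi) Real.pi).indicator
          (fun q : ℝ × ℝ => q.1 * f (q.1 * Complex.exp (Complex.I * q.2))) p := by
    rintro ⟨r, θ⟩ hp
    simp only [polarCoord_target, Set.mem_prod, Set.mem_Ioi] at hp
    have hsymm : Complex.polarCoord.symm (r, θ) = r * Complex.exp (Complex.I * θ) := by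
      rw [Complex.polarCoord_symm_apply, mul_comm Complex.I, Complex.exp_mul_I]
      simp
    rw [hsymm]
    have hn : ‖(r : ℂ) * Complex.exp (Complex.I * θ)‖ = r := by
      rw [norm_mul, mul_comm Complex.I, Complex.norm_exp_ofReal_mul_I, mul_one,
        Complex.norm_real, Real.norm_of_nonneg hp.1.le]
    by_cases h : r < R
    · rw [Set.indicator_of_mem, Set.indicator_of_mem]
      · rfl
      · exact ⟨⟨hp.1, h⟩, hp.2⟩
      · rw [mem_ball_zero_iff, hn]; exact h
    · rw [Set.indicator_of_notMem, Set.indicator_of_notMem]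
      · simp
      · exact fun h' => h h'.1.2
      · rw [mem_ball_zero_iff, hn]; exact h
  rw [setIntegral_congr_fun polarCoord.open_target.measurableSet hset]
  have hsub : Set.Ioo 0 R ×ˢ Set.Ioo (-Real.pi) Real.pi ⊆ polarCoord.target := by
    rw [polarCoord_target]
    exact Set.prod_mono (fun x hx => hx.1) subset_rfl
  rw [setIntegral_indicator (measurableSet_Ioo.prod measurableSet_Ioo),
    Set.inter_eq_self_of_subset_right hsub, Measure.volume_eq_prod, setIntegral_prod]
  · rw [intervalIntegral.integral_of_le hR, integral_Ioc_eq_integral_Ioo]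
    refine setIntegral_congr_fun measurableSet_Ioo fun r _ => ?_
    simp only
    rw [intervalIntegral.integral_of_le (by linarith [Real.pi_pos]), integral_Ioc_eq_integral_Ioo,
      integral_const_mul]
  · have hc : Continuous fun q : ℝ × ℝ => q.1 * f (q.1 * Complex.exp (Complex.I * q.2)) := by
      fun_prop
    exact (hc.continuousOn.integrableOn_compact
      (isCompact_Icc.prod isCompact_Icc)).mono_set
      (Set.prod_mono Set.Ioo_subset_Icc_self Set.Ioo_subset_Icc_self)

theorem continuous_circle_integral {f : ℂ → ℝ} (hf : Continuous f) :
    Continuous fun r : ℝ => ∫ θ in (-Real.pi)..Real.pi, f (r * Complex.exp (Complex.I * θ)) := by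
  apply intervalIntegral.continuous_parametric_intervalIntegral_of_continuous'
  fun_prop

theorem ofReal_integral_ball {f : ℂ → ℝ} (hf : Continuous f) (h0 : ∀ z, 0 ≤ f z) (R : ℝ) :
    ∫⁻ z in Metric.ball (0 : ℂ) R, ENNReal.ofReal (f z)
      = ENNReal.ofReal (∫ z in Metric.ball (0 : ℂ) R, f z) :=
  (ofReal_integral_eq_lintegral_ofReal (integrableOn_ball hf R)
    (Eventually.of_forall h0)).symm

/-- The energy of a smooth map on the disk of radius `R`. -/
def diskEnergy (δ : ℝ) (u : ℂ → ℂ) (R : ℝ) : ℝ := ∫ z in Metric.ball (0 : ℂ) R, density δ u z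

theorem energy_eq_diskEnergy {δ : ℝ} (h0 : 0 ≤ δ) (h1 : δ ≤ 1) {u : ℂ → ℂ}
    (hu : ContDiff ℝ ∞ u) (R : ℝ) :
    energy δ R u (dx u) (dy u) = ENNReal.ofReal (diskEnergy δ u R) :=
  ofReal_integral_ball (continuous_density δ hu) (density_nonneg h0 h1 u) R

/-! ### Boundary cutoffs, membership in H¹₀, comparison by minimality. -/

theorem tendsto_eLpNorm_ball_zero {f : ℕ → ℂ → ℂ} {R C : ℝ} (hf : ∀ k, Continuous (f k))
    (hC : ∀ k, ∀ z ∈ Metric.ball (0 : ℂ) R, ‖f k z‖ ≤ C)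
    (hlim : ∀ z ∈ Metric.ball (0 : ℂ) R, Tendsto (fun k => f k z) atTop (𝓝 0)) :
    Tendsto (fun k => eLpNorm (f k) 2 (volume.restrict (Metric.ball (0 : ℂ) R)))
      atTop (𝓝 0) := by
  have h : Tendsto (fun k => ∫⁻ z in Metric.ball (0 : ℂ) R, ‖f k z‖ₑ ^ (2 : ℝ)) atTop (𝓝 0) := by
    have h0 : ∫⁻ _ in Metric.ball (0 : ℂ) R, (0 : ℝ≥0∞) = 0 := by simp
    rw [← h0]
    refine tendsto_lintegral_of_dominated_convergence (fun _ => ENNReal.ofReal C ^ (2 : ℝ))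
      (fun k => ((hf k).measurable.enorm.pow_const _)) (fun k => ?_) ?_ ?_
    · refine (ae_restrict_iff' Metric.isOpen_ball.measurableSet).2 (Eventually.of_forall ?_)
      intro z hz
      refine ENNReal.rpow_le_rpow ?_ (by norm_num)
      rw [← ofReal_norm]
      exact ENNReal.ofReal_le_ofReal (hC k z hz)
    · rw [setLIntegral_const]
      exact ENNReal.mul_ne_top (by simp) measure_ball_lt_top.ne
    · refine (ae_restrict_iff' Metric.isOpen_ball.measurableSet).2 (Eventually.of_forall ?_)
      intro z hz
      have h1 : Tendsto (fun k => ‖f k z‖ₑ) atTop (𝓝 0) := by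
        simpa using (hlim z hz).enorm
      simpa using h1.ennrpow_const 2
  have h2 := h.ennrpow_const (1 / 2)
  rw [ENNReal.zero_rpow_of_pos (by norm_num)] at h2
  refine h2.congr fun k => ?_
  rw [eLpNorm_eq_lintegral_rpow_enorm_toReal (by simp) (by simp)]
  simp

theorem exists_deriv_smoothTransition_bound :
    ∃ C : ℝ, 0 ≤ C ∧ ∀ x, |deriv Real.smoothTransition x| ≤ C := by
  have hc : Continuous (deriv Real.smoothTransition) :=
    (Real.smoothTransition.contDiff (n := 1)).continuous_deriv (by simp)
  obtain ⟨C, hC⟩ := (isCompact_Icc (a := (0 : ℝ)) (b := 1)).exists_bound_of_continuousOn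
    hc.continuousOn
  refine ⟨max C 0, le_max_right _ _, fun x => ?_⟩
  by_cases hx : x ∈ Set.Icc (0 : ℝ) 1
  · exact (hC x hx).trans (le_max_left _ _)
  · have h0 : deriv Real.smoothTransition x = 0 := by
      rw [Set.mem_Icc, not_and_or, not_le, not_le] at hx
      rcases hx with hx | hx
      · have : Real.smoothTransition =ᶠ[𝓝 x] fun _ => 0 := by
          filter_upwards [gt_mem_nhds hx] with y hy
          exact Real.smoothTransition.zero_of_nonpos hy.le
        rw [this.deriv_eq]; simp
      · have : Real.smoothTransition =ᶠ[𝓝 x] fun _ => 1 := by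
          filter_upwards [lt_mem_nhds hx] with y hy
          exact Real.smoothTransition.one_of_one_le hy.le
        rw [this.deriv_eq]; simp
    rw [h0]; simp

/-- A smooth radial cutoff: it is `1` where `1 ≤ p - q |z|²` and `0` where `p - q |z|² ≤ 0`. -/
def radialCutoff (p q : ℝ) (z : ℂ) : ℝ := Real.smoothTransition (p - q * ‖z‖ ^ 2)

theorem contDiff_radialCutoff (p q : ℝ) : ContDiff ℝ ∞ (radialCutoff p q) :=
  Real.smoothTransition.contDiff.comp
    (contDiff_const.sub (contDiff_const.mul (contDiff_norm_sq ℝ)))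

theorem fderiv_radialCutoff (p q : ℝ) (z e : ℂ) :
    fderiv ℝ (radialCutoff p q) z e
      = deriv Real.smoothTransition (p - q * ‖z‖ ^ 2) * (-(2 * q * inner ℝ z e)) := by
  have h1 : HasFDerivAt (fun w : ℂ => p - q * ‖w‖ ^ 2) (-(q • (2 • (innerSL ℝ z)))) z :=
    ((hasStrictFDerivAt_norm_sq z).hasFDerivAt.const_mul q).const_sub p
  have hS : HasDerivAt Real.smoothTransition
      (deriv Real.smoothTransition (p - q * ‖z‖ ^ 2)) (p - q * ‖z‖ ^ 2) :=
    ((Real.smoothTransition.contDiff (n := 1)).differentiable (by simp) _).hasDerivAt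
  have h2 := (hS.comp_hasFDerivAt z h1).fderiv
  have : radialCutoff p q = Real.smoothTransition ∘ fun w : ℂ => p - q * ‖w‖ ^ 2 := rfl
  rw [this, h2]
  simp
  left
  ring

theorem abs_fderiv_radialCutoff_le {C : ℝ} (hC : ∀ x, |deriv Real.smoothTransition x| ≤ C)
    {p q : ℝ} (hq : 0 ≤ q) (z e : ℂ) :
    |fderiv ℝ (radialCutoff p q) z e| ≤ C * (2 * q * (‖z‖ * ‖e‖)) := by
  rw [fderiv_radialCutoff, abs_mul, abs_neg, abs_mul, abs_of_nonneg (by positivity : 0 ≤ 2 * q)]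
  have := abs_real_inner_le_norm z e
  have h0 : 0 ≤ C := (abs_nonneg _).trans (hC 0)
  gcongr
  exact hC _

theorem radialCutoff_eventuallyEq_one {p q : ℝ} {z : ℂ} (h : 1 < p - q * ‖z‖ ^ 2) :
    radialCutoff p q =ᶠ[𝓝 z] fun _ => 1 := by
  have hc : Continuous fun w : ℂ => p - q * ‖w‖ ^ 2 := by fun_prop
  filter_upwards [hc.continuousAt.eventually (lt_mem_nhds h)] with w hw
  exact Real.smoothTransition.one_of_one_le hw.le

/-- Radial projection to the circle, with an arbitrary choice at the origin. It feeds the mean value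
inequality that bounds a map vanishing on the circle by K(R - |z|). -/
theorem exists_mem_sphere_dist_eq {R : ℝ} (hR : 0 < R) (z : ℂ) (hz : ‖z‖ ≤ R) :
    ∃ w : ℂ, ‖w‖ = R ∧ ‖z - w‖ = R - ‖z‖ := by
  by_cases h : z = 0
  · refine ⟨R, ?_, ?_⟩ <;> simp [h, abs_of_pos hR]
  · have hz0 : 0 < ‖z‖ := norm_pos_iff.2 h
    refine ⟨(R / ‖z‖ : ℝ) * z, ?_, ?_⟩
    · rw [norm_mul, Complex.norm_real, Real.norm_of_nonneg (by positivity)]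
      field_simp
    · have : z - (R / ‖z‖ : ℝ) * z = ((1 - R / ‖z‖ : ℝ) : ℂ) * z := by push_cast; ring
      rw [this, norm_mul, Complex.norm_real, Real.norm_of_nonpos]
      · field_simp; ring
      · rw [sub_nonpos, le_div_iff₀ hz0]; linarith

theorem memLp_two_ball {f : ℂ → ℂ} (hf : Continuous f) (R : ℝ) :
    MemLp f 2 (volume.restrict (Metric.ball (0 : ℂ) R)) := by
  obtain ⟨C, hC⟩ := (isCompact_closedBall (0 : ℂ) R).exists_bound_of_continuousOn hf.continuousOn
  have : IsFiniteMeasure (volume.restrict (Metric.ball (0 : ℂ) R)) :=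
    ⟨by rw [Measure.restrict_apply_univ]; exact measure_ball_lt_top⟩
  refine MemLp.of_bound hf.aestronglyMeasurable C ?_
  refine (ae_restrict_iff' Metric.isOpen_ball.measurableSet).2 (Eventually.of_forall ?_)
  exact fun z hz => hC z (Metric.ball_subset_closedBall hz)

/-- A smooth map that vanishes on the circle of radius `R` belongs to `H¹₀` of the disk. -/
theorem memH10_of_eq_zero_on_sphere {ζ : ℂ → ℂ} (hζ : ContDiff ℝ ∞ ζ) {R : ℝ} (hR : 0 < R)
    (h0 : ∀ z, ‖z‖ = R → ζ z = 0) : MemH10 R ζ (dx ζ) (dy ζ) := by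
  obtain ⟨C, hC0, hC⟩ := exists_deriv_smoothTransition_bound
  obtain ⟨K, hK⟩ := (isCompact_closedBall (0 : ℂ) R).exists_bound_of_continuousOn
    (hζ.continuous_fderiv (by simp)).continuousOn
  have hK0 : 0 ≤ K := (norm_nonneg _).trans (hK 0 (by simp [hR.le]))
  have hdiff : Differentiable ℝ ζ := hζ.differentiable (by simp)
  have hlip : ∀ z, ‖z‖ ≤ R → ‖ζ z‖ ≤ K * (R - ‖z‖) := by
    intro z hz
    obtain ⟨w, hw, hzw⟩ := exists_mem_sphere_dist_eq hR z hz
    have := (convex_closedBall (0 : ℂ) R).norm_image_sub_le_of_norm_fderiv_le (𝕜 := ℝ)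
      (f := ζ) (x := w) (y := z) (fun x _ => hdiff x) hK (by simp [hw]) (by simpa using hz)
    rwa [h0 w hw, sub_zero, hzw] at this
  -- c k is 1 where (k+1)(R² - |z|²) ≥ 2 and 0 where it is ≤ 1, so the layer where it varies shrinks
  -- to the circle.
  set c : ℕ → ℂ → ℝ := fun k => radialCutoff ((k + 1) * R ^ 2 - 1) (k + 1) with hc
  have hcs : ∀ k, ContDiff ℝ ∞ (c k) := fun k => contDiff_radialCutoff _ _
  have hφs : ∀ k, ContDiff ℝ ∞ fun z => c k z • ζ z := fun k => (hcs k).smul hζ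
  have hc1 : ∀ k z, |c k z - 1| ≤ 1 := by
    intro k z
    have h1 := Real.smoothTransition.nonneg ((k + 1 : ℝ) * R ^ 2 - 1 - (k + 1) * ‖z‖ ^ 2)
    have h2 := Real.smoothTransition.le_one ((k + 1 : ℝ) * R ^ 2 - 1 - (k + 1) * ‖z‖ ^ 2)
    rw [abs_le]
    constructor <;> simp only [hc, radialCutoff] <;> linarith
  have hone : ∀ z ∈ Metric.ball (0 : ℂ) R, ∀ᶠ k in atTop, c k =ᶠ[𝓝 z] fun _ => 1 := by
    intro z hz
    rw [mem_ball_zero_iff] at hz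
    have hpos : 0 < R ^ 2 - ‖z‖ ^ 2 := by nlinarith [norm_nonneg z]
    obtain ⟨k₀, hk₀⟩ := exists_nat_gt (2 / (R ^ 2 - ‖z‖ ^ 2))
    filter_upwards [eventually_ge_atTop k₀] with k hk
    apply radialCutoff_eventuallyEq_one
    rw [div_lt_iff₀ hpos] at hk₀
    have : (k₀ : ℝ) ≤ k := by exact_mod_cast hk
    nlinarith
  have hder : ∀ k z e, fderiv ℝ (fun z => c k z • ζ z) z e - fderiv ℝ ζ z e
      = (c k z - 1) • fderiv ℝ ζ z e + (fderiv ℝ (c k) z e) • ζ z := by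
    intro k z e
    rw [fderiv_fun_smul ((hcs k).differentiable (by simp) z) (hdiff z)]
    simp [sub_smul]
    ring
  have hbound : ∀ e : ℂ, ‖e‖ = 1 → ∀ k, ∀ z ∈ Metric.ball (0 : ℂ) R,
      ‖fderiv ℝ (fun z => c k z • ζ z) z e - fderiv ℝ ζ z e‖ ≤ K + 4 * C * K := by
    intro e he k z hz
    have hzc := Metric.ball_subset_closedBall hz
    rw [mem_ball_zero_iff] at hz
    rw [hder]
    refine (norm_add_le _ _).trans (add_le_add ?_ ?_)
    · rw [norm_smul, Real.norm_eq_abs]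
      have h1 : ‖fderiv ℝ ζ z e‖ ≤ K := by
        have := (fderiv ℝ ζ z).le_opNorm e
        rw [he, mul_one] at this
        exact this.trans (hK z hzc)
      calc _ ≤ 1 * K := mul_le_mul (hc1 k z) h1 (norm_nonneg _) zero_le_one
        _ = K := one_mul K
    · rw [norm_smul, Real.norm_eq_abs]
      have hk : (0 : ℝ) < k + 1 := by positivity
      by_cases hcase : 1 < ((k + 1) * R ^ 2 - 1 : ℝ) - (k + 1) * ‖z‖ ^ 2
      · have : fderiv ℝ (c k) z = 0 := by
          rw [(radialCutoff_eventuallyEq_one hcase).fderiv_eq]; simp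
        rw [this]; simp; positivity
      · have h2 := abs_fderiv_radialCutoff_le hC (p := (k + 1) * R ^ 2 - 1) hk.le z e
        have h3 : (k + 1) * (R - ‖z‖) * R ≤ 2 := by
          nlinarith [mul_nonneg hk.le (mul_nonneg (sub_nonneg.2 hz.le) (norm_nonneg z))]
        rw [he, mul_one] at h2
        calc |fderiv ℝ (c k) z e| * ‖ζ z‖
            ≤ (C * (2 * (k + 1) * ‖z‖)) * (K * (R - ‖z‖)) :=
              mul_le_mul h2 (hlip z hz.le) (norm_nonneg _) (by positivity)
          _ ≤ (C * (2 * (k + 1) * R)) * (K * (R - ‖z‖)) := by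
              have : 0 ≤ R - ‖z‖ := by linarith
              gcongr
          _ = 2 * C * K * ((k + 1) * (R - ‖z‖) * R) := by ring
          _ ≤ 2 * C * K * 2 := by gcongr
          _ = 4 * C * K := by ring
  have hlim : ∀ e : ℂ, ∀ z ∈ Metric.ball (0 : ℂ) R,
      Tendsto (fun k => fderiv ℝ (fun z => c k z • ζ z) z e - fderiv ℝ ζ z e) atTop (𝓝 0) := by
    intro e z hz
    refine tendsto_const_nhds.congr' ?_
    filter_upwards [hone z hz] with k hk
    rw [hder, hk.fderiv_eq, hk.self_of_nhds]
    simp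
  refine ⟨memLp_two_ball hζ.continuous R, memLp_two_ball (continuous_dx hζ) R,
    memLp_two_ball (continuous_dy hζ) R, fun k z => c k z • ζ z, fun k => ?_, ?_, ?_, ?_⟩
  · have hsub : tsupport (fun z => c k z • ζ z) ⊆ {z | 1 / (k + 1) ≤ R ^ 2 - ‖z‖ ^ 2} := by
      refine closure_minimal ?_ (isClosed_le continuous_const (by fun_prop))
      intro z hz
      by_contra hcon
      apply hz
      simp only [Set.mem_ofPred_eq, not_le] at hcon
      have : c k z = 0 := by
        apply Real.smoothTransition.zero_of_nonpos
        rw [lt_div_iff₀ (by positivity)] at hcon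
        linarith
      simp [this]
    have hsub2 : tsupport (fun z => c k z • ζ z) ⊆ Metric.ball (0 : ℂ) R := by
      refine hsub.trans fun z hz => ?_
      have h1 : (0 : ℝ) < 1 / (k + 1) := by positivity
      simp only [Set.mem_ofPred_eq] at hz
      rw [mem_ball_zero_iff]
      nlinarith [norm_nonneg z]
    refine ⟨hφs k, ?_, hsub2⟩
    exact (isCompact_closedBall (0 : ℂ) R).of_isClosed_subset (isClosed_tsupport _)
      (hsub2.trans Metric.ball_subset_closedBall)
  · refine tendsto_eLpNorm_ball_zero (C := K * R)
      (fun k => (hφs k).continuous.sub hζ.continuous) ?_ ?_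
    · intro k z hz
      rw [mem_ball_zero_iff] at hz
      have : c k z • ζ z - ζ z = (c k z - 1) • ζ z := by rw [sub_smul, one_smul]
      rw [this, norm_smul, Real.norm_eq_abs]
      calc _ ≤ 1 * (K * (R - ‖z‖)) :=
            mul_le_mul (hc1 k z) (hlip z hz.le) (norm_nonneg _) zero_le_one
        _ ≤ K * R := by rw [one_mul]; gcongr; linarith [norm_nonneg z]
    · intro z hz
      refine tendsto_const_nhds.congr' ?_
      filter_upwards [hone z hz] with k hk
      rw [hk.self_of_nhds]; simp
  · exact tendsto_eLpNorm_ball_zero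
      (fun k => (continuous_dx (hφs k)).sub (continuous_dx hζ)) (hbound 1 (by simp)) (hlim 1)
  · exact tendsto_eLpNorm_ball_zero
      (fun k => (continuous_dy (hφs k)).sub (continuous_dy hζ)) (hbound Complex.I (by simp))
      (hlim Complex.I)

theorem IsEquivariant.sub {d : ℤ} {s : ℤˣ} {u v : ℂ → ℂ} (hu : IsEquivariant d s u)
    (hv : IsEquivariant d s v) : IsEquivariant d s fun z => u z - v z := by
  refine ⟨fun z => ?_, fun z => ?_⟩
  · simp only [hu.1, hv.1]; ring
  · simp only [hu.2, hv.2, map_sub]; ring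

/-- A locally minimizing map has at most the energy of any smooth equivariant map with the same
values on the boundary circle. -/
theorem diskEnergy_le_of_eq_on_sphere {d : ℤ} {s : ℤˣ} {δ : ℝ} (hδ0 : 0 ≤ δ) (hδ1 : δ ≤ 1)
    {u v : ℂ → ℂ} (hu : ContDiff ℝ ∞ u) (hue : IsEquivariant d s u)
    (hmin : IsLocallyMinimizing d s δ u) (hv : ContDiff ℝ ∞ v) (hve : IsEquivariant d s v)
    {R : ℝ} (hR : 0 < R) (huv : ∀ z, ‖z‖ = R → v z = u z) :
    diskEnergy δ u R ≤ diskEnergy δ v R := by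
  -- The perturbation is ξ = v - u, which vanishes on the circle and inherits equivariance.
  have h := hmin R hR _ _ _ (memH10_of_eq_zero_on_sphere (hv.sub hu) hR
    (fun z hz => by rw [huv z hz, sub_self])) (hve.sub hue)
  have hd : ∀ z e, fderiv ℝ u z e + fderiv ℝ (fun z => v z - u z) z e = fderiv ℝ v z e := by
    intro z e
    rw [fderiv_fun_sub (hv.differentiable (by simp) z) (hu.differentiable (by simp) z)]
    simp
  have e1 : (fun z => u z + (v z - u z)) = v := by funext z; ring
  have e2 : (fun z => dx u z + dx (fun z => v z - u z) z) = dx v := by funext z; exact hd z 1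
  have e3 : (fun z => dy u z + dy (fun z => v z - u z) z) = dy v := by
    funext z; exact hd z Complex.I
  rw [e1, e2, e3, energy_eq_diskEnergy hδ0 hδ1 hu, energy_eq_diskEnergy hδ0 hδ1 hv] at h
  refine (ENNReal.ofReal_le_ofReal_iff ?_).1 h
  exact integral_nonneg (density_nonneg hδ0 hδ1 v)

/-! ### Caccioppoli inequality and linear growth of the energy. -/

/-- Expansion in y = t x: the first-order term of W((1-y)w) is (1-|w|²)|w|² y, taken in absolute
value because its sign is not known, and the rest is O(t²). -/
theorem W_smul_le {x t : ℝ} (hx : 0 ≤ x) (hx1 : x ≤ 1) (ht : 0 ≤ t) (ht1 : t ≤ 1) (w : ℂ) :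
    W ((1 - t * x) • w) ≤ W w + t * (x * (|1 - ‖w‖ ^ 2| * ‖w‖ ^ 2))
      + t ^ 2 * (2 * (‖w‖ ^ 2) ^ 2 + ‖w‖ ^ 2) := by
  unfold W
  rw [norm_smul, mul_pow, Real.norm_eq_abs, sq_abs]
  set m := ‖w‖ ^ 2 with hm
  have hm0 : 0 ≤ m := by positivity
  obtain ⟨y, hy⟩ : ∃ y, y = t * x := ⟨_, rfl⟩
  have hy0 : 0 ≤ y := by rw [hy]; positivity
  have hyt : y ≤ t := by rw [hy]; nlinarith
  have h1 : (1 - m) ≤ |1 - m| := le_abs_self _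
  have h2 : -|1 - m| ≤ (1 - m) := neg_abs_le _
  have h3 : |1 - m| ≤ 1 + m := by rw [abs_le]; constructor <;> linarith
  have e : t * (x * (|1 - m| * m)) = y * (|1 - m| * m) := by rw [hy]; ring
  rw [e, ← hy]
  have hyy : y ^ 2 ≤ t ^ 2 := by nlinarith
  have k1 : y ^ 2 * (2 * m ^ 2 + m) ≤ t ^ 2 * (2 * m ^ 2 + m) := by gcongr
  have k2 : (2 * y - y ^ 2) ^ 2 ≤ 4 * y ^ 2 := by
    have : 0 ≤ 2 * y - y ^ 2 := by nlinarith
    nlinarith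
  have k3 : (2 * y - y ^ 2) ^ 2 * m ^ 2 ≤ 4 * y ^ 2 * m ^ 2 := by gcongr
  have k4 : (1 - m) * m * y ≤ |1 - m| * m * y := by gcongr
  have k5 : -((1 - m) * (m * y ^ 2)) ≤ (1 + m) * (m * y ^ 2) := by
    have : 0 ≤ m * y ^ 2 := by positivity
    nlinarith
  nlinarith

/-- Upper bound for the energy density along the variation `t ↦ (1 - t c²) u`, where `g`, `h`
stand for the products of `u` with the partial derivatives of the cutoff `c`. -/
theorem energyDensity_variation_le {δ : ℝ} (hδ0 : 0 ≤ δ) (hδ1 : δ ≤ 1) {c t : ℝ}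
    (hc : 0 ≤ c) (hc1 : c ≤ 1) (ht : 0 ≤ t) (ht1 : t ≤ 1) (w p q g h : ℂ) :
    energyDensity δ ((1 - t * c ^ 2) • w) ((1 - t * c ^ 2) • p - (t * (2 * c)) • g)
        ((1 - t * c ^ 2) • q - (t * (2 * c)) • h)
      ≤ energyDensity δ w p q
        + t * (-(c ^ 2 * energyDensity δ 1 p q) + 4 * energyDensity δ 1 g h
          + c ^ 2 * (|1 - ‖w‖ ^ 2| * ‖w‖ ^ 2))
        + t ^ 2 * (energyDensity δ 1 (c ^ 2 • p + (2 * c) • g) (c ^ 2 • q + (2 * c) • h)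
          + (2 * (‖w‖ ^ 2) ^ 2 + ‖w‖ ^ 2)) := by
  have hW := W_smul_le (x := c ^ 2) (by positivity) (by nlinarith) ht ht1 w
  have hpos : 0 ≤ energyDensity δ 1 (c • p + (2 : ℝ) • g) (c • q + (2 : ℝ) • h) := by
    unfold energyDensity
    have : 0 ≤ (1 - δ) / 2 := by linarith
    have := W_nonneg 1
    positivity
  have hpos2 := mul_nonneg ht hpos
  -- For the quadratic form Q and its bilinear form B, the first-order coefficient is -2B(p, c²p +
  -- 2cg), summed over the partial derivatives. Completing the square turns it into -c²Q(p) + 4Q(g)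
  -- - Q(cp + 2g), and the last term is dropped by positivity. The value slot is 1 because W 1 = 0
  -- leaves only Q.
  have hid : energyDensity δ ((1 - t * c ^ 2) • w) ((1 - t * c ^ 2) • p - (t * (2 * c)) • g)
        ((1 - t * c ^ 2) • q - (t * (2 * c)) • h) - W ((1 - t * c ^ 2) • w)
      + t * energyDensity δ 1 (c • p + (2 : ℝ) • g) (c • q + (2 : ℝ) • h)
      = energyDensity δ w p q - W w
        + t * (-(c ^ 2 * energyDensity δ 1 p q) + 4 * energyDensity δ 1 g h)
        + t ^ 2 * energyDensity δ 1 (c ^ 2 • p + (2 * c) • g) (c ^ 2 • q + (2 * c) • h) := by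
    have hW1 : W 1 = 0 := by simp [W]
    unfold energyDensity
    rw [hW1]
    simp only [← Complex.normSq_eq_norm_sq, Complex.normSq_apply, Complex.add_re, Complex.add_im,
      Complex.sub_re, Complex.sub_im, Complex.smul_re, Complex.smul_im, smul_eq_mul]
    ring
  nlinarith

theorem exists_norm_le {u : ℂ → ℂ} (hu : Continuous u)
    (h : Tendsto (fun z => ‖u z‖) (cocompact ℂ) (𝓝 1)) : ∃ U : ℝ, 0 ≤ U ∧ ∀ z, ‖u z‖ ≤ U := by
  have h2 : ∀ᶠ z in cocompact ℂ, ‖u z‖ < 2 := h.eventually (gt_mem_nhds (by norm_num))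
  obtain ⟨K, hK, hKs⟩ := Filter.mem_cocompact.1 h2
  obtain ⟨C, hC⟩ := hK.exists_bound_of_continuousOn hu.continuousOn
  refine ⟨max C 2, by positivity, fun z => ?_⟩
  by_cases hz : z ∈ K
  · exact (hC z hz).trans (le_max_left _ _)
  · exact (hKs hz : ‖u z‖ < 2).le.trans (le_max_right _ _)

theorem setIntegral_ball_le_const {f : ℂ → ℝ} (hf : Continuous f) {R K : ℝ} (hR : 0 ≤ R)
    (h : ∀ z, ‖z‖ < R → f z ≤ K) :
    ∫ z in Metric.ball (0 : ℂ) R, f z ≤ K * (Real.pi * R ^ 2) := by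
  have hv : volume.real (Metric.ball (0 : ℂ) R) = Real.pi * R ^ 2 := by
    rw [Measure.real, Complex.volume_ball, ENNReal.toReal_mul, ENNReal.toReal_pow,
      ENNReal.toReal_ofReal hR, mul_comm]
    simp
  calc ∫ z in Metric.ball (0 : ℂ) R, f z ≤ ∫ _ in Metric.ball (0 : ℂ) R, K := by
        refine setIntegral_mono_on (integrableOn_ball hf R)
          (integrableOn_ball continuous_const R) Metric.isOpen_ball.measurableSet ?_
        exact fun z hz => h z (mem_ball_zero_iff.1 hz)
    _ = K * (Real.pi * R ^ 2) := by rw [setIntegral_const, hv, smul_eq_mul, mul_comm]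

/-- If a < 0, the case t = 1 gives b ≥ -a > 0, so the minimiser -a/(2b) is an admissible t, and the
value there is negative. -/
theorem nonneg_of_forall_linear_add_sq {a b : ℝ} (h : ∀ t, 0 < t → t ≤ 1 → 0 ≤ t * a + t ^ 2 * b) :
    0 ≤ a := by
  by_contra ha
  push Not at ha
  have h1 : 0 ≤ a + b := by simpa using h 1 one_pos le_rfl
  have hb : 0 < b := by linarith
  have h2 := h (-a / (2 * b)) (by apply div_pos <;> linarith)
    (by rw [div_le_one (by linarith)]; linarith)
  have : -a / (2 * b) * a + (-a / (2 * b)) ^ 2 * b = -(a ^ 2 / (4 * b)) := by field_simp; ring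
  rw [this] at h2
  have : 0 < a ^ 2 / (4 * b) := by have := ha.ne; positivity
  linarith

theorem IsEquivariant.radial_smul {d : ℤ} {s : ℤˣ} {u : ℂ → ℂ} (hu : IsEquivariant d s u)
    {c : ℂ → ℝ} (hc : ∀ z w, ‖z‖ = ‖w‖ → c z = c w) : IsEquivariant d s fun z => c z • u z := by
  refine ⟨fun z => ?_, fun z => ?_⟩
  · have h1 : ‖Complex.exp (Complex.I * (Real.pi / (1 - d)))‖ = 1 := by
      rw [mul_comm]
      exact_mod_cast Complex.norm_exp_ofReal_mul_I (Real.pi / (1 - d))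
    have h2 : c (Complex.exp (Complex.I * (Real.pi / (1 - d))) * z) = c z :=
      hc _ _ (by rw [norm_mul, h1, one_mul])
    simp only [hu.1, h2]
    simp only [Complex.real_smul]
    ring
  · have h2 : c (starRingEnd ℂ z) = c z := hc _ _ (by simp)
    simp only [hu.2, h2, Complex.real_smul, map_mul, Complex.conj_ofReal]
    ring

theorem energyDensity_le {δ : ℝ} (h0 : 0 ≤ δ) (w p q : ℂ) :
    energyDensity δ w p q ≤ (1 + 3 * δ) / 2 * (‖p‖ ^ 2 + ‖q‖ ^ 2) + W w := by
  unfold energyDensity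
  have h : (p.re + q.im) ^ 2 ≤ 2 * (‖p‖ ^ 2 + ‖q‖ ^ 2) := by
    simp only [← Complex.normSq_eq_norm_sq, Complex.normSq_apply]
    nlinarith [sq_nonneg (p.re - q.im), sq_nonneg p.im, sq_nonneg q.re]
  nlinarith [mul_le_mul_of_nonneg_left h h0]

/-- The one-sided first variation of a minimiser is nonnegative. An upper bound for the varied
density that is quadratic in t is enough, so no derivative in t is taken. -/
theorem integral_nonneg_of_variation {f a b : ℂ → ℝ} {v : ℝ → ℂ → ℝ} (hf : Continuous f)
    (ha : Continuous a) (hb : Continuous b) (hv : ∀ t, Continuous (v t)) (R : ℝ)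
    (hle : ∀ t, 0 < t → t ≤ 1 →
      ∫ z in Metric.ball (0 : ℂ) R, f z ≤ ∫ z in Metric.ball (0 : ℂ) R, v t z)
    (hpt : ∀ t, 0 < t → t ≤ 1 → ∀ z, v t z ≤ f z + t * a z + t ^ 2 * b z) :
    0 ≤ ∫ z in Metric.ball (0 : ℂ) R, a z := by
  refine nonneg_of_forall_linear_add_sq (b := ∫ z in Metric.ball (0 : ℂ) R, b z)
    fun t ht ht1 => ?_
  have h1 : ∫ z in Metric.ball (0 : ℂ) R, v t z
      ≤ ∫ z in Metric.ball (0 : ℂ) R, (f z + t * a z + t ^ 2 * b z) :=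
    setIntegral_mono_on (integrableOn_ball (hv t) R) (integrableOn_ball (by fun_prop) R)
      Metric.isOpen_ball.measurableSet fun z _ => hpt t ht ht1 z
  rw [integral_add (integrableOn_ball (by fun_prop) R) (integrableOn_ball (by fun_prop) R),
    integral_add (integrableOn_ball hf R) (integrableOn_ball (by fun_prop) R),
    integral_const_mul, integral_const_mul] at h1
  linarith [hle t ht ht1]

/-- Caccioppoli inequality for minimizers, tested with `c² u`. -/
theorem caccioppoli {d : ℤ} {s : ℤˣ} {δ : ℝ} (hδ0 : 0 ≤ δ) (hδ1 : δ ≤ 1)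
    {u : ℂ → ℂ} (hu : ContDiff ℝ ∞ u) (hue : IsEquivariant d s u)
    (hmin : IsLocallyMinimizing d s δ u) {c : ℂ → ℝ} (hcs : ContDiff ℝ ∞ c)
    (hcr : ∀ z w, ‖z‖ = ‖w‖ → c z = c w) (hc0 : ∀ z, 0 ≤ c z) (hc1 : ∀ z, c z ≤ 1)
    {R : ℝ} (hR : 0 < R) (hcR : ∀ z, ‖z‖ = R → c z = 0) :
    ∫ z in Metric.ball (0 : ℂ) R, c z ^ 2 * energyDensity δ 1 (dx u z) (dy u z)
      ≤ (∫ z in Metric.ball (0 : ℂ) R,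
          4 * energyDensity δ 1 (fderiv ℝ c z 1 • u z) (fderiv ℝ c z Complex.I • u z))
        + ∫ z in Metric.ball (0 : ℂ) R, c z ^ 2 * (|1 - ‖u z‖ ^ 2| * ‖u z‖ ^ 2) := by
  have hcd : ∀ e : ℂ, Continuous fun z => fderiv ℝ c z e := fun e =>
    (hcs.continuous_fderiv (by simp)).clm_apply continuous_const
  have k1 := hcd 1
  have k2 := hcd Complex.I
  have k3 := continuous_dx hu
  have k4 := continuous_dy hu
  have k5 := hu.continuous
  have k6 := hcs.continuous
  have k7 := continuous_W
  have i1 : Continuous fun z => c z ^ 2 * energyDensity δ 1 (dx u z) (dy u z) := by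
    unfold energyDensity; fun_prop
  have i2 : Continuous fun z =>
      4 * energyDensity δ 1 (fderiv ℝ c z 1 • u z) (fderiv ℝ c z Complex.I • u z) := by
    unfold energyDensity; fun_prop
  have i3 : Continuous fun z => c z ^ 2 * (|1 - ‖u z‖ ^ 2| * ‖u z‖ ^ 2) := by fun_prop
  have i4 : Continuous fun z =>
      energyDensity δ 1 (c z ^ 2 • dx u z + (2 * c z) • (fderiv ℝ c z 1 • u z))
        (c z ^ 2 • dy u z + (2 * c z) • (fderiv ℝ c z Complex.I • u z))
          + (2 * (‖u z‖ ^ 2) ^ 2 + ‖u z‖ ^ 2) := by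
    unfold energyDensity; fun_prop
  have hvs : ∀ t : ℝ, ContDiff ℝ ∞ fun z => (1 - t * c z ^ 2) • u z := fun t =>
    (contDiff_const.sub (contDiff_const.mul (hcs.pow 2))).smul hu
  have hder : ∀ (t : ℝ) z e, fderiv ℝ (fun z => (1 - t * c z ^ 2) • u z) z e
      = (1 - t * c z ^ 2) • fderiv ℝ u z e - (t * (2 * c z)) • (fderiv ℝ c z e • u z) := by
    intro t z e
    have hcz := (hcs.differentiable (by simp) z).hasFDerivAt
    have h1 : HasFDerivAt (fun z => 1 - t * c z ^ 2) (-(t • ((2 * c z) • fderiv ℝ c z))) z := by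
      have := ((hcz.pow 2).const_mul t).const_sub 1
      simpa using this
    rw [(h1.fun_smul (hu.differentiable (by simp) z).hasFDerivAt).fderiv]
    simp
    ring
  have hfin := integral_nonneg_of_variation (continuous_density δ hu) ((i1.neg.add i2).add i3) i4
    (fun t => continuous_density δ (hvs t)) R
    (fun t _ _ => diskEnergy_le_of_eq_on_sphere hδ0 hδ1 hu hue hmin (hvs t)
      (hue.radial_smul (c := fun z => 1 - t * c z ^ 2) fun z w h => by simp only [hcr z w h]) hR
      (fun z hz => by simp [hcR z hz]))
    (fun t ht ht1 z => by
      have h3 := energyDensity_variation_le hδ0 hδ1 (hc0 z) (hc1 z) ht.le ht1 (u z) (dx u z)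
        (dy u z) (fderiv ℝ c z 1 • u z) (fderiv ℝ c z Complex.I • u z)
      unfold density dx dy
      rw [hder, hder]
      exact h3)
  rw [integral_add' (integrableOn_ball (i1.neg.add i2) R) (integrableOn_ball i3 R),
    integral_add' (integrableOn_ball i1.neg R) (integrableOn_ball i2 R),
    integral_neg'] at hfin
  linarith

/-- In the Caccioppoli inequality the cutoff term is O(1), since |∇c|² = O(R⁻²) on an area O(R²).
The potential term involves only the first power of |1-|u|²|, and its integral over the disk is O(R)
because that of the square is finite. -/
theorem exists_diskEnergy_le_linear {d : ℤ} {s : ℤˣ} {δ : ℝ} (hδ0 : 0 ≤ δ) (hδ1 : δ < 1)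
    {u : ℂ → ℂ} (hu : IsEntireMinimizingSolution d s δ u) :
    ∃ C : ℝ, ∀ R : ℝ, 1 ≤ R → diskEnergy δ u R ≤ C * R := by
  obtain ⟨U, hU0, hU⟩ := exists_norm_le hu.smooth.continuous hu.norm_tendsto
  obtain ⟨S, hS0, hS⟩ := exists_deriv_smoothTransition_bound
  set I := ∫ z, W (u z) with hI
  have hI0 : 0 ≤ I := integral_nonneg fun z => W_nonneg _
  have hWball : ∀ R, ∫ z in Metric.ball (0 : ℂ) R, W (u z) ≤ I := fun R =>
    setIntegral_le_integral hu.potential_integrable (Eventually.of_forall fun z => W_nonneg _)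
  have kW : Continuous fun z => W (u z) := continuous_W.comp hu.smooth.continuous
  refine ⟨4096 * S ^ 2 * U ^ 2 + U ^ 2 * (2 * I + 2 * Real.pi) + I, fun R hR => ?_⟩
  have hR0 : 0 < R := by linarith
  -- The argument 2 - |z|²/R² is at least 1 on D_R and negative on the circle of radius 2R.
  set c := radialCutoff 2 (1 / R ^ 2) with hc
  have hcs : ContDiff ℝ ∞ c := contDiff_radialCutoff _ _
  have hc0 : ∀ z, 0 ≤ c z := fun z => Real.smoothTransition.nonneg _
  have hc1 : ∀ z, c z ≤ 1 := fun z => Real.smoothTransition.le_one _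
  have hcac := caccioppoli hδ0 hδ1.le hu.smooth hu.equivariant hu.minimizing hcs
    (fun z w h => by simp only [hc, radialCutoff, h]) hc0 hc1
    (R := 2 * R) (by linarith) (fun z hz => by
      apply Real.smoothTransition.zero_of_nonpos
      rw [hz]; field_simp; norm_num)
  have hcd : ∀ e : ℂ, Continuous fun z => fderiv ℝ c z e := fun e =>
    (hcs.continuous_fderiv (by simp)).clm_apply continuous_const
  have k1 := hcd 1
  have k2 := hcd Complex.I
  have k3 := continuous_dx hu.smooth
  have k4 := continuous_dy hu.smooth
  have k5 := hu.smooth.continuous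
  have k6 := hcs.continuous
  have i1 : Continuous fun z => c z ^ 2 * energyDensity δ 1 (dx u z) (dy u z) := by
    unfold energyDensity; fun_prop
  have i2 : Continuous fun z =>
      4 * energyDensity δ 1 (fderiv ℝ c z 1 • u z) (fderiv ℝ c z Complex.I • u z) := by
    unfold energyDensity; fun_prop
  have hW1 : W 1 = 0 := by simp [W]
  have b1 : ∫ z in Metric.ball (0 : ℂ) (2 * R),
      4 * energyDensity δ 1 (fderiv ℝ c z 1 • u z) (fderiv ℝ c z Complex.I • u z)
      ≤ (256 * S ^ 2 * U ^ 2 / R ^ 2) * (Real.pi * (2 * R) ^ 2) := by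
    refine setIntegral_ball_le_const i2 (by linarith) fun z hz => ?_
    have h1 := energyDensity_le hδ0 1 (fderiv ℝ c z 1 • u z) (fderiv ℝ c z Complex.I • u z)
    have h2 : ∀ e : ℂ, ‖e‖ = 1 → ‖fderiv ℝ c z e • u z‖ ^ 2 ≤ 16 * S ^ 2 * U ^ 2 / R ^ 2 := by
      intro e he
      have h3 := abs_fderiv_radialCutoff_le hS (p := 2) (q := 1 / R ^ 2) (by positivity) z e
      have h4 : ‖fderiv ℝ c z e • u z‖ ≤ 4 * S * U / R := by
        rw [norm_smul, Real.norm_eq_abs]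
        calc |fderiv ℝ c z e| * ‖u z‖ ≤ (S * (2 * (1 / R ^ 2) * (‖z‖ * ‖e‖))) * U :=
              mul_le_mul h3 (hU z) (norm_nonneg _) (by positivity)
          _ ≤ (S * (2 * (1 / R ^ 2) * (2 * R))) * U := by rw [he, mul_one]; gcongr
          _ = 4 * S * U / R := by field_simp; ring
      calc _ ≤ (4 * S * U / R) ^ 2 := by gcongr
        _ = _ := by ring
    have h5 := h2 1 (by simp)
    have h6 := h2 Complex.I (by simp)
    rw [hW1] at h1
    have h7 : (1 + 3 * δ) / 2 * (‖fderiv ℝ c z 1 • u z‖ ^ 2 + ‖fderiv ℝ c z Complex.I • u z‖ ^ 2)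
        ≤ 2 * (16 * S ^ 2 * U ^ 2 / R ^ 2 + 16 * S ^ 2 * U ^ 2 / R ^ 2) := by
      gcongr; linarith
    calc _ ≤ 4 * (2 * (16 * S ^ 2 * U ^ 2 / R ^ 2 + 16 * S ^ 2 * U ^ 2 / R ^ 2)) := by linarith
      _ = _ := by ring
  have b2 : ∫ z in Metric.ball (0 : ℂ) (2 * R), c z ^ 2 * (|1 - ‖u z‖ ^ 2| * ‖u z‖ ^ 2)
      ≤ U ^ 2 * (2 * I * R + 2 * Real.pi * R) := by
    have h1 : ∫ z in Metric.ball (0 : ℂ) (2 * R), c z ^ 2 * (|1 - ‖u z‖ ^ 2| * ‖u z‖ ^ 2)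
        ≤ ∫ z in Metric.ball (0 : ℂ) (2 * R), U ^ 2 * (2 * R * W (u z) + 1 / (2 * R)) := by
      refine setIntegral_mono_on (integrableOn_ball (by fun_prop) _)
        (integrableOn_ball (by fun_prop) _) Metric.isOpen_ball.measurableSet fun z _ => ?_
      -- Young's inequality with weight R: the first term integrates to O(R) by integrability of
      -- W(u), the second because the disk has area 4πR².
      have h2 : |1 - ‖u z‖ ^ 2| ≤ 2 * R * W (u z) + 1 / (2 * R) := by
        have h3 : 2 * R * W (u z) + 1 / (2 * R) - |1 - ‖u z‖ ^ 2|
            = (R * |1 - ‖u z‖ ^ 2| - 1) ^ 2 / (2 * R) := by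
          unfold W
          rw [← sq_abs (1 - ‖u z‖ ^ 2)]
          field_simp
          ring
        have : 0 ≤ (R * |1 - ‖u z‖ ^ 2| - 1) ^ 2 / (2 * R) := by positivity
        linarith
      have h4 : c z ^ 2 ≤ 1 := by nlinarith [hc0 z, hc1 z]
      have h5 : ‖u z‖ ^ 2 ≤ U ^ 2 := by have := hU z; gcongr
      calc c z ^ 2 * (|1 - ‖u z‖ ^ 2| * ‖u z‖ ^ 2)
          ≤ 1 * (|1 - ‖u z‖ ^ 2| * ‖u z‖ ^ 2) := by gcongr
        _ = ‖u z‖ ^ 2 * |1 - ‖u z‖ ^ 2| := by ring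
        _ ≤ _ := mul_le_mul h5 h2 (abs_nonneg _) (by positivity)
    refine h1.trans ?_
    rw [integral_const_mul]
    refine mul_le_mul_of_nonneg_left ?_ (by positivity)
    rw [integral_add (integrableOn_ball (by fun_prop) _) (integrableOn_ball continuous_const _),
      integral_const_mul]
    have h6 := setIntegral_ball_le_const (f := fun _ => 1 / (2 * R)) continuous_const
      (R := 2 * R) (by linarith) (fun z _ => le_rfl)
    have h7 : 1 / (2 * R) * (Real.pi * (2 * R) ^ 2) = 2 * Real.pi * R := by field_simp
    have h8 := mul_le_mul_of_nonneg_left (hWball (2 * R)) (by linarith : 0 ≤ 2 * R)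
    linarith
  have b3 : diskEnergy δ u R ≤ (∫ z in Metric.ball (0 : ℂ) (2 * R),
      c z ^ 2 * energyDensity δ 1 (dx u z) (dy u z)) + I := by
    have h1 : diskEnergy δ u R ≤ ∫ z in Metric.ball (0 : ℂ) R,
        (c z ^ 2 * energyDensity δ 1 (dx u z) (dy u z) + W (u z)) := by
      refine setIntegral_mono_on (integrableOn_ball (continuous_density δ hu.smooth) _)
        (integrableOn_ball (by fun_prop) _) Metric.isOpen_ball.measurableSet fun z hz => ?_
      rw [mem_ball_zero_iff] at hz
      have : c z = 1 := by
        apply Real.smoothTransition.one_of_one_le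
        have : 1 / R ^ 2 * ‖z‖ ^ 2 ≤ 1 := by
          rw [one_div, inv_mul_le_one₀ (by positivity)]
          gcongr
        linarith
      rw [this]
      unfold density energyDensity
      rw [hW1]
      linarith
    rw [integral_add (integrableOn_ball i1 _) (integrableOn_ball kW _)] at h1
    refine h1.trans (add_le_add ?_ (hWball R))
    refine setIntegral_mono_set (integrableOn_ball i1 _) (Eventually.of_forall fun z => ?_)
      (Metric.ball_subset_ball (by linarith)).eventuallyLE
    have : 0 ≤ (1 - δ) / 2 := by linarith
    have := W_nonneg 1
    simp only [Pi.zero_apply]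
    unfold energyDensity
    positivity
  have e1 : (256 * S ^ 2 * U ^ 2 / R ^ 2) * (Real.pi * (2 * R) ^ 2)
      = 1024 * Real.pi * (S ^ 2 * U ^ 2) := by field_simp; ring
  have e2 : 1024 * Real.pi * (S ^ 2 * U ^ 2) ≤ 4096 * S ^ 2 * U ^ 2 * R := by
    have h1 : 1024 * Real.pi ≤ 4096 := by linarith [Real.pi_le_four]
    have h2 : 0 ≤ S ^ 2 * U ^ 2 := by positivity
    nlinarith [mul_nonneg h2 (sub_nonneg.2 hR)]
  nlinarith

/-! ### Logarithmic lifts and winding along circles. -/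

/-- Λ is a primitive of w'/w, and w e^{-Λ} has zero derivative. -/
theorem exists_log_lift {w : ℝ → ℂ} (hw : ContDiff ℝ ∞ w) (h0 : ∀ θ, w θ ≠ 0) :
    ∃ Λ : ℝ → ℂ, ContDiff ℝ ∞ Λ ∧ (∀ θ, Complex.exp (Λ θ) = w θ) ∧
      ∀ θ, Λ θ = Complex.log (w 0) + ∫ t in (0 : ℝ)..θ, deriv w t / w t := by
  have hd : ContDiff ℝ ∞ (deriv w) := (contDiff_infty_iff_deriv.1 hw).2
  have hq : ContDiff ℝ ∞ fun t => deriv w t / w t := by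
    simp only [div_eq_mul_inv]
    exact hd.mul (hw.inv h0)
  set Λ : ℝ → ℂ := fun θ => Complex.log (w 0) + ∫ t in (0 : ℝ)..θ, deriv w t / w t with hΛ
  have hder : ∀ θ, HasDerivAt Λ (deriv w θ / w θ) θ := fun θ =>
    (hq.continuous.integral_hasStrictDerivAt 0 θ).hasDerivAt.const_add _
  have hΛs : ContDiff ℝ ∞ Λ := by
    refine contDiff_infty_iff_deriv.2 ⟨fun θ => (hder θ).differentiableAt, ?_⟩
    have : deriv Λ = fun t => deriv w t / w t := funext fun θ => (hder θ).deriv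
    rwa [this]
  refine ⟨Λ, hΛs, ?_, fun _ => rfl⟩
  have hconst : ∀ θ, HasDerivAt (fun θ => w θ * Complex.exp (-Λ θ)) 0 θ := by
    intro θ
    have h1 := ((hw.differentiable (by simp) θ).hasDerivAt).mul ((hder θ).neg.cexp)
    refine h1.congr_deriv ?_
    have := h0 θ
    field_simp
    simp
  intro θ
  have h2 := is_const_of_deriv_eq_zero (fun θ => (hconst θ).differentiableAt)
    (fun θ => (hconst θ).deriv) θ 0
  have h3 : Λ 0 = Complex.log (w 0) := by simp [hΛ]
  simp only [h3, Complex.exp_neg, Complex.exp_log (h0 0), mul_inv_cancel₀ (h0 0)] at h2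
  rw [mul_inv_eq_one₀ (Complex.exp_ne_zero _)] at h2
  exact h2.symm

/-- A differentiable curve cannot jump between the preimages of c under exp. This makes the integers
attached to lifts independent of θ. -/
theorem eq_of_exp_const {f : ℝ → ℂ} (hf : Differentiable ℝ f) {c : ℂ}
    (h : ∀ θ, Complex.exp (f θ) = c) (x y : ℝ) : f x = f y := by
  refine is_const_of_deriv_eq_zero hf (fun θ => ?_) x y
  have h1 := (hf θ).hasDerivAt.cexp
  have h2 : (fun θ => Complex.exp (f θ)) = fun _ => c := funext h
  rw [h2] at h1
  have h3 := h1.unique (hasDerivAt_const θ c)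
  exact (mul_eq_zero.1 h3).resolve_left (Complex.exp_ne_zero _)

theorem norm_circle {r : ℝ} (hr : 0 ≤ r) (θ : ℝ) : ‖(r : ℂ) * Complex.exp (Complex.I * θ)‖ = r := by
  rw [norm_mul, mul_comm Complex.I, Complex.norm_exp_ofReal_mul_I, mul_one,
    Complex.norm_real, Real.norm_of_nonneg hr]

/-- The derivative of `u` along the circle of radius `r`, with respect to the angle. -/
def tang (u : ℂ → ℂ) (r θ : ℝ) : ℂ :=
  fderiv ℝ u (r * Complex.exp (Complex.I * θ)) (Complex.I * (r * Complex.exp (Complex.I * θ)))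

theorem hasDerivAt_circle (r θ : ℝ) :
    HasDerivAt (fun θ : ℝ => (r : ℂ) * Complex.exp (Complex.I * θ))
      (Complex.I * (r * Complex.exp (Complex.I * θ))) θ := by
  have h1 : HasDerivAt (fun θ : ℝ => Complex.I * (θ : ℂ)) Complex.I θ := by
    simpa using (Complex.ofRealCLM.hasDerivAt (x := θ)).const_mul Complex.I
  have := (h1.cexp).const_mul (r : ℂ)
  exact this.congr_deriv (by ring)

theorem hasDerivAt_comp_circle {u : ℂ → ℂ} (hu : ContDiff ℝ ∞ u) (r θ : ℝ) :
    HasDerivAt (fun θ : ℝ => u (r * Complex.exp (Complex.I * θ))) (tang u r θ) θ :=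
  ((hu.differentiable (by simp) _).hasFDerivAt).comp_hasDerivAt θ (hasDerivAt_circle r θ)

theorem contDiff_circle (r : ℝ) :
    ContDiff ℝ ∞ fun θ : ℝ => (r : ℂ) * Complex.exp (Complex.I * θ) :=
  contDiff_const.mul ((contDiff_const.mul Complex.ofRealCLM.contDiff).cexp)

theorem continuous_tang {u : ℂ → ℂ} (hu : ContDiff ℝ ∞ u) :
    Continuous fun p : ℝ × ℝ => tang u p.1 p.2 := by
  have h := hu.continuous_fderiv (by simp)
  unfold tang
  exact (h.comp (by fun_prop)).clm_apply (by fun_prop)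

theorem norm_tang_sq_le (u : ℂ → ℂ) {r : ℝ} (hr : 0 ≤ r) (θ : ℝ) :
    ‖tang u r θ‖ ^ 2 ≤ r ^ 2 * ‖grad u (r * Complex.exp (Complex.I * θ))‖ ^ 2 := by
  have h := norm_sq_mul_norm_grad_sq u (r * Complex.exp (Complex.I * θ))
  rw [norm_circle hr] at h
  rw [h]
  exact le_add_of_nonneg_left (by positivity)

theorem rotate_circle (d : ℤ) (r θ : ℝ) :
    (r : ℂ) * Complex.exp (Complex.I * ((θ + Real.pi / (1 - d) : ℝ) : ℂ))
      = Complex.exp (Complex.I * (Real.pi / (1 - d))) * (r * Complex.exp (Complex.I * θ)) := by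
  push_cast
  rw [mul_add, Complex.exp_add]
  ring

theorem neg_exp_rotation {d : ℤ} (hd : d ≤ -1) :
    -Complex.exp (Complex.I * (Real.pi / (1 - d)))
      = Complex.exp (Complex.I * (Real.pi / (1 - d) * d)) := by
  have hd' : (1 - d : ℂ) ≠ 0 := by
    have : (1 - d : ℤ) ≠ 0 := by omega
    exact_mod_cast this
  have : Complex.I * (Real.pi / (1 - d) * d)
      = Complex.I * (Real.pi / (1 - d)) - Real.pi * Complex.I := by
    field_simp
    ring
  rw [this, Complex.exp_sub, Complex.exp_pi_mul_I]
  rw [div_neg, div_one]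

/-- Exponentiating the increment over an arc of angle π/(1-d) gives the equivariance multiplier
-e^{iπ/(1-d)} = e^{iπd/(1-d)}, so the increment is known up to 2πi times an integer. -/
theorem exists_winding {d : ℤ} (hd : d ≤ -1) {s : ℤˣ} {u : ℂ → ℂ} (hue : IsEquivariant d s u)
    {r : ℝ} {Λ : ℝ → ℂ} (hΛ : Differentiable ℝ Λ)
    (hexp : ∀ θ : ℝ, Complex.exp (Λ θ) = u (r * Complex.exp (Complex.I * θ))) :
    ∃ k : ℤ, ∀ θ, Λ (θ + Real.pi / (1 - d))
      = Λ θ + Complex.I * (Real.pi / (1 - d) * d + 2 * Real.pi * k) := by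
  have hf : Differentiable ℝ fun θ => Λ (θ + Real.pi / (1 - d)) - Λ θ :=
    (hΛ.comp (differentiable_id.add_const _)).sub hΛ
  have hc : ∀ θ, Complex.exp (Λ (θ + Real.pi / (1 - d)) - Λ θ)
      = Complex.exp (Complex.I * (Real.pi / (1 - d) * d)) := by
    intro θ
    have hne : u (r * Complex.exp (Complex.I * θ)) ≠ 0 := by
      rw [← hexp]; exact Complex.exp_ne_zero _
    rw [Complex.exp_sub, hexp, hexp, rotate_circle, hue.1, ← neg_exp_rotation hd]
    field_simp
  obtain ⟨k, hk⟩ := Complex.exp_eq_exp_iff_exists_int.1 (hc 0)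
  refine ⟨k, fun θ => ?_⟩
  have := eq_of_exp_const hf hc θ 0
  linear_combination this + hk

/-- The winding of an equivariant map along an arc of angle `π / (1 - d)` does not depend on the
radius of the circle as long as the map does not vanish. -/
theorem exists_winding_uniform {d : ℤ} (hd : d ≤ -1) {s : ℤˣ} {u : ℂ → ℂ}
    (hu : ContDiff ℝ ∞ u) (hue : IsEquivariant d s u) {r₀ : ℝ} (hr₀ : 0 ≤ r₀)
    (hne : ∀ z, r₀ ≤ ‖z‖ → u z ≠ 0) :
    ∃ k : ℤ, ∀ r, r₀ ≤ r → ∀ Λ : ℝ → ℂ, Differentiable ℝ Λ →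
      (∀ θ : ℝ, Complex.exp (Λ θ) = u (r * Complex.exp (Complex.I * θ))) →
      ∀ θ, Λ (θ + Real.pi / (1 - d))
        = Λ θ + Complex.I * (Real.pi / (1 - d) * d + 2 * Real.pi * k) := by
  have hne' : ∀ r θ : ℝ, u ((max r r₀ : ℝ) * Complex.exp (Complex.I * θ)) ≠ 0 := fun r θ =>
    hne _ (by rw [norm_circle (hr₀.trans (le_max_right _ _))]; exact le_max_right _ _)
  -- The radius is clamped to max r r₀ so that the integrand is defined and continuous for every
  -- real r. Constancy of the integer then follows from connectedness of ℝ.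
  set J : ℝ → ℂ := fun r => ∫ θ in (0 : ℝ)..(Real.pi / (1 - d)),
    tang u (max r r₀) θ / u ((max r r₀ : ℝ) * Complex.exp (Complex.I * θ)) with hJ
  have hJc : Continuous J := by
    apply intervalIntegral.continuous_parametric_intervalIntegral_of_continuous'
    have h1 : Continuous fun p : ℝ × ℝ => tang u (max p.1 r₀) p.2 :=
      (continuous_tang hu).comp (by fun_prop : Continuous fun p : ℝ × ℝ => (max p.1 r₀, p.2))
    have h2 : Continuous fun p : ℝ × ℝ =>
        u ((max p.1 r₀ : ℝ) * Complex.exp (Complex.I * p.2)) :=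
      hu.continuous.comp (by fun_prop)
    exact h1.div h2 fun p => hne' p.1 p.2
  have hlift : ∀ r : ℝ, ∀ Λ : ℝ → ℂ, Differentiable ℝ Λ →
      (∀ θ : ℝ, Complex.exp (Λ θ) = u ((max r r₀ : ℝ) * Complex.exp (Complex.I * θ))) →
      J r = Λ (Real.pi / (1 - d)) - Λ 0 := by
    intro r Λ hΛ hexp
    have hder : ∀ θ, HasDerivAt Λ
        (tang u (max r r₀) θ / u ((max r r₀ : ℝ) * Complex.exp (Complex.I * θ))) θ := by
      intro θ
      have h1 := (hΛ θ).hasDerivAt.cexp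
      have h2 : (fun θ => Complex.exp (Λ θ))
          = fun θ : ℝ => u ((max r r₀ : ℝ) * Complex.exp (Complex.I * θ)) := funext hexp
      rw [h2] at h1
      have h3 := h1.unique (hasDerivAt_comp_circle hu (max r r₀) θ)
      have h4 : deriv Λ θ
          = tang u (max r r₀) θ / u ((max r r₀ : ℝ) * Complex.exp (Complex.I * θ)) := by
        rw [eq_div_iff (hne' r θ), ← h3, ← hexp]; ring
      rw [← h4]
      exact (hΛ θ).hasDerivAt
    refine intervalIntegral.integral_eq_sub_of_hasDerivAt (fun θ _ => hder θ) ?_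
    apply Continuous.intervalIntegrable
    have h1 : Continuous fun θ : ℝ => tang u (max r r₀) θ :=
      (continuous_tang hu).comp (by fun_prop : Continuous fun θ : ℝ => (max r r₀, θ))
    have h2 : Continuous fun θ : ℝ => u ((max r r₀ : ℝ) * Complex.exp (Complex.I * θ)) :=
      hu.continuous.comp (by fun_prop)
    exact h1.div h2 fun θ => hne' r θ
  have hinteg : ∀ r : ℝ, ∃ k : ℤ,
      J r = Complex.I * (Real.pi / (1 - d) * d + 2 * Real.pi * k) := by
    intro r
    obtain ⟨Λ, hΛs, hexp, -⟩ := exists_log_lift (hu.comp (contDiff_circle (max r r₀))) (hne' r)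
    have hΛd : Differentiable ℝ Λ := hΛs.differentiable (by simp)
    obtain ⟨k, hk⟩ := exists_winding hd hue hΛd hexp
    refine ⟨k, ?_⟩
    have := hk 0
    rw [zero_add] at this
    rw [hlift r Λ hΛd hexp, this]
    ring
  choose κ hκ using hinteg
  have hκc : Continuous κ := by
    rw [Int.isClosedEmbedding_coe_real.isEmbedding.continuous_iff]
    have : ((fun m : ℤ => (m : ℝ)) ∘ κ)
        = fun r => ((J r).im - Real.pi / (1 - d) * d) / (2 * Real.pi) := by
      funext r
      have h1 : (J r).im = Real.pi / (1 - d) * d + 2 * Real.pi * κ r := by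
        rw [hκ r]
        have : (Complex.I * (Real.pi / (1 - d) * d + 2 * Real.pi * κ r) : ℂ)
            = Complex.I * ((Real.pi / (1 - d) * d + 2 * Real.pi * κ r : ℝ) : ℂ) := by
          push_cast; ring
        rw [this, Complex.I_mul_im, Complex.ofReal_re]
      have := Real.pi_pos
      rw [h1]
      simp only [Function.comp_apply]
      field_simp
      ring
    rw [this]
    fun_prop
  refine ⟨κ r₀, fun r hr Λ hΛ hexp θ => ?_⟩
  have hconst : κ r = κ r₀ := PreconnectedSpace.constant inferInstance hκc
  obtain ⟨k, hk⟩ := exists_winding hd hue hΛ hexp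
  have hmax : max r r₀ = r := max_eq_left hr
  have h1 := hlift r Λ hΛ (by rw [hmax]; exact hexp)
  have h2 := hk 0
  rw [zero_add] at h2
  rw [hκ r, h2, hconst] at h1
  rw [hk θ]
  linear_combination -h1

theorem iterate_shift {Λ : ℝ → ℂ} {α : ℝ} {c : ℂ} (h : ∀ θ, Λ (θ + α) = Λ θ + c) (m : ℕ) (θ : ℝ) :
    Λ (θ + m * α) = Λ θ + m * c := by
  induction m with
  | zero => simp
  | succ m ih =>
    have : θ + ((m + 1 : ℕ) : ℝ) * α = (θ + m * α) + α := by push_cast; ring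
    rw [this, h, ih]
    push_cast
    ring

theorem full_turn {d : ℤ} (hd : d ≤ -1) {Λ : ℝ → ℂ} {k : ℤ}
    (h : ∀ θ, Λ (θ + Real.pi / (1 - d))
        = Λ θ + Complex.I * (Real.pi / (1 - d) * d + 2 * Real.pi * k)) (θ : ℝ) :
    Λ (θ + 2 * Real.pi) = Λ θ + Complex.I * (2 * Real.pi * (d + 2 * (1 - d) * k)) := by
  -- A full turn consists of 2(1-d) arcs of angle π/(1-d).
  obtain ⟨n, hn⟩ : ∃ n : ℕ, (n : ℤ) = 2 * (1 - d) := ⟨(2 * (1 - d)).toNat, by omega⟩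
  have hnR : (n : ℝ) = 2 * (1 - d) := by exact_mod_cast hn
  have hnC : (n : ℂ) = 2 * (1 - d) := by exact_mod_cast hn
  have hdR : (1 - d : ℝ) ≠ 0 := by
    have : (1 - d : ℤ) ≠ 0 := by omega
    exact_mod_cast this
  have hdC : (1 - d : ℂ) ≠ 0 := by exact_mod_cast hdR
  have h1 := iterate_shift h n θ
  have h2 : θ + n * (Real.pi / (1 - d)) = θ + 2 * Real.pi := by
    rw [hnR]; field_simp
  rw [h2, hnC] at h1
  rw [h1]
  field_simp

theorem hasDegree_of_lift {d : ℤ} (hd : d ≤ -1) {u : ℂ → ℂ} {r : ℝ} {Λ : ℝ → ℂ}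
    (hΛ : Continuous Λ)
    (hexp : ∀ θ : ℝ, Complex.exp (Λ θ) = u (r * Complex.exp (Complex.I * θ)))
    (h : ∀ θ, Λ (θ + Real.pi / (1 - d))
        = Λ θ + Complex.I * (Real.pi / (1 - d) * d + 2 * Real.pi * (0 : ℤ))) :
    HasDegree u r d := by
  refine ⟨fun θ => by rw [← hexp]; exact Complex.exp_ne_zero _, fun θ => (Λ θ).im, by fun_prop,
    fun θ => ?_, ?_⟩
  · rw [← hexp, Complex.norm_exp]
    nth_rewrite 1 [← Complex.re_add_im (Λ θ)]
    rw [Complex.exp_add, Complex.ofReal_exp, mul_comm Complex.I]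
    field_simp
  · have h1 := full_turn hd h 0
    rw [zero_add] at h1
    simp only [h1]
    have : Complex.I * (2 * Real.pi * (d + 2 * (1 - d) * (0 : ℤ)))
        = Complex.I * ((2 * Real.pi * d : ℝ) : ℂ) := by push_cast; ring
    rw [this, Complex.add_im, Complex.I_mul_im, Complex.ofReal_re]
    ring

/-- Lower bound for the tangential energy on a circle in terms of the degree. -/
theorem integral_norm_tang_sq_ge {d : ℤ} (hd : d ≤ -1) {u : ℂ → ℂ} (hu : ContDiff ℝ ∞ u)
    {r : ℝ} {Λ : ℝ → ℂ} (hΛ : ContDiff ℝ ∞ Λ)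
    (hexp : ∀ θ : ℝ, Complex.exp (Λ θ) = u (r * Complex.exp (Complex.I * θ))) {k : ℤ}
    (h : ∀ θ, Λ (θ + Real.pi / (1 - d))
        = Λ θ + Complex.I * (Real.pi / (1 - d) * d + 2 * Real.pi * k))
    {m : ℝ} (hm : 0 ≤ m) (hum : ∀ θ : ℝ, m ≤ ‖u (r * Complex.exp (Complex.I * θ))‖) :
    m ^ 2 * (2 * Real.pi * (d + 2 * (1 - d) * k) ^ 2)
      ≤ ∫ θ in (-Real.pi)..Real.pi, ‖tang u r θ‖ ^ 2 := by
  set D : ℝ := d + 2 * (1 - d) * k with hD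
  have hΛd : Differentiable ℝ Λ := hΛ.differentiable (by simp)
  have hdc : Continuous (deriv Λ) := (contDiff_infty_iff_deriv.1 hΛ).2.continuous
  have htc : Continuous fun θ : ℝ => tang u r θ :=
    (continuous_tang hu).comp (by fun_prop : Continuous fun θ : ℝ => (r, θ))
  have htang : ∀ θ, tang u r θ = u (r * Complex.exp (Complex.I * θ)) * deriv Λ θ := by
    intro θ
    have h1 := (hΛd θ).hasDerivAt.cexp
    have h2 : (fun θ => Complex.exp (Λ θ))
        = fun θ : ℝ => u (r * Complex.exp (Complex.I * θ)) := funext hexp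
    rw [h2, hexp] at h1
    exact (hasDerivAt_comp_circle hu r θ).unique h1
  -- The tangent-line inequality x² ≥ 2Dx - D² replaces Cauchy–Schwarz. Its right side integrates
  -- exactly, because the mean of Im Λ' over the circle is D.
  have hpt : ∀ θ, m ^ 2 * (2 * D * (deriv Λ θ).im - D ^ 2) ≤ ‖tang u r θ‖ ^ 2 := by
    intro θ
    rw [htang, norm_mul, mul_pow]
    have h1 : 2 * D * (deriv Λ θ).im - D ^ 2 ≤ ‖deriv Λ θ‖ ^ 2 := by
      rw [← Complex.normSq_eq_norm_sq, Complex.normSq_apply]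
      nlinarith [sq_nonneg ((deriv Λ θ).im - D), sq_nonneg (deriv Λ θ).re]
    have h2 : m ^ 2 ≤ ‖u (r * Complex.exp (Complex.I * θ))‖ ^ 2 := by
      have := hum θ; gcongr
    calc _ ≤ m ^ 2 * ‖deriv Λ θ‖ ^ 2 := by gcongr
      _ ≤ _ := by gcongr
  have hinteg : ∫ θ in (-Real.pi)..Real.pi, (deriv Λ θ).im = 2 * Real.pi * D := by
    have h1 : ∀ θ, HasDerivAt (fun θ => (Λ θ).im) (deriv Λ θ).im θ := fun θ =>
      Complex.imCLM.hasFDerivAt.comp_hasDerivAt θ (hΛd θ).hasDerivAt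
    rw [intervalIntegral.integral_eq_sub_of_hasDerivAt (fun θ _ => h1 θ)
      (by apply Continuous.intervalIntegrable; fun_prop)]
    have h2 := full_turn hd h (-Real.pi)
    have h3 : -Real.pi + 2 * Real.pi = Real.pi := by ring
    have h4 : Complex.I * (2 * Real.pi * (d + 2 * (1 - d) * k))
        = Complex.I * ((2 * Real.pi * D : ℝ) : ℂ) := by rw [hD]; push_cast; ring
    rw [h3, h4] at h2
    rw [h2, Complex.add_im, Complex.I_mul_im, Complex.ofReal_re]
    ring
  calc m ^ 2 * (2 * Real.pi * D ^ 2)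
      = ∫ θ in (-Real.pi)..Real.pi, m ^ 2 * (2 * D * (deriv Λ θ).im - D ^ 2) := by
        rw [intervalIntegral.integral_const_mul, intervalIntegral.integral_sub
          (by apply Continuous.intervalIntegrable; fun_prop) (by simp),
          intervalIntegral.integral_const_mul, hinteg, intervalIntegral.integral_const]
        simp only [smul_eq_mul]
        ring
    _ ≤ _ := by
        refine intervalIntegral.integral_mono_on (by linarith [Real.pi_pos])
          (by apply Continuous.intervalIntegrable; fun_prop)
          (by apply Continuous.intervalIntegrable; fun_prop) fun θ _ => hpt θ

/-! ### Regularised vortices: Dirichlet and potential energies. -/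

/-- The regularized phase `w / √(|w|² + μ²)`. -/
def core (μ : ℝ) (w : ℂ) : ℂ := (√(‖w‖ ^ 2 + μ ^ 2))⁻¹ • w

theorem contDiff_core {μ : ℝ} (hμ : 0 < μ) : ContDiff ℝ ∞ (core μ) := by
  have h : ∀ w : ℂ, ‖w‖ ^ 2 + μ ^ 2 ≠ 0 := fun w => by positivity
  have h1 : ContDiff ℝ ∞ fun w : ℂ => √(‖w‖ ^ 2 + μ ^ 2) :=
    ((contDiff_norm_sq ℝ).add contDiff_const).sqrt h
  exact (h1.inv fun w => (Real.sqrt_ne_zero'.2 (by positivity))).smul contDiff_id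

theorem norm_core_sq {μ : ℝ} (hμ : 0 < μ) (w : ℂ) :
    ‖core μ w‖ ^ 2 = ‖w‖ ^ 2 / (‖w‖ ^ 2 + μ ^ 2) := by
  unfold core
  rw [norm_smul, mul_pow, Real.norm_eq_abs, sq_abs, inv_pow, Real.sq_sqrt (by positivity)]
  ring

theorem one_sub_norm_core_sq {μ : ℝ} (hμ : 0 < μ) (w : ℂ) :
    1 - ‖core μ w‖ ^ 2 = μ ^ 2 / (‖w‖ ^ 2 + μ ^ 2) := by
  rw [norm_core_sq hμ]
  have : ‖w‖ ^ 2 + μ ^ 2 ≠ 0 := by positivity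
  field_simp
  ring

theorem norm_core_le_one {μ : ℝ} (hμ : 0 < μ) (w : ℂ) : ‖core μ w‖ ≤ 1 := by
  have h := one_sub_norm_core_sq hμ w
  have : 0 ≤ μ ^ 2 / (‖w‖ ^ 2 + μ ^ 2) := by positivity
  nlinarith [norm_nonneg (core μ w)]

/-- With P = |w|² + μ², the differential of `core μ` at w has the factors μ²/P^{3/2} radially and
1/√P tangentially. A holomorphic inner map is conformal, so it only multiplies both by |f'|. -/
theorem norm_grad_core_comp_sq {μ : ℝ} (hμ : 0 < μ) {f : ℂ → ℂ} {f' z : ℂ}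
    (hf : HasDerivAt f f' z) :
    ‖grad (fun z => core μ (f z)) z‖ ^ 2
      = ‖f'‖ ^ 2 * (1 / (‖f z‖ ^ 2 + μ ^ 2) + μ ^ 4 / (‖f z‖ ^ 2 + μ ^ 2) ^ 3) := by
  set P := ‖f z‖ ^ 2 + μ ^ 2 with hP
  have hP0 : 0 < P := by positivity
  have hsq : HasFDerivAt (fun w : ℂ => ‖w‖ ^ 2 + μ ^ 2) (2 • innerSL ℝ (f z)) (f z) :=
    (hasStrictFDerivAt_norm_sq (f z)).hasFDerivAt.add_const _
  have hs := (hsq.sqrt hP0.ne')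
  have hsi := (hasDerivAt_inv (Real.sqrt_ne_zero'.2 hP0)).comp_hasFDerivAt (f z) hs
  have hcore : HasFDerivAt (core μ) _ (f z) := hsi.fun_smul (hasFDerivAt_id (f z))
  have hcomp := hcore.comp z (hf.hasFDerivAt.restrictScalars ℝ)
  have hval : ∀ e : ℂ, fderiv ℝ (fun z => core μ (f z)) z e
      = (√P)⁻¹ • (e * f') - ((√P)⁻¹ ^ 3 * inner ℝ (f z) (e * f')) • f z := by
    intro e
    have : (fun z => core μ (f z)) = core μ ∘ f := rfl
    rw [this, hcomp.fderiv]
    have h3 : √P ≠ 0 := Real.sqrt_ne_zero'.2 hP0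
    simp only [← hP]
    simp [sub_eq_add_neg, ← hP]
    left
    field_simp
  rw [norm_grad_sq]
  unfold dx dy
  rw [hval, hval]
  have hinv : (√P)⁻¹ ^ 2 = 1 / P := by rw [inv_pow, Real.sq_sqrt hP0.le, one_div]
  set q := (√P)⁻¹ with hq
  have hP1 : μ ^ 2 = P - ‖f z‖ ^ 2 := by rw [hP]; ring
  have hμ4 : μ ^ 4 = (P - ‖f z‖ ^ 2) ^ 2 := by rw [← hP1]; ring
  have e1 : (1 : ℝ) / P = q ^ 2 := hinv.symm
  have e2 : μ ^ 4 / P ^ 3 = (1 - q ^ 2 * ‖f z‖ ^ 2) ^ 2 * q ^ 2 := by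
    rw [hμ4, hinv]; field_simp
  rw [e1, e2]
  simp only [← Complex.normSq_eq_norm_sq, Complex.normSq_apply, Complex.inner,
    Complex.sub_re, Complex.sub_im, Complex.smul_re, Complex.smul_im, smul_eq_mul, one_mul,
    Complex.mul_re, Complex.mul_im, Complex.I_re, Complex.I_im, Complex.conj_re, Complex.conj_im]
  ring

/-- Change of variables by a power map on disks. -/
theorem integral_ball_pow {f : ℂ → ℝ} (hf : Continuous f) {m : ℕ} (hm : m ≠ 0) {R : ℝ}
    (hR : 0 ≤ R) :
    ∫ z in Metric.ball (0 : ℂ) R, (m : ℝ) ^ 2 * ‖z‖ ^ (2 * (m - 1)) * f (z ^ m)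
      = m * ∫ w in Metric.ball (0 : ℂ) (R ^ m), f w := by
  have hm0 : (m : ℝ) ≠ 0 := by exact_mod_cast hm
  rw [integral_ball_eq_polar (by fun_prop) hR, integral_ball_eq_polar hf (by positivity)]
  set H : ℝ → ℝ := fun s => ∫ θ in (-Real.pi)..Real.pi, f (s * Complex.exp (Complex.I * θ)) with hH
  have hHc : Continuous H := continuous_circle_integral hf
  have hinner : ∀ r : ℝ, ∫ θ in (-Real.pi)..Real.pi,
      f ((r * Complex.exp (Complex.I * θ)) ^ m) = H (r ^ m) := by
    intro r
    set g : ℝ → ℝ := fun φ => f ((r ^ m : ℝ) * Complex.exp (Complex.I * φ)) with hg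
    have hper : Function.Periodic g (2 * Real.pi) := by
      intro φ
      simp only [hg]
      congr 2
      push_cast
      rw [mul_add, Complex.exp_add]
      have : Complex.I * (2 * Real.pi) = 2 * Real.pi * Complex.I := by ring
      rw [this, Complex.exp_two_pi_mul_I, mul_one]
    have h1 : ∀ θ : ℝ, f ((r * Complex.exp (Complex.I * θ)) ^ m) = g (m * θ) := by
      intro θ
      simp only [hg]
      rw [mul_pow, ← Complex.exp_nat_mul]
      push_cast
      congr 3
      ring
    simp_rw [h1]
    rw [intervalIntegral.integral_comp_mul_left g hm0]
    -- As θ makes one turn, mθ makes m of them. Periodicity replaces the long interval by m copies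
    -- of one period, and the factor m cancels the m⁻¹ of the substitution.
    have h2 : (m : ℝ) * Real.pi = (m : ℝ) * -Real.pi + m • (2 * Real.pi) := by
      rw [nsmul_eq_mul]; ring
    have h3 := hper.intervalIntegral_add_zsmul_eq m ((m : ℝ) * -Real.pi)
      (fun t₁ t₂ => by apply Continuous.intervalIntegrable; fun_prop)
    have h4 := hper.intervalIntegral_add_eq ((m : ℝ) * -Real.pi) (-Real.pi)
    rw [h2]
    simp only [natCast_zsmul] at h3
    rw [h3, h4]
    have h5 : -Real.pi + 2 * Real.pi = Real.pi := by ring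
    rw [h5, nsmul_eq_mul, smul_eq_mul, inv_mul_cancel_left₀ hm0]
  have hsub := intervalIntegral.integral_comp_mul_deriv (a := 0) (b := R) (f := fun r : ℝ => r ^ m)
    (f' := fun r => (m : ℝ) * r ^ (m - 1)) (g := fun s => s * H s)
    (fun x _ => hasDerivAt_pow m x) (by fun_prop) (by fun_prop)
  rw [zero_pow hm] at hsub
  rw [← hsub, ← intervalIntegral.integral_const_mul]
  refine intervalIntegral.integral_congr fun r hr => ?_
  rw [Set.uIcc_of_le hR] at hr
  simp only [Function.comp_apply]
  have h6 : ∀ θ : ℝ, (m : ℝ) ^ 2 * ‖(r : ℂ) * Complex.exp (Complex.I * θ)‖ ^ (2 * (m - 1))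
      * f ((r * Complex.exp (Complex.I * θ)) ^ m)
      = (m : ℝ) ^ 2 * r ^ (2 * (m - 1)) * f ((r * Complex.exp (Complex.I * θ)) ^ m) := by
    intro θ; rw [norm_circle hr.1]
  simp_rw [h6]
  rw [intervalIntegral.integral_const_mul, hinner]
  obtain ⟨j, rfl⟩ : ∃ j, m = j + 1 := ⟨m - 1, by omega⟩
  simp only [Nat.add_sub_cancel]
  ring

theorem integral_ball_translate_le {f : ℂ → ℝ} (hf : Continuous f) (h0 : ∀ z, 0 ≤ f z)
    {A : ℂ} {S ρ : ℝ} (h : S + ‖A‖ ≤ ρ) :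
    ∫ w in Metric.ball (0 : ℂ) S, f (w - A) ≤ ∫ w in Metric.ball (0 : ℂ) ρ, f w := by
  have h1 := (measurePreserving_sub_right (volume : Measure ℂ) A).setIntegral_preimage_emb
    (MeasurableEquiv.subRight A).measurableEmbedding f (Metric.ball (-A) S)
  have h2 : (fun w => w - A) ⁻¹' Metric.ball (-A) S = Metric.ball (0 : ℂ) S := by
    ext w
    simp [Metric.mem_ball, dist_eq_norm]
  rw [h2] at h1
  rw [h1]
  refine setIntegral_mono_set (integrableOn_ball hf _) (Eventually.of_forall h0)
    (Metric.ball_subset_ball' ?_).eventuallyLE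
  simpa using h

theorem integral_ball_radial {g : ℝ → ℝ} (hg : Continuous fun z : ℂ => g ‖z‖)
    {G : ℝ → ℝ} {ρ : ℝ} (hρ : 0 ≤ ρ)
    (hG : ∀ r, HasDerivAt G (r * g r) r) (hc : Continuous fun r => r * g r) :
    ∫ z in Metric.ball (0 : ℂ) ρ, g ‖z‖ = 2 * Real.pi * (G ρ - G 0) := by
  rw [integral_ball_eq_polar hg hρ,
    ← intervalIntegral.integral_eq_sub_of_hasDerivAt (fun r _ => hG r) (hc.intervalIntegrable _ _),
    ← intervalIntegral.integral_const_mul]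
  refine intervalIntegral.integral_congr fun r hr => ?_
  rw [Set.uIcc_of_le hρ] at hr
  simp only [norm_circle hr.1]
  rw [intervalIntegral.integral_const, smul_eq_mul]
  ring

theorem hasDerivAt_sq_add (μ r : ℝ) : HasDerivAt (fun r : ℝ => r ^ 2 + μ ^ 2) (2 * r) r := by
  simpa using (hasDerivAt_pow 2 r).add_const (μ ^ 2)

/-- In polar coordinates the integrand has an explicit primitive. The term 1/P gives the logarithm,
the term μ⁴/P³ at most π/2 whatever μ and ρ are. -/
theorem integral_ball_dirichlet_le {μ ρ : ℝ} (hμ : 0 < μ) (hρ : 0 ≤ ρ) :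
    ∫ z in Metric.ball (0 : ℂ) ρ, (1 / (‖z‖ ^ 2 + μ ^ 2) + μ ^ 4 / (‖z‖ ^ 2 + μ ^ 2) ^ 3)
      ≤ Real.pi * Real.log (1 + ρ ^ 2 / μ ^ 2) + Real.pi / 2 := by
  have hpos : ∀ r : ℝ, 0 < r ^ 2 + μ ^ 2 := fun r => by positivity
  have hne : ∀ r : ℝ, r ^ 2 + μ ^ 2 ≠ 0 := fun r => (hpos r).ne'
  have hne3 : ∀ r : ℝ, (r ^ 2 + μ ^ 2) ^ 3 ≠ 0 := fun r => pow_ne_zero 3 (hne r)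
  have hG : ∀ r : ℝ, HasDerivAt
      (fun r => Real.log (r ^ 2 + μ ^ 2) / 2 + -(μ ^ 4 / 4) * ((r ^ 2 + μ ^ 2) ^ 2)⁻¹)
      (r * (1 / (r ^ 2 + μ ^ 2) + μ ^ 4 / (r ^ 2 + μ ^ 2) ^ 3)) r := by
    intro r
    have h := hasDerivAt_sq_add μ r
    have h1 := (h.log (hne r)).div_const 2
    have h2 := ((h.fun_pow 2).fun_inv (pow_ne_zero 2 (hne r))).const_mul (-(μ ^ 4 / 4))
    refine (h1.fun_add h2).congr_deriv ?_
    have := hne r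
    field_simp
    ring
  have hc1 : Continuous fun z : ℂ =>
      (1 / (‖z‖ ^ 2 + μ ^ 2) + μ ^ 4 / (‖z‖ ^ 2 + μ ^ 2) ^ 3) := by
    refine (continuous_const.div (by fun_prop) fun z => hne ‖z‖).add
      (continuous_const.div (by fun_prop) fun z => hne3 ‖z‖)
  have hc2 : Continuous fun r : ℝ =>
      r * (1 / (r ^ 2 + μ ^ 2) + μ ^ 4 / (r ^ 2 + μ ^ 2) ^ 3) := by
    refine continuous_id.mul ((continuous_const.div (by fun_prop) fun z => hne z).add
      (continuous_const.div (by fun_prop) fun z => hne3 z))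
  rw [integral_ball_radial (g := fun r => 1 / (r ^ 2 + μ ^ 2) + μ ^ 4 / (r ^ 2 + μ ^ 2) ^ 3)
    hc1 hρ hG hc2]
  have h3 : 1 + ρ ^ 2 / μ ^ 2 = (ρ ^ 2 + μ ^ 2) / μ ^ 2 := by field_simp; ring
  rw [h3, Real.log_div (hne ρ) (by positivity)]
  have h4 : 0 ≤ μ ^ 4 / 4 * ((ρ ^ 2 + μ ^ 2) ^ 2)⁻¹ := by positivity
  have h5 : μ ^ 4 / 4 * ((0 ^ 2 + μ ^ 2) ^ 2)⁻¹ = 1 / 4 := by field_simp; ring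
  have h6 : (0 : ℝ) ^ 2 + μ ^ 2 = μ ^ 2 := by ring
  rw [h6] at h5
  rw [h6]
  have := Real.pi_pos
  nlinarith

theorem integral_ball_potential_le {μ ρ : ℝ} (hμ : 0 < μ) (hρ : 0 ≤ ρ) :
    ∫ z in Metric.ball (0 : ℂ) ρ, μ ^ 2 / (‖z‖ ^ 2 + μ ^ 2) ^ 2 ≤ Real.pi := by
  have hne : ∀ r : ℝ, r ^ 2 + μ ^ 2 ≠ 0 := fun r => by positivity
  have hne2 : ∀ r : ℝ, (r ^ 2 + μ ^ 2) ^ 2 ≠ 0 := fun r => pow_ne_zero 2 (hne r)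
  have hG : ∀ r : ℝ, HasDerivAt (fun r => -(μ ^ 2 / 2) * (r ^ 2 + μ ^ 2)⁻¹)
      (r * (μ ^ 2 / (r ^ 2 + μ ^ 2) ^ 2)) r := by
    intro r
    refine (((hasDerivAt_sq_add μ r).fun_inv (hne r)).const_mul (-(μ ^ 2 / 2))).congr_deriv ?_
    have := hne r
    field_simp
  have hc1 : Continuous fun z : ℂ => μ ^ 2 / (‖z‖ ^ 2 + μ ^ 2) ^ 2 :=
    continuous_const.div (by fun_prop) fun z => hne2 ‖z‖
  have hc2 : Continuous fun r : ℝ => r * (μ ^ 2 / (r ^ 2 + μ ^ 2) ^ 2) :=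
    continuous_id.mul (continuous_const.div (by fun_prop) fun z => hne2 z)
  rw [integral_ball_radial (g := fun r => μ ^ 2 / (r ^ 2 + μ ^ 2) ^ 2) hc1 hρ hG hc2]
  have h4 : 0 ≤ μ ^ 2 / 2 * (ρ ^ 2 + μ ^ 2)⁻¹ := by positivity
  have h6 : (0 : ℝ) ^ 2 + μ ^ 2 = μ ^ 2 := by ring
  have h5 : μ ^ 2 / 2 * (μ ^ 2)⁻¹ = 1 / 2 := by field_simp
  rw [h6]
  have := Real.pi_pos
  nlinarith

/-- The regularized phase of `z ^ m - A`. -/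
def powCore (m : ℕ) (A μ : ℝ) (z : ℂ) : ℂ := core μ (z ^ m - A)

theorem contDiff_powCore (m : ℕ) (A : ℝ) {μ : ℝ} (hμ : 0 < μ) :
    ContDiff ℝ ∞ (powCore m A μ) :=
  (contDiff_core hμ).comp ((contDiff_id.pow m).sub contDiff_const)

theorem norm_grad_powCore_sq (m : ℕ) (A : ℝ) {μ : ℝ} (hμ : 0 < μ) (z : ℂ) :
    ‖grad (powCore m A μ) z‖ ^ 2 = (m : ℝ) ^ 2 * ‖z‖ ^ (2 * (m - 1)) *
      (1 / (‖z ^ m - A‖ ^ 2 + μ ^ 2) + μ ^ 4 / (‖z ^ m - A‖ ^ 2 + μ ^ 2) ^ 3) := by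
  have h := norm_grad_core_comp_sq hμ ((hasDerivAt_pow m z).sub_const (A : ℂ))
  have e : ‖(m : ℂ) * z ^ (m - 1)‖ ^ 2 = (m : ℝ) ^ 2 * ‖z‖ ^ (2 * (m - 1)) := by
    rw [norm_mul, norm_pow, Complex.norm_natCast]; ring
  rw [e] at h
  exact h

/-- The substitution w = z^m turns the m vertices into m copies of one vortex at A. Translating it
to the origin enlarges the disk by |A|. -/
theorem integral_norm_grad_powCore_sq_le {m : ℕ} (hm : m ≠ 0) {A μ R ρ : ℝ} (hμ : 0 < μ)
    (hR : 0 ≤ R) (hρ : R ^ m + |A| ≤ ρ) :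
    ∫ z in Metric.ball (0 : ℂ) R, ‖grad (powCore m A μ) z‖ ^ 2
      ≤ m * (Real.pi * Real.log (1 + ρ ^ 2 / μ ^ 2) + Real.pi / 2) := by
  have hne : ∀ w : ℂ, ‖w‖ ^ 2 + μ ^ 2 ≠ 0 := fun w => by positivity
  have hf : Continuous fun w : ℂ =>
      (1 / (‖w‖ ^ 2 + μ ^ 2) + μ ^ 4 / (‖w‖ ^ 2 + μ ^ 2) ^ 3) :=
    (continuous_const.div (by fun_prop) hne).add
      (continuous_const.div (by fun_prop) fun w => pow_ne_zero 3 (hne w))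
  have h1 := integral_ball_pow (f := fun w : ℂ =>
    (1 / (‖w - A‖ ^ 2 + μ ^ 2) + μ ^ 4 / (‖w - A‖ ^ 2 + μ ^ 2) ^ 3))
    (hf.comp (continuous_id.sub continuous_const)) hm hR
  have h2 := integral_ball_translate_le hf (fun z => by positivity) (A := A) (S := R ^ m) (ρ := ρ)
    (by rwa [Complex.norm_real])
  simp_rw [norm_grad_powCore_sq m A hμ]
  rw [h1]
  refine mul_le_mul_of_nonneg_left (h2.trans (integral_ball_dirichlet_le hμ ?_)) (by positivity)
  exact le_trans (by positivity) hρ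

theorem integral_potential_powCore_le {m : ℕ} (hm : m ≠ 0) {A μ R : ℝ} (hμ : 0 < μ)
    (hR : 0 ≤ R) :
    ∫ z in Metric.ball (0 : ℂ) R, (m : ℝ) ^ 2 * ‖z‖ ^ (2 * (m - 1)) *
      (μ ^ 2 / (‖z ^ m - A‖ ^ 2 + μ ^ 2) ^ 2) ≤ m * Real.pi := by
  have hne : ∀ w : ℂ, ‖w‖ ^ 2 + μ ^ 2 ≠ 0 := fun w => by positivity
  have hf : Continuous fun w : ℂ => μ ^ 2 / (‖w‖ ^ 2 + μ ^ 2) ^ 2 :=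
    continuous_const.div (by fun_prop) fun w => pow_ne_zero 2 (hne w)
  have h1 := integral_ball_pow (f := fun w : ℂ => μ ^ 2 / (‖w - A‖ ^ 2 + μ ^ 2) ^ 2)
    (hf.comp (continuous_id.sub continuous_const)) hm hR
  have h2 := integral_ball_translate_le hf (fun z => by positivity) (A := A) (S := R ^ m)
    (ρ := R ^ m + |A|) (by rw [Complex.norm_real]; rfl)
  rw [h1]
  refine mul_le_mul_of_nonneg_left (h2.trans (integral_ball_potential_le hμ ?_)) (by positivity)
  positivity

/-- Away from the zeros of z^m - A the gradient is bounded independently of μ. Applied well inside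
and well outside the polygon, this gives O(1/R). -/
theorem norm_grad_powCore_le (m : ℕ) (A : ℝ) {μ : ℝ} (hμ : 0 < μ) {z : ℂ} {b : ℝ} (hb : 0 < b)
    (h : b ≤ ‖z ^ m - A‖) : ‖grad (powCore m A μ) z‖ ≤ 2 * m * ‖z‖ ^ (m - 1) / b := by
  refine le_of_sq_le_sq ?_ (by positivity)
  rw [norm_grad_powCore_sq m A hμ]
  set P := ‖z ^ m - A‖ ^ 2 + μ ^ 2 with hP
  have hbP : b ^ 2 ≤ P := by
    have : b ^ 2 ≤ ‖z ^ m - A‖ ^ 2 := by gcongr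
    nlinarith [sq_nonneg μ]
  have hP0 : 0 < P := lt_of_lt_of_le (by positivity) hbP
  have h1 : μ ^ 4 / P ^ 3 ≤ 1 / P := by
    rw [div_le_div_iff₀ (by positivity) hP0]
    have : μ ^ 2 ≤ P := by rw [hP]; nlinarith [norm_nonneg (z ^ m - A)]
    have h2 : μ ^ 4 ≤ P ^ 2 := by nlinarith [sq_nonneg μ]
    nlinarith
  have h2 : 1 / P ≤ 1 / b ^ 2 := one_div_le_one_div_of_le (by positivity) hbP
  calc (m : ℝ) ^ 2 * ‖z‖ ^ (2 * (m - 1)) * (1 / P + μ ^ 4 / P ^ 3)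
      ≤ (m : ℝ) ^ 2 * ‖z‖ ^ (2 * (m - 1)) * (1 / b ^ 2 + 1 / b ^ 2) :=
        mul_le_mul_of_nonneg_left (by linarith) (by positivity)
    _ ≤ (m : ℝ) ^ 2 * ‖z‖ ^ (2 * (m - 1)) * (4 / b ^ 2) := by
        gcongr
        rw [← add_div]
        gcongr
        norm_num
    _ = (2 * m * ‖z‖ ^ (m - 1) / b) ^ 2 := by ring

/-- The elementary vortex of degree one at the origin. -/
abbrev centre : ℂ → ℂ := powCore 1 0 1

/-- Vortices of degree one at the `m` points of a regular polygon of radius `R / 8`. -/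
abbrev polygon (m : ℕ) (R : ℝ) : ℂ → ℂ := powCore m ((R / 8) ^ m) ((R / 8) ^ (m - 1))

theorem norm_grad_centre_le {R : ℝ} (hR : 0 < R) {z : ℂ} (hz : R / 16 ≤ ‖z‖) :
    ‖grad centre z‖ ≤ 32 / R := by
  have h := norm_grad_powCore_le 1 0 one_pos (z := z) (b := R / 16) (by positivity)
    (by simpa using hz)
  refine h.trans_eq ?_
  simp
  field_simp
  norm_num

theorem polygon_denominator_inner {m : ℕ} (hm : 1 ≤ m) {R : ℝ} (hR : 0 < R) {z : ℂ}
    (hz : ‖z‖ ≤ R / 16) : (R / 8) ^ m / 2 ≤ ‖z ^ m - ((R / 8) ^ m : ℝ)‖ := by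
  have h1 : ‖z‖ ^ m ≤ (R / 8) ^ m / 2 := by
    calc ‖z‖ ^ m ≤ (R / 8 * (1 / 2)) ^ m := by gcongr; linarith
      _ = (R / 8) ^ m * (1 / 2) ^ m := mul_pow _ _ _
      _ ≤ (R / 8) ^ m * (1 / 2) ^ 1 := by
          gcongr (R / 8) ^ m * ?_
          exact pow_le_pow_of_le_one (by norm_num) (by norm_num) hm
      _ = _ := by ring
  have h2 := norm_sub_norm_le (((R / 8) ^ m : ℝ) : ℂ) (z ^ m)
  rw [norm_sub_rev, Complex.norm_real, Real.norm_of_nonneg (by positivity), norm_pow] at h2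
  linarith

theorem polygon_denominator_outer {m : ℕ} (hm : 1 ≤ m) {R : ℝ} (hR : 0 < R) {z : ℂ}
    (hz : R / 3 ≤ ‖z‖) : ‖z‖ ^ m / 2 ≤ ‖z ^ m - ((R / 8) ^ m : ℝ)‖ := by
  have h1 : (R / 8) ^ m ≤ ‖z‖ ^ m / 2 := by
    calc (R / 8) ^ m ≤ (‖z‖ * (1 / 2)) ^ m := by gcongr; linarith
      _ = ‖z‖ ^ m * (1 / 2) ^ m := mul_pow _ _ _
      _ ≤ ‖z‖ ^ m * (1 / 2) ^ 1 := by
          gcongr ‖z‖ ^ m * ?_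
          exact pow_le_pow_of_le_one (by norm_num) (by norm_num) hm
      _ = _ := by ring
  have h2 := norm_sub_norm_le (z ^ m) (((R / 8) ^ m : ℝ) : ℂ)
  rw [Complex.norm_real, Real.norm_of_nonneg (by positivity), norm_pow] at h2
  linarith

theorem norm_grad_polygon_le_inner {m : ℕ} (hm : 1 ≤ m) {R : ℝ} (hR : 0 < R) {z : ℂ}
    (hz : ‖z‖ ≤ R / 16) : ‖grad (polygon m R) z‖ ≤ 32 * m / R := by
  have h := norm_grad_powCore_le m ((R / 8) ^ m) (μ := (R / 8) ^ (m - 1)) (by positivity)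
    (by positivity) (polygon_denominator_inner hm hR hz)
  refine h.trans ?_
  obtain ⟨j, rfl⟩ : ∃ j, m = j + 1 := ⟨m - 1, by omega⟩
  have h1 : ‖z‖ ^ j ≤ (R / 8) ^ j := by gcongr; linarith
  simp only [Nat.add_sub_cancel]
  calc 2 * ((j + 1 : ℕ) : ℝ) * ‖z‖ ^ j / ((R / 8) ^ (j + 1) / 2)
      ≤ 2 * ((j + 1 : ℕ) : ℝ) * (R / 8) ^ j / ((R / 8) ^ (j + 1) / 2) := by gcongr
    _ = 32 * ((j + 1 : ℕ) : ℝ) / R := by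
        have : (R / 8) ^ j ≠ 0 := by positivity
        rw [pow_succ]
        field_simp
        norm_num

theorem norm_grad_polygon_le_outer {m : ℕ} (hm : 1 ≤ m) {R : ℝ} (hR : 0 < R) {z : ℂ}
    (hz : R / 3 ≤ ‖z‖) : ‖grad (polygon m R) z‖ ≤ 32 * m / R := by
  have hz0 : 0 < ‖z‖ := by linarith
  have h := norm_grad_powCore_le m ((R / 8) ^ m) (μ := (R / 8) ^ (m - 1)) (by positivity)
    (by positivity) (polygon_denominator_outer hm hR hz)
  refine h.trans ?_
  obtain ⟨j, rfl⟩ : ∃ j, m = j + 1 := ⟨m - 1, by omega⟩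
  simp only [Nat.add_sub_cancel]
  have : 2 * ((j + 1 : ℕ) : ℝ) * ‖z‖ ^ j / (‖z‖ ^ (j + 1) / 2) = 4 * ((j + 1 : ℕ) : ℝ) / ‖z‖ := by
    have : ‖z‖ ^ j ≠ 0 := by positivity
    rw [pow_succ]
    field_simp
    norm_num
  rw [this, div_le_div_iff₀ hz0 hR]
  have : (0 : ℝ) ≤ ((j + 1 : ℕ) : ℝ) := by positivity
  nlinarith

/-- The change of variables for w = z^m needs the Jacobian m²|z|^{2(m-1)}, which degenerates at the
origin. For |z| ≥ R/16 it is at least μ²/4^{m-1} and can be inserted. For smaller |z| the map is far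
from its vertices and the defect is O(R⁻²), which integrates to O(1) over the disk. -/
theorem polygon_defect_le {m : ℕ} (hm : 1 ≤ m) {R : ℝ} (hR : 1 ≤ R) (z : ℂ) :
    (((R / 8) ^ (m - 1)) ^ 2 / (‖z ^ m - ((R / 8) ^ m : ℝ)‖ ^ 2 + ((R / 8) ^ (m - 1)) ^ 2)) ^ 2
      ≤ 4 ^ (m - 1) * ((m : ℝ) ^ 2 * ‖z‖ ^ (2 * (m - 1)) * (((R / 8) ^ (m - 1)) ^ 2 /
        (‖z ^ m - ((R / 8) ^ m : ℝ)‖ ^ 2 + ((R / 8) ^ (m - 1)) ^ 2) ^ 2)) + 65536 / R ^ 2 := by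
  have hR0 : 0 < R := by linarith
  set μ := (R / 8) ^ (m - 1) with hμ
  have hμ0 : 0 < μ := by positivity
  set N := ‖z ^ m - ((R / 8) ^ m : ℝ)‖ with hN
  have hP : 0 < N ^ 2 + μ ^ 2 := by positivity
  rcases le_total (R / 16) ‖z‖ with h | h
  · have h1 : μ ^ 2 ≤ 4 ^ (m - 1) * ((m : ℝ) ^ 2 * ‖z‖ ^ (2 * (m - 1))) := by
      have h2 : (R / 16) ^ (m - 1) ≤ ‖z‖ ^ (m - 1) := by gcongr
      have h3 : μ = 2 ^ (m - 1) * (R / 16) ^ (m - 1) := by rw [hμ, ← mul_pow]; congr 1; ring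
      have h4 : (1 : ℝ) ≤ (m : ℝ) ^ 2 := by
        have : (1 : ℝ) ≤ m := by exact_mod_cast hm
        nlinarith
      have h5 : (4 : ℝ) ^ (m - 1) = (2 ^ (m - 1)) ^ 2 := by
        rw [← pow_mul, mul_comm, pow_mul]; norm_num
      rw [h3, h5, mul_pow, pow_mul', ]
      gcongr
      calc ((R / 16) ^ (m - 1)) ^ 2 ≤ 1 * (‖z‖ ^ (m - 1)) ^ 2 := by rw [one_mul]; gcongr
        _ ≤ _ := by gcongr
    have h2 : (μ ^ 2 / (N ^ 2 + μ ^ 2)) ^ 2 = μ ^ 2 * (μ ^ 2 / (N ^ 2 + μ ^ 2) ^ 2) := by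
      field_simp
    have h3 : 0 ≤ μ ^ 2 / (N ^ 2 + μ ^ 2) ^ 2 := by positivity
    have h4 : 0 ≤ 65536 / R ^ 2 := by positivity
    have h5 := mul_le_mul_of_nonneg_right h1 h3
    rw [h2]
    linarith
  · have h1 := polygon_denominator_inner hm hR0 h
    rw [← hN] at h1
    have h2 : μ ^ 2 / (N ^ 2 + μ ^ 2) ≤ 256 / R ^ 2 := by
      rw [div_le_div_iff₀ hP (by positivity)]
      have h3 : (R / 8) ^ m = μ * (R / 8) := by
        rw [hμ, ← pow_succ]; congr 1; omega
      have h4 : μ * R / 16 ≤ N := by rw [h3] at h1; linarith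
      have h5 : (μ * R / 16) ^ 2 ≤ N ^ 2 := by gcongr
      nlinarith
    have h3 : 256 / R ^ 2 ≤ 256 := by
      rw [div_le_iff₀ (by positivity)]; nlinarith
    have h4 : (μ ^ 2 / (N ^ 2 + μ ^ 2)) ^ 2 ≤ 65536 / R ^ 2 := by
      have h5 : 0 ≤ μ ^ 2 / (N ^ 2 + μ ^ 2) := by positivity
      calc (μ ^ 2 / (N ^ 2 + μ ^ 2)) ^ 2 ≤ 256 * (256 / R ^ 2) := by nlinarith
        _ = _ := by ring
    refine h4.trans (le_add_of_nonneg_left (by positivity))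

/-- Bernoulli's inequality for each factor. The modulus defect of a product of vortices is at most
the sum of their defects. -/
theorem one_sub_pow_mul_pow_le {x y : ℝ} (hx : 0 ≤ x) (hx1 : x ≤ 1) (hy : 0 ≤ y) (hy1 : y ≤ 1)
    (p k : ℕ) : 1 - x ^ p * y ^ k ≤ p * (1 - x) + k * (1 - y) := by
  have h1 := one_add_mul_le_pow (a := x - 1) (by linarith) p
  have h2 := one_add_mul_le_pow (a := y - 1) (by linarith) k
  rw [add_sub_cancel] at h1 h2
  have h3 : x ^ p ≤ 1 := pow_le_one₀ hx hx1
  have h4 : y ^ k ≤ 1 := pow_le_one₀ hy hy1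
  nlinarith [pow_nonneg hx p, pow_nonneg hy k]

/-! ### The model map and its energy. -/

/-- Identity or complex conjugation, depending on the sign of `k`. -/
def twist (k : ℤ) (w : ℂ) : ℂ := if 0 < k then w else starRingEnd ℂ w

theorem norm_twist (k : ℤ) (w : ℂ) : ‖twist k w‖ = ‖w‖ := by
  unfold twist; split_ifs <;> simp

theorem contDiff_twist (k : ℤ) {E : Type*} [NormedAddCommGroup E] [NormedSpace ℝ E]
    {f : E → ℂ} (hf : ContDiff ℝ ∞ f) :
    ContDiff ℝ ∞ fun z => twist k (f z) := by
  unfold twist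
  split_ifs
  · exact hf
  · exact (Complex.conjCLE : ℂ →L[ℝ] ℂ).contDiff.comp hf

theorem norm_grad_twist (k : ℤ) {f : ℂ → ℂ} {z : ℂ} (hf : DifferentiableAt ℝ f z) :
    ‖grad (fun z => twist k (f z)) z‖ = ‖grad f z‖ := by
  unfold twist
  split_ifs
  · rfl
  · exact norm_grad_conj hf

/-- A model map with a vortex of degree `-p` at the origin and vortices of degree `k` at the
vertices of a regular polygon with `2 (p + 1)` vertices. -/
def model (p : ℕ) (k : ℤ) (R : ℝ) (z : ℂ) : ℂ :=
  (starRingEnd ℂ (centre z)) ^ p * (twist k (polygon (2 * (p + 1)) R z)) ^ k.natAbs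

section

variable (p : ℕ) (k : ℤ) {R : ℝ}

theorem contDiff_model (hR : 0 < R) : ContDiff ℝ ∞ (model p k R) :=
  (((Complex.conjCLE : ℂ →L[ℝ] ℂ).contDiff.comp (contDiff_powCore 1 0 one_pos)).pow p).mul
    ((contDiff_twist k (contDiff_powCore _ _ (by positivity))).pow _)

theorem norm_model (z : ℂ) : ‖model p k R z‖
    = ‖centre z‖ ^ p * ‖polygon (2 * (p + 1)) R z‖ ^ k.natAbs := by
  unfold model
  rw [norm_mul, norm_pow, norm_pow, norm_twist, Complex.norm_conj]

theorem one_sub_norm_centre_sq (z : ℂ) : 1 - ‖centre z‖ ^ 2 = 1 / (‖z‖ ^ 2 + 1) := by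
  change 1 - ‖core 1 (z ^ 1 - (0 : ℝ))‖ ^ 2 = _
  rw [one_sub_norm_core_sq one_pos]
  simp

theorem norm_centre_le_one (z : ℂ) : ‖centre z‖ ≤ 1 := norm_core_le_one one_pos _

theorem norm_polygon_le_one (m : ℕ) (hR : 0 < R) (z : ℂ) : ‖polygon m R z‖ ≤ 1 :=
  norm_core_le_one (by positivity) _

theorem norm_model_le_one (hR : 0 < R) (z : ℂ) : ‖model p k R z‖ ≤ 1 := by
  rw [norm_model]
  exact mul_le_one₀ (pow_le_one₀ (norm_nonneg _) (norm_centre_le_one z)) (by positivity)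
    (pow_le_one₀ (norm_nonneg _) (norm_polygon_le_one _ hR z))

theorem one_sub_norm_model_sq_le (hR : 0 < R) (z : ℂ) :
    1 - ‖model p k R z‖ ^ 2 ≤ p * (1 - ‖centre z‖ ^ 2)
      + k.natAbs * (1 - ‖polygon (2 * (p + 1)) R z‖ ^ 2) := by
  have h1 : ‖centre z‖ ^ 2 ≤ 1 := pow_le_one₀ (norm_nonneg _) (norm_centre_le_one z)
  have h2 : ‖polygon (2 * (p + 1)) R z‖ ^ 2 ≤ 1 :=
    pow_le_one₀ (norm_nonneg _) (norm_polygon_le_one _ hR z)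
  have h3 := one_sub_pow_mul_pow_le (by positivity) h1 (by positivity) h2 p k.natAbs
  rw [norm_model, mul_pow, ← pow_mul, ← pow_mul, mul_comm p 2, mul_comm k.natAbs 2, pow_mul,
    pow_mul]
  exact h3

theorem norm_grad_model_le (hR : 0 < R) (z : ℂ) :
    ‖grad (model p k R) z‖ ≤ p * ‖grad centre z‖
      + k.natAbs * ‖grad (polygon (2 * (p + 1)) R) z‖ := by
  have d1 : DifferentiableAt ℝ centre z :=
    (contDiff_powCore 1 0 one_pos).differentiable (by simp) z
  have d2 : DifferentiableAt ℝ (polygon (2 * (p + 1)) R) z :=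
    (contDiff_powCore _ _ (by positivity)).differentiable (by simp) z
  have d3 : DifferentiableAt ℝ (fun z => starRingEnd ℂ (centre z)) z :=
    ((Complex.conjCLE : ℂ →L[ℝ] ℂ).contDiff.comp
      (contDiff_powCore 1 0 one_pos)).differentiable (by simp : (∞ : WithTop ℕ∞) ≠ 0) z
  have d4 : DifferentiableAt ℝ (fun z => twist k (polygon (2 * (p + 1)) R z)) z :=
    (contDiff_twist k (contDiff_powCore _ _ (by positivity))).differentiable
      (by simp : (∞ : WithTop ℕ∞) ≠ 0) z
  have e : model p k R = fun z => (fun z => (starRingEnd ℂ (centre z)) ^ p) z *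
    (fun z => (twist k (polygon (2 * (p + 1)) R z)) ^ k.natAbs) z := rfl
  rw [e, grad_mul (d3.fun_pow p) (d4.fun_pow _), grad_pow d3, grad_pow d4, add_comm]
  refine (norm_add_le _ _).trans (add_le_add ?_ ?_)
  · rw [norm_smul, norm_smul, norm_grad_conj d1, norm_mul, norm_pow, norm_pow, norm_twist,
      Complex.norm_conj, Complex.norm_natCast]
    have h1 : ‖polygon (2 * (p + 1)) R z‖ ^ k.natAbs ≤ 1 :=
      pow_le_one₀ (norm_nonneg _) (norm_polygon_le_one _ hR z)
    have h2 : ‖centre z‖ ^ (p - 1) ≤ 1 := pow_le_one₀ (norm_nonneg _) (norm_centre_le_one z)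
    calc _ ≤ 1 * ((p : ℝ) * 1 * ‖grad centre z‖) := by gcongr
      _ = _ := by ring
  · rw [norm_smul, norm_smul, norm_grad_twist k d2, norm_mul, norm_pow, norm_pow, norm_twist,
      Complex.norm_conj, Complex.norm_natCast]
    have h1 : ‖polygon (2 * (p + 1)) R z‖ ^ (k.natAbs - 1) ≤ 1 :=
      pow_le_one₀ (norm_nonneg _) (norm_polygon_le_one _ hR z)
    have h2 : ‖centre z‖ ^ p ≤ 1 := pow_le_one₀ (norm_nonneg _) (norm_centre_le_one z)
    calc _ ≤ 1 * ((k.natAbs : ℝ) * 1 * ‖grad (polygon (2 * (p + 1)) R) z‖) := by gcongr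
      _ = _ := by ring

/-- Controls the cross term of two gradients, one of which is small at every point. With M = O(1/R),
the ε part only perturbs the coefficient of log R and the M² part has bounded integral over the
disk. -/
theorem sq_add_le_of_min_le {a b x y M ε : ℝ} (ha : 0 ≤ a) (hb : 0 ≤ b) (hx : 0 ≤ x) (hy : 0 ≤ y)
    (hε : 0 < ε) (h : x ≤ M ∨ y ≤ M) :
    (a * x + b * y) ^ 2 ≤ (a ^ 2 + ε) * x ^ 2 + (b ^ 2 + ε) * y ^ 2 + (a * b) ^ 2 / ε * M ^ 2 := by
  have key : ∀ s t : ℝ, 0 ≤ s → 0 ≤ t → s ≤ M →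
      2 * (a * b) * (s * t) ≤ ε * t ^ 2 + (a * b) ^ 2 / ε * M ^ 2 := by
    intro s t hs ht hsM
    have h1 : 2 * (a * b) * (s * t) ≤ 2 * (a * b) * (M * t) := by gcongr
    have h2 : ε * t ^ 2 + (a * b) ^ 2 / ε * M ^ 2 - 2 * (a * b) * (M * t)
        = (ε * t - a * b * M) ^ 2 / ε := by field_simp; ring
    have h3 : 0 ≤ (ε * t - a * b * M) ^ 2 / ε := by positivity
    linarith
  rcases h with h | h
  · have := key x y hx hy h
    nlinarith [mul_nonneg hε.le (sq_nonneg x)]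
  · have := key y x hy hx h
    nlinarith [mul_nonneg hε.le (sq_nonneg y)]

theorem norm_grad_model_sq_le (hR : 0 < R) {ε : ℝ} (hε : 0 < ε) (z : ℂ) :
    ‖grad (model p k R) z‖ ^ 2 ≤ ((p : ℝ) ^ 2 + ε) * ‖grad centre z‖ ^ 2
      + ((k.natAbs : ℝ) ^ 2 + ε) * ‖grad (polygon (2 * (p + 1)) R) z‖ ^ 2
      + ((p : ℝ) * k.natAbs) ^ 2 / ε * (64 * (p + 1) / R) ^ 2 := by
  have h1 := norm_grad_model_le p k hR z
  refine (pow_le_pow_left₀ (norm_nonneg _) h1 2).trans ?_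
  refine sq_add_le_of_min_le (by positivity) (by positivity) (norm_nonneg _) (norm_nonneg _) hε ?_
  rcases le_total (R / 16) ‖z‖ with h | h
  · left
    refine (norm_grad_centre_le hR h).trans ?_
    gcongr
    have : (0 : ℝ) ≤ p := by positivity
    linarith
  · right
    refine (norm_grad_polygon_le_inner (by omega) hR h).trans_eq ?_
    push_cast
    ring

theorem log_one_add_mul_sq_le {c : ℝ} (hc : 0 ≤ c) (hR : 1 ≤ R) :
    Real.log (1 + c * R ^ 2) ≤ 2 * Real.log R + Real.log (1 + c) := by
  have hR0 : 0 < R := by linarith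
  have h1 : 1 + c * R ^ 2 ≤ R ^ 2 * (1 + c) := by nlinarith
  calc _ ≤ Real.log (R ^ 2 * (1 + c)) := Real.log_le_log (by positivity) h1
    _ = _ := by rw [Real.log_mul (by positivity) (by positivity), Real.log_pow]; norm_num

theorem exists_integral_norm_grad_model_le {η : ℝ} (hη : 0 < η) :
    ∃ C : ℝ, ∀ R : ℝ, 1 ≤ R → ∫ z in Metric.ball (0 : ℂ) R, ‖grad (model p k R) z‖ ^ 2
      ≤ 2 * Real.pi * ((p : ℝ) ^ 2 + 2 * (p + 1) * (k.natAbs : ℝ) ^ 2 + η) * Real.log R + C := by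
  set m := 2 * (p + 1) with hm
  -- The error ε enters once for the centre and 2(p+1) times for the polygon, which adds up to η.
  set ε := η / (2 * p + 3) with hε
  have hε0 : 0 < ε := by positivity
  set c : ℝ := 4 * 64 ^ (m - 1) with hc
  set K : ℝ := ((p : ℝ) * k.natAbs) ^ 2 / ε * (64 * (p + 1)) ^ 2 with hK
  refine ⟨((p : ℝ) ^ 2 + ε) * (Real.pi * Real.log 2 + Real.pi / 2)
    + ((k.natAbs : ℝ) ^ 2 + ε) * (m * (Real.pi * Real.log (1 + c) + Real.pi / 2))
    + K * Real.pi, fun R hR => ?_⟩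
  have hR0 : 0 < R := by linarith
  have c1 : Continuous fun z => ‖grad centre z‖ :=
    continuous_norm_grad (contDiff_powCore 1 0 one_pos)
  have c2 : Continuous fun z => ‖grad (polygon m R) z‖ :=
    continuous_norm_grad (contDiff_powCore _ _ (by positivity))
  have c3 : Continuous fun z => ‖grad (model p k R) z‖ :=
    continuous_norm_grad (contDiff_model p k hR0)
  have h1 : ∫ z in Metric.ball (0 : ℂ) R, ‖grad (model p k R) z‖ ^ 2
      ≤ ∫ z in Metric.ball (0 : ℂ) R, (((p : ℝ) ^ 2 + ε) * ‖grad centre z‖ ^ 2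
      + ((k.natAbs : ℝ) ^ 2 + ε) * ‖grad (polygon m R) z‖ ^ 2
      + ((p : ℝ) * k.natAbs) ^ 2 / ε * (64 * (p + 1) / R) ^ 2) :=
    setIntegral_mono_on (integrableOn_ball (by fun_prop) R) (integrableOn_ball (by fun_prop) R)
      Metric.isOpen_ball.measurableSet fun z _ => norm_grad_model_sq_le p k hR0 hε0 z
  rw [integral_add (integrableOn_ball (by fun_prop) R) (integrableOn_ball (by fun_prop) R),
    integral_add (integrableOn_ball (by fun_prop) R) (integrableOn_ball (by fun_prop) R),
    integral_const_mul, integral_const_mul] at h1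
  have h2 := integral_norm_grad_powCore_sq_le (m := 1) one_ne_zero (A := 0) (μ := 1) (R := R)
    (ρ := R) one_pos hR0.le (by simp)
  -- At a vertex the derivative of z^m has modulus m(R/8)^{m-1}, so this μ gives cores of size of
  -- order one. Then ρ/μ is proportional to R, and the logarithm is 2 log R + O(1) rather than 2m
  -- log R.
  have h3 := integral_norm_grad_powCore_sq_le (m := m) (by omega) (A := (R / 8) ^ m)
    (μ := (R / 8) ^ (m - 1)) (R := R) (ρ := 2 * R ^ m) (by positivity) hR0.le (by
      rw [abs_of_nonneg (by positivity)]
      have : (R / 8) ^ m ≤ R ^ m := by gcongr; linarith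
      linarith)
  have h4 := setIntegral_ball_le_const (f := fun _ : ℂ =>
    ((p : ℝ) * k.natAbs) ^ 2 / ε * (64 * (p + 1) / R) ^ 2) continuous_const hR0.le
    (fun z _ => le_rfl)
  have e4 : ((p : ℝ) * k.natAbs) ^ 2 / ε * (64 * (p + 1) / R) ^ 2 * (Real.pi * R ^ 2)
      = K * Real.pi := by rw [hK]; field_simp
  have e3 : (2 * R ^ m) ^ 2 / ((R / 8) ^ (m - 1)) ^ 2 = c * R ^ 2 := by
    have h5 : R ^ m = R ^ (m - 1) * R := by rw [← pow_succ]; congr 1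
    have h6 : (64 : ℝ) ^ (m - 1) = (8 ^ (m - 1)) ^ 2 := by
      rw [← pow_mul, mul_comm (m - 1) 2, pow_mul]; norm_num
    rw [h5, hc, h6, div_pow]
    have : R ^ (m - 1) ≠ 0 := by positivity
    field_simp
    norm_num
  have e2 : 1 + R ^ 2 / 1 ^ 2 = 1 + 1 * R ^ 2 := by ring
  rw [e2, Nat.cast_one, one_mul] at h2
  rw [e3] at h3
  rw [e4] at h4
  have l2 := log_one_add_mul_sq_le zero_le_one hR
  have l3 := log_one_add_mul_sq_le (c := c) (by positivity) hR
  have l2' : (1 : ℝ) + 1 = 2 := by norm_num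
  rw [l2'] at l2
  have hpi := Real.pi_pos
  have g2 : ((p : ℝ) ^ 2 + ε) * ∫ z in Metric.ball (0 : ℂ) R, ‖grad centre z‖ ^ 2
      ≤ ((p : ℝ) ^ 2 + ε) * (Real.pi * (2 * Real.log R + Real.log 2) + Real.pi / 2) := by
    gcongr
    exact h2.trans (by gcongr)
  have g3 : ((k.natAbs : ℝ) ^ 2 + ε) * ∫ z in Metric.ball (0 : ℂ) R, ‖grad (polygon m R) z‖ ^ 2
      ≤ ((k.natAbs : ℝ) ^ 2 + ε) *
        (m * (Real.pi * (2 * Real.log R + Real.log (1 + c)) + Real.pi / 2)) := by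
    gcongr
    exact h3.trans (by gcongr)
  have hmR : (m : ℝ) = 2 * (p + 1) := by rw [hm]; push_cast; ring
  have hηε : η = ε * (2 * p + 3) := by rw [hε]; field_simp
  refine h1.trans ((add_le_add (add_le_add g2 g3) h4).trans_eq ?_)
  rw [hηε, hmR]
  ring

theorem exists_integral_W_model_le :
    ∃ C : ℝ, ∀ R : ℝ, 1 ≤ R → ∫ z in Metric.ball (0 : ℂ) R, W (model p k R z) ≤ C := by
  set m := 2 * (p + 1) with hm
  refine ⟨(p : ℝ) ^ 2 * Real.pi + (k.natAbs : ℝ) ^ 2 * (4 ^ (m - 1) * (m * Real.pi))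
    + (k.natAbs : ℝ) ^ 2 * 65536 * Real.pi, fun R hR => ?_⟩
  have hR0 : 0 < R := by linarith
  set μ := (R / 8) ^ (m - 1) with hμ
  have hμ0 : 0 < μ := by positivity
  have n1 : ∀ z : ℂ, (‖z‖ ^ 2 + (1 : ℝ) ^ 2) ^ 2 ≠ 0 := fun z => by positivity
  have n2 : ∀ z : ℂ, (‖z ^ m - ((R / 8) ^ m : ℝ)‖ ^ 2 + μ ^ 2) ^ 2 ≠ 0 := fun z => by positivity
  have c1 : Continuous fun z : ℂ => (1 : ℝ) ^ 2 / (‖z‖ ^ 2 + 1 ^ 2) ^ 2 :=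
    continuous_const.div (by fun_prop) n1
  have c2 : Continuous fun z : ℂ => (m : ℝ) ^ 2 * ‖z‖ ^ (2 * (m - 1)) *
      (μ ^ 2 / (‖z ^ m - ((R / 8) ^ m : ℝ)‖ ^ 2 + μ ^ 2) ^ 2) :=
    (by fun_prop : Continuous fun z : ℂ => (m : ℝ) ^ 2 * ‖z‖ ^ (2 * (m - 1))).mul
      (continuous_const.div (by fun_prop) n2)
  have c3 : Continuous fun z => W (model p k R z) :=
    continuous_W.comp (contDiff_model p k hR0).continuous
  have hpt : ∀ z, W (model p k R z) ≤ (p : ℝ) ^ 2 * ((1 : ℝ) ^ 2 / (‖z‖ ^ 2 + 1 ^ 2) ^ 2)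
      + (k.natAbs : ℝ) ^ 2 * (4 ^ (m - 1) * ((m : ℝ) ^ 2 * ‖z‖ ^ (2 * (m - 1)) *
      (μ ^ 2 / (‖z ^ m - ((R / 8) ^ m : ℝ)‖ ^ 2 + μ ^ 2) ^ 2)))
      + (k.natAbs : ℝ) ^ 2 * 65536 / R ^ 2 := by
    intro z
    have h1 := one_sub_norm_model_sq_le p k hR0 z
    have h2 := norm_model_le_one p k hR0 z
    have h0 : 0 ≤ 1 - ‖model p k R z‖ ^ 2 := by nlinarith [norm_nonneg (model p k R z)]
    have h3 := one_sub_norm_centre_sq z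
    have h4 := one_sub_norm_core_sq hμ0 (z ^ m - ((R / 8) ^ m : ℝ))
    have h5 := polygon_defect_le (m := m) (by omega) hR z
    rw [← hμ] at h5
    change 1 - ‖polygon m R z‖ ^ 2 = _ at h4
    rw [← hm, h3, h4] at h1
    set X := μ ^ 2 / (‖z ^ m - ((R / 8) ^ m : ℝ)‖ ^ 2 + μ ^ 2)
    set Y := 1 / (‖z‖ ^ 2 + 1) with hY
    have e1 : (1 : ℝ) ^ 2 / (‖z‖ ^ 2 + 1 ^ 2) ^ 2 = Y ^ 2 := by rw [hY]; field_simp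
    have h6 : W (model p k R z) ≤ (p : ℝ) ^ 2 * Y ^ 2 + (k.natAbs : ℝ) ^ 2 * X ^ 2 := by
      unfold W
      have h7 : (1 - ‖model p k R z‖ ^ 2) ^ 2 ≤ (p * Y + k.natAbs * X) ^ 2 := by gcongr
      nlinarith [sq_nonneg (p * Y - k.natAbs * X), sq_nonneg (p * Y + k.natAbs * X),
        sq_nonneg (p * Y), sq_nonneg (k.natAbs * X)]
    rw [e1]
    have h8 := mul_le_mul_of_nonneg_left h5 (sq_nonneg (k.natAbs : ℝ))
    have e2 : (k.natAbs : ℝ) ^ 2 * 65536 / R ^ 2 = (k.natAbs : ℝ) ^ 2 * (65536 / R ^ 2) := by ring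
    rw [e2]
    linarith
  have h1 : ∫ z in Metric.ball (0 : ℂ) R, W (model p k R z) ≤ ∫ z in Metric.ball (0 : ℂ) R,
      ((p : ℝ) ^ 2 * ((1 : ℝ) ^ 2 / (‖z‖ ^ 2 + 1 ^ 2) ^ 2)
      + (k.natAbs : ℝ) ^ 2 * (4 ^ (m - 1) * ((m : ℝ) ^ 2 * ‖z‖ ^ (2 * (m - 1)) *
      (μ ^ 2 / (‖z ^ m - ((R / 8) ^ m : ℝ)‖ ^ 2 + μ ^ 2) ^ 2)))
      + (k.natAbs : ℝ) ^ 2 * 65536 / R ^ 2) :=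
    setIntegral_mono_on (integrableOn_ball c3 R) (integrableOn_ball (by fun_prop) R)
      Metric.isOpen_ball.measurableSet fun z _ => hpt z
  rw [integral_add (integrableOn_ball (by fun_prop) R) (integrableOn_ball (by fun_prop) R),
    integral_add (integrableOn_ball (by fun_prop) R) (integrableOn_ball (by fun_prop) R),
    integral_const_mul, integral_const_mul, integral_const_mul] at h1
  have h2 := integral_ball_potential_le one_pos hR0.le
  have h3 := integral_potential_powCore_le (m := m) (by omega) (A := (R / 8) ^ m) hμ0 hR0.le
  have h4 := setIntegral_ball_le_const (f := fun _ : ℂ =>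
    (k.natAbs : ℝ) ^ 2 * 65536 / R ^ 2) continuous_const hR0.le (fun z _ => le_rfl)
  have e4 : (k.natAbs : ℝ) ^ 2 * 65536 / R ^ 2 * (Real.pi * R ^ 2)
      = (k.natAbs : ℝ) ^ 2 * 65536 * Real.pi := by field_simp
  rw [e4] at h4
  refine h1.trans (add_le_add (add_le_add ?_ ?_) h4)
  · gcongr
  · gcongr

/-- R/3 lies well outside the polygon radius R/8. The layer in which the competitor differs from the
model stays in this region. -/
theorem norm_grad_model_le_outer (hR : 0 < R) {z : ℂ} (hz : R / 3 ≤ ‖z‖) :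
    ‖grad (model p k R) z‖ ≤ (32 * p + 64 * (p + 1) * k.natAbs) / R := by
  refine (norm_grad_model_le p k hR z).trans ?_
  have h1 := norm_grad_centre_le hR (z := z) (by linarith)
  have h2 := norm_grad_polygon_le_outer (m := 2 * (p + 1)) (by omega) hR hz
  calc _ ≤ (p : ℝ) * (32 / R) + k.natAbs * (32 * (2 * (p + 1) : ℕ) / R) := by gcongr
    _ = _ := by push_cast; ring

theorem one_sub_norm_model_sq_le_outer (hR : 0 < R) {z : ℂ} (hz : R / 3 ≤ ‖z‖) :
    1 - ‖model p k R z‖ ^ 2 ≤ 36 * (p + k.natAbs) / R ^ 2 := by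
  refine (one_sub_norm_model_sq_le p k hR z).trans ?_
  set m := 2 * (p + 1) with hm
  have hz0 : 0 < ‖z‖ := by linarith
  have hzz : R ^ 2 ≤ 9 * ‖z‖ ^ 2 := by nlinarith
  have h3 : 1 - ‖centre z‖ ^ 2 ≤ 36 / R ^ 2 := by
    rw [one_sub_norm_centre_sq, div_le_div_iff₀ (by positivity) (by positivity)]
    nlinarith
  have h4 : 1 - ‖polygon m R z‖ ^ 2 ≤ 36 / R ^ 2 := by
    have h5 := one_sub_norm_core_sq (μ := (R / 8) ^ (m - 1)) (by positivity)
      (z ^ m - ((R / 8) ^ m : ℝ))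
    change 1 - ‖polygon m R z‖ ^ 2 = _ at h5
    have h6 := polygon_denominator_outer (m := m) (by omega) hR hz
    set μ := (R / 8) ^ (m - 1)
    set N := ‖z ^ m - ((R / 8) ^ m : ℝ)‖
    have hμ0 : 0 < μ := by positivity
    have h7 : μ ≤ ‖z‖ ^ (m - 1) :=
      pow_le_pow_left₀ (by positivity) (by linarith) _
    have h8 : μ * ‖z‖ / 2 ≤ N := by
      have : ‖z‖ ^ m = ‖z‖ ^ (m - 1) * ‖z‖ := by rw [← pow_succ]; congr 1
      rw [this] at h6
      nlinarith
    have h9 : (μ * ‖z‖ / 2) ^ 2 ≤ N ^ 2 := by gcongr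
    rw [h5, div_le_div_iff₀ (by positivity) (by positivity)]
    nlinarith [mul_le_mul_of_nonneg_left hzz (sq_nonneg μ)]
  calc _ ≤ (p : ℝ) * (36 / R ^ 2) + k.natAbs * (36 / R ^ 2) := by gcongr
    _ = _ := by ring

end

/-! ### Symmetries of the model and its logarithm on the circle. -/

theorem core_mul_of_norm_one (μ : ℝ) {a : ℂ} (ha : ‖a‖ = 1) (w : ℂ) :
    core μ (a * w) = a * core μ w := by
  unfold core
  rw [norm_mul, ha, one_mul, mul_smul_comm]

theorem core_conj (μ : ℝ) (w : ℂ) : core μ (starRingEnd ℂ w) = starRingEnd ℂ (core μ w) := by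
  unfold core
  rw [Complex.norm_conj, Complex.real_smul, Complex.real_smul, map_mul, Complex.conj_ofReal]

theorem twist_conj (k : ℤ) (w : ℂ) :
    twist k (starRingEnd ℂ w) = starRingEnd ℂ (twist k w) := by
  unfold twist; split_ifs <;> rfl

theorem model_conj (p : ℕ) (k : ℤ) (R : ℝ) (z : ℂ) :
    model p k R (starRingEnd ℂ z) = starRingEnd ℂ (model p k R z) := by
  have h : ∀ (m : ℕ) (A μ : ℝ), powCore m A μ (starRingEnd ℂ z)
      = starRingEnd ℂ (powCore m A μ z) := by
    intro m A μ
    unfold powCore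
    rw [← core_conj, map_sub, map_pow, Complex.conj_ofReal]
  unfold model centre polygon
  rw [h, h, twist_conj, map_mul, map_pow, map_pow]

/-- For a = e^{iπ/(p+1)} one has a^{p+1} = -1. Hence the central factor picks up conj(a)^p = -a,
while the polygon factor depends only on z^{2(p+1)} and is unchanged. -/
theorem model_rotate (p : ℕ) (k : ℤ) (R : ℝ) (z : ℂ) :
    model p k R (Complex.exp (Complex.I * (Real.pi / (p + 1))) * z)
      = -Complex.exp (Complex.I * (Real.pi / (p + 1))) * model p k R z := by
  set a := Complex.exp (Complex.I * (Real.pi / (p + 1))) with ha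
  have hp : (p + 1 : ℂ) ≠ 0 := by exact_mod_cast Nat.succ_ne_zero p
  have hn : ‖a‖ = 1 := by
    rw [ha, mul_comm]
    exact_mod_cast Complex.norm_exp_ofReal_mul_I (Real.pi / (p + 1))
  have h1 : a ^ (p + 1) = -1 := by
    rw [ha, ← Complex.exp_nat_mul, ← Complex.exp_pi_mul_I]
    congr 1
    push_cast
    field_simp
  have h2 : a ^ (2 * (p + 1)) = 1 := by rw [mul_comm, pow_mul, h1]; norm_num
  have h3 : (starRingEnd ℂ a) * a = 1 := by
    rw [mul_comm, Complex.mul_conj, Complex.normSq_eq_norm_sq, hn]; norm_num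
  have h4 : (starRingEnd ℂ a) ^ p = -a := by
    have h5 : (starRingEnd ℂ a) ^ p * a ^ (p + 1) = a := by
      rw [pow_succ, ← mul_assoc, ← mul_pow, h3, one_pow, one_mul]
    rw [h1] at h5
    linear_combination -h5
  have h6 : centre (a * z) = a * centre z := by
    unfold centre powCore
    rw [← core_mul_of_norm_one 1 hn]
    simp
  have h7 : polygon (2 * (p + 1)) R (a * z) = polygon (2 * (p + 1)) R z := by
    unfold polygon powCore
    rw [mul_pow, h2, one_mul]
  unfold model
  rw [h6, h7, map_mul, mul_pow, h4]
  ring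

/-- On the circle z^m - (R/8)^m = R^m e^{imθ}(1 - 8^{-m}e^{-imθ}). The last factor stays in the disk
of radius less than 1 about 1, where the principal logarithm is smooth and commutes with
conjugation, so all winding comes from e^{imθ}. -/
theorem exists_lift_polygon {m : ℕ} (hm : 1 ≤ m) {R : ℝ} (hR : 0 < R) :
    ∃ L : ℝ → ℂ, ContDiff ℝ ∞ L ∧
      (∀ θ : ℝ, Complex.exp (L θ) = polygon m R (R * Complex.exp (Complex.I * θ))) ∧
      (∀ θ, L (θ + 2 * Real.pi / m) = L θ + 2 * Real.pi * Complex.I) ∧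
      ∀ θ, L (-θ) = starRingEnd ℂ (L θ) := by
  have hm0 : (m : ℂ) ≠ 0 := by exact_mod_cast (by omega : m ≠ 0)
  set μ : ℝ := (R / 8) ^ (m - 1) with hμ
  have hμ0 : 0 < μ := by positivity
  set q : ℝ := (1 / 8) ^ m with hq
  have hq0 : 0 < q := by positivity
  have hq1 : q < 1 := pow_lt_one₀ (by norm_num) (by norm_num) (by omega)
  set N : ℝ → ℂ := fun θ => (R * Complex.exp (Complex.I * θ)) ^ m - ((R / 8) ^ m : ℝ) with hN
  set ν : ℝ → ℝ := fun θ => √(‖N θ‖ ^ 2 + μ ^ 2) with hν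
  have hν0 : ∀ θ, 0 < ν θ := fun θ => Real.sqrt_pos.2 (by positivity)
  set E : ℝ → ℂ := fun θ => Complex.exp (-(Complex.I * (m * θ))) with hE
  have hEn : ∀ θ, ‖(q : ℂ) * E θ‖ < 1 := by
    intro θ
    have : -(Complex.I * (m * θ)) = ((-(m * θ) : ℝ) : ℂ) * Complex.I := by push_cast; ring
    simp only [hE]
    rw [this, norm_mul, Complex.norm_exp_ofReal_mul_I, mul_one, Complex.norm_real,
      Real.norm_of_nonneg hq0.le]
    exact hq1
  have hslit : ∀ θ, 1 - (q : ℂ) * E θ ∈ Complex.slitPlane := by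
    intro θ
    rw [sub_eq_add_neg]
    exact Complex.mem_slitPlane_of_norm_lt_one (by rw [norm_neg]; exact hEn θ)
  have hNs : ContDiff ℝ ∞ N := ((contDiff_circle R).pow m).sub contDiff_const
  have hνs : ContDiff ℝ ∞ ν :=
    (((contDiff_norm_sq ℝ).comp hNs).add contDiff_const).sqrt fun θ => by
      simp only [Function.comp_apply]; positivity
  have hEs : ContDiff ℝ ∞ E :=
    ((contDiff_const.mul (contDiff_const.mul Complex.ofRealCLM.contDiff)).neg).cexp
  have hlogs : ContDiff ℝ ∞ fun θ => Complex.log (1 - (q : ℂ) * E θ) := by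
    rw [contDiff_iff_contDiffAt]
    intro θ
    have h1 : ContDiffAt ℝ ∞ Complex.log (1 - (q : ℂ) * E θ) :=
      (Complex.contDiffAt_log (hslit θ)).restrict_scalars ℝ
    exact h1.comp θ (contDiff_const.sub (contDiff_const.mul hEs)).contDiffAt
  have hreal : ContDiff ℝ ∞ fun θ => ((Real.log (R ^ m / ν θ) : ℝ) : ℂ) :=
    Complex.ofRealCLM.contDiff.comp
      ((contDiff_const.div hνs fun θ => (hν0 θ).ne').log fun θ =>
        (div_pos (by positivity) (hν0 θ)).ne')
  set L : ℝ → ℂ := fun θ => ((Real.log (R ^ m / ν θ) : ℝ) : ℂ) + Complex.I * (m * θ)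
    + Complex.log (1 - (q : ℂ) * E θ) with hL
  have hNfac : ∀ θ, N θ = R ^ m * Complex.exp (Complex.I * (m * θ)) * (1 - q * E θ) := by
    intro θ
    simp only [hN, hE, hq]
    rw [mul_sub, mul_one]
    have h1 : (R : ℂ) ^ m * Complex.exp (Complex.I * (m * θ)) *
        (((1 / 8 : ℝ) ^ m : ℝ) * Complex.exp (-(Complex.I * (m * θ))))
        = ((R / 8 : ℝ) ^ m : ℝ) := by
      have : Complex.exp (Complex.I * (m * θ)) * Complex.exp (-(Complex.I * (m * θ))) = 1 := by
        rw [← Complex.exp_add, add_neg_cancel, Complex.exp_zero]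
      calc _ = (R : ℂ) ^ m * ((1 / 8 : ℝ) ^ m : ℝ) * (Complex.exp (Complex.I * (m * θ))
            * Complex.exp (-(Complex.I * (m * θ)))) := by ring
        _ = _ := by rw [this, mul_one]; push_cast; rw [← mul_pow]; congr 1; ring
    rw [h1, mul_pow, ← Complex.exp_nat_mul, mul_left_comm]
  refine ⟨L, (hreal.add (contDiff_const.mul (contDiff_const.mul
    Complex.ofRealCLM.contDiff))).add hlogs, fun θ => ?_, fun θ => ?_, fun θ => ?_⟩
  · have h1 : polygon m R (R * Complex.exp (Complex.I * θ)) = (ν θ)⁻¹ • N θ := rfl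
    rw [h1, hNfac]
    simp only [hL]
    rw [Complex.exp_add, Complex.exp_add, Complex.exp_log (Complex.slitPlane_ne_zero (hslit θ)),
      ← Complex.ofReal_exp, Real.exp_log (div_pos (by positivity) (hν0 θ)), Complex.real_smul]
    push_cast
    ring
  · have hexp : Complex.I * (m * ((θ + 2 * Real.pi / m : ℝ) : ℂ))
        = Complex.I * (m * θ) + 2 * Real.pi * Complex.I := by
      push_cast
      field_simp
    have hE1 : E (θ + 2 * Real.pi / m) = E θ := by
      simp only [hE]
      rw [hexp, neg_add, Complex.exp_add, Complex.exp_neg (2 * Real.pi * Complex.I),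
        Complex.exp_two_pi_mul_I]
      simp
    have hN1 : N (θ + 2 * Real.pi / m) = N θ := by
      rw [hNfac, hNfac, hE1, hexp, Complex.exp_add, Complex.exp_two_pi_mul_I, mul_one]
    have hν1 : ν (θ + 2 * Real.pi / m) = ν θ := by simp only [hν, hN1]
    simp only [hL]
    rw [hE1, hν1, hexp]
    ring
  · have hE1 : E (-θ) = starRingEnd ℂ (E θ) := by
      simp only [hE]
      rw [← Complex.exp_conj]
      simp
    have hN1 : N (-θ) = starRingEnd ℂ (N θ) := by
      simp only [hN]
      rw [map_sub, map_pow, map_mul, ← Complex.exp_conj, Complex.conj_ofReal,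
        Complex.conj_ofReal]
      simp
    have hν1 : ν (-θ) = ν θ := by simp only [hν, hN1, Complex.norm_conj]
    have hlog : Complex.log (1 - q * starRingEnd ℂ (E θ))
        = starRingEnd ℂ (Complex.log (1 - q * E θ)) := by
      rw [← Complex.log_conj _ (Complex.slitPlane_arg_ne_pi (hslit θ))]
      simp
    simp only [hL]
    rw [hE1, hν1, hlog]
    simp

/-- The centre contributes -pπ/(p+1) per arc of angle π/(p+1), the polygon 2πk. This is the
increment of a lift of u, so the difference of the two lifts is periodic. -/
theorem exists_lift_model (p : ℕ) (k : ℤ) {R : ℝ} (hR : 0 < R) :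
    ∃ L : ℝ → ℂ, ContDiff ℝ ∞ L ∧
      (∀ θ : ℝ, Complex.exp (L θ) = model p k R (R * Complex.exp (Complex.I * θ))) ∧
      (∀ θ, L (θ + Real.pi / (p + 1))
        = L θ + Complex.I * (Real.pi / (p + 1) * (-p) + 2 * Real.pi * k)) ∧
      ∀ θ, L (-θ) = starRingEnd ℂ (L θ) := by
  obtain ⟨L₁, hs₁, he₁, ht₁, hc₁⟩ := exists_lift_polygon (m := 2 * (p + 1)) (by omega) hR
  have hper : 2 * Real.pi / ((2 * (p + 1) : ℕ) : ℝ) = Real.pi / (p + 1) := by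
    push_cast
    field_simp
  rw [hper] at ht₁
  set c : ℝ := (√(R ^ 2 + 1))⁻¹ * R with hc
  have hc0 : 0 < c := by positivity
  have he₀ : ∀ θ : ℝ, Complex.exp ((Real.log c : ℝ) + Complex.I * θ)
      = centre (R * Complex.exp (Complex.I * θ)) := by
    intro θ
    unfold centre powCore core
    rw [pow_one, Complex.ofReal_zero, sub_zero, norm_circle hR.le, Complex.exp_add,
      ← Complex.ofReal_exp, Real.exp_log hc0, Complex.real_smul, hc]
    push_cast
    rw [one_pow]
    ring
  have htw : ∀ w : ℂ, Complex.exp (twist k w) = twist k (Complex.exp w) := by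
    intro w
    unfold twist
    split_ifs
    · rfl
    · rw [Complex.exp_conj]
  refine ⟨fun θ => p * ((Real.log c : ℝ) - Complex.I * θ) + k.natAbs * twist k (L₁ θ),
    (contDiff_const.mul (contDiff_const.sub (contDiff_const.mul
      Complex.ofRealCLM.contDiff))).add (contDiff_const.mul (contDiff_twist k hs₁)), ?_, ?_, ?_⟩
  · intro θ
    unfold model
    rw [Complex.exp_add, Complex.exp_nat_mul, Complex.exp_nat_mul, htw, he₁, ← he₀,
      ← Complex.exp_conj]
    simp [sub_eq_add_neg]
  · intro θ
    simp only [ht₁]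
    have hsgn : (k.natAbs : ℂ) * twist k (L₁ θ + 2 * Real.pi * Complex.I)
        = k.natAbs * twist k (L₁ θ) + Complex.I * (2 * Real.pi * k) := by
      unfold twist
      split_ifs with h
      · have : ((k.natAbs : ℤ) : ℂ) = k := by rw [Int.natAbs_of_nonneg h.le]
        rw [Int.cast_natCast] at this
        rw [this]
        ring
      · have : ((k.natAbs : ℤ) : ℂ) = -k := by
          rw [Int.ofNat_natAbs_of_nonpos (by omega)]; push_cast; ring
        rw [Int.cast_natCast] at this
        rw [this]
        simp [map_ofNat]
        ring
    rw [hsgn]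
    push_cast
    ring
  · intro θ
    simp only [hc₁, twist_conj]
    simp

/-! ### Transition profile and a Poincaré inequality on the circle. -/

/-- A rise from 0 to 1 over a length 7/10 needs slope at least 10/7, so 3/2 leaves room for
smoothing. The length is below log 3, which keeps the layer in |z| ≥ R/3. -/
theorem exists_transition : ∃ γ : ℝ → ℝ, ContDiff ℝ ∞ γ ∧ (∀ t, t ≤ -(7 / 10) → γ t = 0) ∧
    γ 0 = 1 ∧ (∀ t, 0 ≤ γ t) ∧ (∀ t, γ t ≤ 1) ∧
    (∀ t, -(7 / 10) ≤ t → γ t ≤ 3 / 2 * (t + 7 / 10)) ∧ ∀ t, |deriv γ t| ≤ 3 / 2 := by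
  -- The inner ball of radius 1/3 has length 2/3, so the normalised bump is at most 3/2. Its support
  -- is [-7/10, 0].
  let f : ContDiffBump (-(7 / 20) : ℝ) := ⟨1 / 3, 7 / 20, by norm_num, by norm_num⟩
  set b : ℝ → ℝ := f.normed volume with hb
  have hbs : ContDiff ℝ ∞ b := f.contDiff_normed
  have hbc : Continuous b := hbs.continuous
  have hb0 : ∀ t, 0 ≤ b t := fun t => f.nonneg_normed t
  have hb1 : ∀ t, b t ≤ 3 / 2 := by
    intro t
    have h := f.normed_le_div_measure_closedBall_rIn (μ := (volume : Measure ℝ)) t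
    have hv : (volume : Measure ℝ).real (Metric.closedBall (-(7 / 20)) f.rIn) = 2 / 3 := by
      change (volume : Measure ℝ).real (Metric.closedBall (-(7 / 20)) (1 / 3)) = 2 / 3
      rw [Measure.real, Real.volume_closedBall, ENNReal.toReal_ofReal (by norm_num)]
      norm_num
    rw [hv] at h
    linarith
  have hsupp : ∀ t, t ∉ Set.Ioo (-(7 / 10) : ℝ) 0 → b t = 0 := by
    intro t ht
    by_contra hne
    apply ht
    have : t ∈ Function.support b := hne
    rw [hb, f.support_normed_eq, Real.ball_eq_Ioo] at this
    change t ∈ Set.Ioo (-(7 / 20) - 7 / 20 : ℝ) (-(7 / 20) + 7 / 20) at this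
    constructor <;> linarith [this.1, this.2]
  set γ : ℝ → ℝ := fun t => ∫ x in (-(7 / 10) : ℝ)..t, b x with hγ
  have hder : ∀ t, HasDerivAt γ (b t) t := fun t =>
    (hbc.integral_hasStrictDerivAt _ t).hasDerivAt
  have hderiv : deriv γ = b := funext fun t => (hder t).deriv
  have hmono : Monotone γ := monotone_of_deriv_nonneg (fun t => (hder t).differentiableAt)
    (by rw [hderiv]; exact hb0)
  have hzero : ∀ t, t ≤ -(7 / 10) → γ t = 0 := by
    intro t ht
    simp only [hγ]
    rw [intervalIntegral.integral_symm, neg_eq_zero]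
    refine (intervalIntegral.integral_congr (g := fun _ => 0) fun x hx => ?_).trans (by simp)
    rw [Set.uIcc_of_le ht] at hx
    exact hsupp x fun h => by linarith [h.1, hx.2]
  have hinteg : ∀ t, 0 ≤ t → γ t = 1 := by
    intro t ht
    simp only [hγ]
    have h1 : ∫ x, b x = 1 := f.integral_normed
    rw [intervalIntegral.integral_of_le (by linarith), setIntegral_eq_integral_of_forall_compl_eq_zero]
    · exact h1
    · intro x hx
      exact hsupp x fun h => hx ⟨h.1, by linarith [h.2]⟩
  refine ⟨γ, ?_, hzero, hinteg 0 le_rfl, ?_, ?_, ?_, ?_⟩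
  · refine contDiff_infty_iff_deriv.2 ⟨fun t => (hder t).differentiableAt, ?_⟩
    rwa [hderiv]
  · intro t
    rcases le_total t (-(7 / 10)) with h | h
    · exact (hzero t h).ge
    · rw [← hzero _ le_rfl]; exact hmono h
  · intro t
    rcases le_total t 0 with h | h
    · rw [← hinteg 0 le_rfl]; exact hmono h
    · exact (hinteg t h).le
  · intro t ht
    calc γ t ≤ ∫ _ in (-(7 / 10) : ℝ)..t, (3 / 2 : ℝ) :=
          intervalIntegral.integral_mono_on ht (hbc.intervalIntegrable _ _) (by simp)
            fun x _ => hb1 x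
      _ = _ := by rw [intervalIntegral.integral_const, smul_eq_mul]; ring
  · intro t
    rw [hderiv, abs_of_nonneg (hb0 t)]
    exact hb1 t

theorem sq_integral_le {f : ℝ → ℝ} (hf : Continuous f) {h : ℝ} (hh : 0 < h) :
    (∫ x in (0 : ℝ)..h, f x) ^ 2 ≤ h * ∫ x in (0 : ℝ)..h, f x ^ 2 := by
  set I := ∫ x in (0 : ℝ)..h, f x with hI
  have h1 : 0 ≤ ∫ x in (0 : ℝ)..h, (h * f x - I) ^ 2 :=
    intervalIntegral.integral_nonneg hh.le fun x _ => sq_nonneg _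
  have h2 : ∀ x, (h * f x - I) ^ 2 = h ^ 2 * f x ^ 2 - 2 * h * I * f x + I ^ 2 := fun x => by ring
  simp_rw [h2] at h1
  rw [intervalIntegral.integral_add (by apply Continuous.intervalIntegrable; fun_prop) (by simp),
    intervalIntegral.integral_sub (by apply Continuous.intervalIntegrable; fun_prop)
      (by apply Continuous.intervalIntegrable; fun_prop),
    intervalIntegral.integral_const_mul, intervalIntegral.integral_const_mul, ← hI,
    intervalIntegral.integral_const, smul_eq_mul] at h1
  have h3 : 0 ≤ h * (h * (∫ x in (0 : ℝ)..h, f x ^ 2) - I ^ 2) := by nlinarith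
  nlinarith [nonneg_of_mul_nonneg_right h3 hh]

/-- A full turn consists of 2n periods, each of two mirror halves. Estimates reduce to [0, π/(2n)],
at both ends of which an odd function of period π/n vanishes. -/
theorem integral_even_periodic {F : ℝ → ℝ} (hF : Continuous F) (heven : ∀ x, F (-x) = F x)
    {n : ℕ} (hn : n ≠ 0) (hper : Function.Periodic F (Real.pi / n)) :
    ∫ x in (-Real.pi)..Real.pi, F x = 4 * n * ∫ x in (0 : ℝ)..(Real.pi / (2 * n)), F x := by
  have hn0 : (n : ℝ) ≠ 0 := by exact_mod_cast hn
  set T := Real.pi / n with hT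
  have hinteg : ∀ a b, IntervalIntegrable F volume a b := fun a b => hF.intervalIntegrable a b
  have h1 := hper.intervalIntegral_add_zsmul_eq (2 * n : ℕ) (-Real.pi) hinteg
  have h2 : -Real.pi + ((2 * n : ℕ) : ℤ) • T = Real.pi := by
    rw [natCast_zsmul, nsmul_eq_mul, hT]; push_cast; field_simp; ring
  have h3 := hper.intervalIntegral_add_eq (-Real.pi) (-(T / 2))
  have h4 : -(T / 2) + T = T / 2 := by ring
  rw [h2] at h1
  rw [h1, h3, h4, natCast_zsmul, nsmul_eq_mul,
    ← intervalIntegral.integral_add_adjacent_intervals (hinteg (-(T / 2)) 0) (hinteg 0 (T / 2))]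
  have h5 : ∫ x in (-(T / 2))..0, F x = ∫ x in (0 : ℝ)..(T / 2), F x := by
    have := intervalIntegral.integral_comp_neg F (a := 0) (b := T / 2)
    simp only [heven, neg_zero] at this
    exact this.symm
  have h6 : T / 2 = Real.pi / (2 * n) := by rw [hT]; field_simp
  rw [h5, h6]
  push_cast
  ring

/-- Poincaré inequality for odd periodic functions. -/
theorem integral_sq_le_of_odd_periodic {χ : ℝ → ℝ} (hχ : ContDiff ℝ ∞ χ)
    (hodd : ∀ x, χ (-x) = -χ x) {n : ℕ} (hn : n ≠ 0)
    (hper : Function.Periodic χ (Real.pi / n)) :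
    ∫ x in (-Real.pi)..Real.pi, χ x ^ 2
      ≤ (Real.pi / n) ^ 2 / 16 * ∫ x in (-Real.pi)..Real.pi, deriv χ x ^ 2 := by
  have hn0 : (n : ℝ) ≠ 0 := by exact_mod_cast hn
  have hnpos : (0 : ℝ) < n := by positivity
  have hd : Differentiable ℝ χ := hχ.differentiable (by simp)
  have hdc : Continuous (deriv χ) := (contDiff_infty_iff_deriv.1 hχ).2.continuous
  have hc := hχ.continuous
  set h := Real.pi / (2 * n) with hh
  have hh0 : 0 < h := by have := Real.pi_pos; positivity
  have hdeven : ∀ x, deriv χ (-x) = deriv χ x := by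
    intro x
    have h1 : (fun x => χ (-x)) = fun x => -χ x := funext hodd
    have h2 : deriv (fun x => χ (-x)) x = -deriv χ (-x) := deriv_comp_neg χ x
    rw [h1, deriv.fun_neg] at h2
    linarith
  have hdper : Function.Periodic (deriv χ) (Real.pi / n) := by
    intro x
    have h1 : (fun x => χ (x + Real.pi / n)) = χ := funext hper
    have h2 := deriv_comp_add_const (f := χ) (Real.pi / n) x
    rw [h1] at h2
    exact h2.symm
  have z0 : χ 0 = 0 := by have := hodd 0; rw [neg_zero] at this; linarith
  have zh : χ h = 0 := by
    have h1 := hper (-h)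
    have h2 : -h + Real.pi / n = h := by rw [hh]; field_simp; ring
    rw [h2, hodd] at h1
    linarith
  set I := ∫ x in (0 : ℝ)..h, |deriv χ x| with hI
  have hab : Continuous fun x => |deriv χ x| := hdc.abs
  -- |χ x| is bounded by the variation to the left of x and by that to the right. Averaging the two
  -- gives I/2.
  have hbd : ∀ x ∈ Set.Icc 0 h, χ x ^ 2 ≤ I ^ 2 / 4 := by
    intro x hx
    have e1 : |χ x| ≤ ∫ t in (0 : ℝ)..x, |deriv χ t| := by
      have h1 := intervalIntegral.integral_eq_sub_of_hasDerivAt (a := 0) (b := x)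
        (fun t _ => (hd t).hasDerivAt) (hdc.intervalIntegrable _ _)
      rw [z0, sub_zero] at h1
      rw [← h1]
      exact intervalIntegral.abs_integral_le_integral_abs hx.1
    have e2 : |χ x| ≤ ∫ t in x..h, |deriv χ t| := by
      have h1 := intervalIntegral.integral_eq_sub_of_hasDerivAt (a := x) (b := h)
        (fun t _ => (hd t).hasDerivAt) (hdc.intervalIntegrable _ _)
      rw [zh, zero_sub] at h1
      rw [← abs_neg, ← h1]
      exact intervalIntegral.abs_integral_le_integral_abs hx.2
    have e3 := intervalIntegral.integral_add_adjacent_intervals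
      (hab.intervalIntegrable (μ := volume) 0 x) (hab.intervalIntegrable x h)
    have e4 : |χ x| ≤ I / 2 := by linarith
    calc χ x ^ 2 = |χ x| ^ 2 := (sq_abs _).symm
      _ ≤ (I / 2) ^ 2 := by gcongr
      _ = I ^ 2 / 4 := by ring
  have hI2 : I ^ 2 ≤ h * ∫ x in (0 : ℝ)..h, deriv χ x ^ 2 := by
    have := sq_integral_le hab hh0
    simpa only [sq_abs] using this
  have b1 : ∫ x in (0 : ℝ)..h, χ x ^ 2 ≤ h * (I ^ 2 / 4) := by
    calc _ ≤ ∫ _ in (0 : ℝ)..h, I ^ 2 / 4 :=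
          intervalIntegral.integral_mono_on hh0.le (by apply Continuous.intervalIntegrable; fun_prop)
            (by simp) hbd
      _ = _ := by rw [intervalIntegral.integral_const, smul_eq_mul, sub_zero]
  rw [integral_even_periodic (F := fun x => χ x ^ 2) (by fun_prop) (fun x => by rw [hodd]; ring) hn
      (fun x => by simp only [hper x]),
    integral_even_periodic (F := fun x => deriv χ x ^ 2) (by fun_prop)
      (fun x => by simp only [hdeven]) hn (fun x => by simp only [hdper x]), ← hh]
  have e : (Real.pi / n) ^ 2 / 16 = h ^ 2 / 4 := by rw [hh]; field_simp; norm_num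
  rw [e]
  have : 4 * n * ∫ x in (0 : ℝ)..h, χ x ^ 2
      ≤ 4 * n * (h * ((h * ∫ x in (0 : ℝ)..h, deriv χ x ^ 2) / 4)) := by
    gcongr
    exact b1.trans (by gcongr)
  refine this.trans_eq ?_
  ring

/-! ### Interpolation in logarithmic polar coordinates. -/

/-- The map equal to `γ (log (r / R)) Λ(θ)` in polar coordinates. -/
def angular (γ : ℝ → ℝ) (Λ : ℝ → ℂ) (R : ℝ) (z : ℂ) : ℂ :=
  γ (Real.log ‖z‖ - Real.log R) • Λ (Complex.arg z)

theorem periodic_arg_eq {Λ : ℝ → ℂ} (hper : Function.Periodic Λ (2 * Real.pi)) {r θ : ℝ}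
    (hr : 0 < r) : Λ (Complex.arg (r * Complex.exp (Complex.I * θ))) = Λ θ := by
  have h1 := Complex.norm_mul_exp_arg_mul_I ((r : ℂ) * Complex.exp (Complex.I * θ))
  rw [norm_circle hr.le] at h1
  have h2 := mul_left_cancel₀ (by exact_mod_cast hr.ne') h1
  obtain ⟨j, hj⟩ := Complex.exp_eq_exp_iff_exists_int.1 h2
  have h3 : Complex.arg (r * Complex.exp (Complex.I * θ)) = θ + j * (2 * Real.pi) := by
    have := congrArg Complex.im hj
    simpa using this
  rw [h3]
  exact hper.int_mul j θ

theorem angular_circle {γ : ℝ → ℝ} {Λ : ℝ → ℂ} (hper : Function.Periodic Λ (2 * Real.pi))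
    (R : ℝ) {r : ℝ} (hr : 0 < r) (θ : ℝ) :
    angular γ Λ R (r * Complex.exp (Complex.I * θ)) = γ (Real.log r - Real.log R) • Λ θ := by
  unfold angular
  rw [periodic_arg_eq hper hr, norm_circle hr.le]

section

variable {γ : ℝ → ℝ} {Λ : ℝ → ℂ} {R : ℝ}

theorem angular_eq_zero (hγ0 : ∀ t, t ≤ -(7 / 10) → γ t = 0) (hR : 3 ≤ R) {z : ℂ}
    (hz : ‖z‖ ≤ R * Real.exp (-(7 / 10))) : angular γ Λ R z = 0 := by
  have hR0 : 0 < R := by linarith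
  unfold angular
  rw [hγ0, zero_smul]
  by_cases h : z = 0
  -- `Real.log 0 = 0` makes the argument of γ equal to -log R here. It lies below -7/10 because R ≥
  -- 3.
  · rw [h, norm_zero, Real.log_zero]
    have h1 : (1 : ℝ) ≤ Real.log R := by
      rw [Real.le_log_iff_exp_le hR0]
      linarith [Real.exp_one_lt_d9]
    linarith
  · have h1 := Real.log_le_log (norm_pos_iff.2 h) hz
    rw [Real.log_mul hR0.ne' (Real.exp_pos _).ne', Real.log_exp] at h1
    linarith

theorem contDiff_angular (hγ : ContDiff ℝ ∞ γ) (hγ0 : ∀ t, t ≤ -(7 / 10) → γ t = 0)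
    (hΛ : ContDiff ℝ ∞ Λ) (hper : Function.Periodic Λ (2 * Real.pi)) (hR : 3 ≤ R) :
    ContDiff ℝ ∞ (angular γ Λ R) := by
  rw [contDiff_iff_contDiffAt]
  intro z₀
  by_cases h : z₀ = 0
  · have h1 : angular γ Λ R =ᶠ[𝓝 z₀] fun _ => 0 := by
      have hpos : 0 < R * Real.exp (-(7 / 10)) := by have := Real.exp_pos (-(7 / 10)); positivity
      filter_upwards [Metric.ball_mem_nhds z₀ hpos] with z hz
      rw [h, mem_ball_zero_iff] at hz
      exact angular_eq_zero hγ0 hR hz.le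
    exact contDiffAt_const.congr_of_eventuallyEq h1
  -- `Complex.arg` jumps across the negative axis. Since Λ is 2π-periodic, it may be replaced near
  -- z₀ by the smooth branch arg z₀ + Im log(z/z₀).
  · have h1 : angular γ Λ R =ᶠ[𝓝 z₀] fun z => γ (Real.log ‖z‖ - Real.log R) •
        Λ (Complex.arg z₀ + (Complex.log (z / z₀)).im) := by
      filter_upwards [isOpen_ne.mem_nhds h] with z hz
      have hr : 0 < ‖z‖ := norm_pos_iff.2 hz
      have e : z = ‖z‖ * Complex.exp (Complex.I *
          ((Complex.arg z₀ + (Complex.log (z / z₀)).im : ℝ) : ℂ)) := by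
        rw [Complex.log_im]
        push_cast
        rw [mul_add, Complex.exp_add]
        have e1 := Complex.norm_mul_exp_arg_mul_I z₀
        have e2 := Complex.norm_mul_exp_arg_mul_I (z / z₀)
        have e3 : (‖z‖ : ℂ) = ‖z₀‖ * ‖z / z₀‖ := by
          rw [norm_div]
          push_cast
          have : (‖z₀‖ : ℂ) ≠ 0 := by exact_mod_cast norm_ne_zero_iff.2 h
          field_simp
        rw [e3, mul_comm Complex.I, mul_comm Complex.I]
        calc z = z₀ * (z / z₀) := by field_simp
          _ = (‖z₀‖ * Complex.exp (Complex.arg z₀ * Complex.I)) *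
            (‖z / z₀‖ * Complex.exp (Complex.arg (z / z₀) * Complex.I)) := by rw [e1, e2]
          _ = _ := by ring
      conv_lhs => rw [e]
      rw [angular_circle hper R hr]
    refine ContDiffAt.congr_of_eventuallyEq ?_ h1
    have d1 : ContDiffAt ℝ ∞ (fun z : ℂ => γ (Real.log ‖z‖ - Real.log R)) z₀ :=
      hγ.contDiffAt.comp z₀ ((((contDiffAt_norm ℝ h).log (norm_ne_zero_iff.2 h))).sub
        contDiffAt_const)
    have d2 : ContDiffAt ℝ ∞ (fun z : ℂ => Complex.log (z / z₀)) z₀ := by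
      have l1 : ContDiffAt ℝ ∞ Complex.log (z₀ / z₀) := by
        rw [div_self h]
        exact (Complex.contDiffAt_log Complex.one_mem_slitPlane).restrict_scalars ℝ
      exact ContDiffAt.comp (g := Complex.log) (f := fun z => z / z₀) z₀ l1
        (contDiffAt_id.div_const z₀)
    have d3 : ContDiffAt ℝ ∞ (fun z : ℂ => Complex.arg z₀ + (Complex.log (z / z₀)).im) z₀ :=
      contDiffAt_const.add (Complex.imCLM.contDiff.contDiffAt.comp z₀ d2)
    exact d1.smul (hΛ.contDiffAt.comp z₀ d3)

/-- The coordinates (log r, θ) are conformal with factor r, so r²|∇|² separates into a radial and an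
angular derivative. -/
theorem norm_grad_angular_sq (hγ : ContDiff ℝ ∞ γ) (hγ0 : ∀ t, t ≤ -(7 / 10) → γ t = 0)
    (hΛ : ContDiff ℝ ∞ Λ) (hper : Function.Periodic Λ (2 * Real.pi)) (hR : 3 ≤ R) {r : ℝ}
    (hr : 0 < r) (θ : ℝ) :
    r ^ 2 * ‖grad (angular γ Λ R) (r * Complex.exp (Complex.I * θ))‖ ^ 2
      = deriv γ (Real.log r - Real.log R) ^ 2 * ‖Λ θ‖ ^ 2
        + γ (Real.log r - Real.log R) ^ 2 * ‖deriv Λ θ‖ ^ 2 := by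
  have hs := contDiff_angular hγ hγ0 hΛ hper hR
  set z : ℂ := r * Complex.exp (Complex.I * θ) with hz
  have hdz : HasFDerivAt (angular γ Λ R) (fderiv ℝ (angular γ Λ R) z) z :=
    (hs.differentiable (by simp) z).hasFDerivAt
  have hγd : HasDerivAt γ (deriv γ (Real.log r - Real.log R)) (Real.log r - Real.log R) :=
    (hγ.differentiable (by simp) _).hasDerivAt
  have hΛd : HasDerivAt Λ (deriv Λ θ) θ := (hΛ.differentiable (by simp) _).hasDerivAt
  have t1 : fderiv ℝ (angular γ Λ R) z (Complex.I * z)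
      = γ (Real.log r - Real.log R) • deriv Λ θ := by
    have h1 := hdz.comp_hasDerivAt θ (hasDerivAt_circle r θ)
    have h2 : (angular γ Λ R ∘ fun θ : ℝ => (r : ℂ) * Complex.exp (Complex.I * θ))
        = fun θ => γ (Real.log r - Real.log R) • Λ θ :=
      funext fun θ => angular_circle hper R hr θ
    rw [h2] at h1
    exact h1.unique (hΛd.fun_const_smul _)
  have t2 : fderiv ℝ (angular γ Λ R) z z = deriv γ (Real.log r - Real.log R) • Λ θ := by
    have h0 : HasDerivAt (fun ρ : ℝ => (ρ : ℂ) * Complex.exp (Complex.I * θ))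
        (Complex.exp (Complex.I * θ)) r := by
      have := (Complex.ofRealCLM.hasDerivAt (x := r)).mul_const (Complex.exp (Complex.I * θ))
      simpa using this
    have h1 := hdz.comp_hasDerivAt r h0
    have h2 : (angular γ Λ R ∘ fun ρ : ℝ => (ρ : ℂ) * Complex.exp (Complex.I * θ))
        =ᶠ[𝓝 r] fun ρ => γ (Real.log ρ - Real.log R) • Λ θ := by
      filter_upwards [lt_mem_nhds hr] with ρ hρ
      exact angular_circle hper R hρ θ
    have h3 : HasDerivAt (fun ρ => γ (Real.log ρ - Real.log R))
        (deriv γ (Real.log r - Real.log R) * r⁻¹) r :=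
      hγd.comp r ((Real.hasDerivAt_log hr.ne').sub_const _)
    have h4 := (h1.congr_of_eventuallyEq h2.symm).unique (h3.smul_const (Λ θ))
    have h5 : z = r • Complex.exp (Complex.I * θ) := by rw [hz, Complex.real_smul]
    nth_rewrite 2 [h5]
    rw [map_smul, h4, smul_smul]
    congr 1
    field_simp
  have h := norm_sq_mul_norm_grad_sq (angular γ Λ R) z
  rw [t1, t2, hz, norm_circle hr.le, ← hz, norm_smul, norm_smul, mul_pow, mul_pow,
    Real.norm_eq_abs, Real.norm_eq_abs, sq_abs, sq_abs] at h
  exact h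

theorem grad_angular_eq_zero (hγ0 : ∀ t, t ≤ -(7 / 10) → γ t = 0) (hR : 3 ≤ R) {z : ℂ}
    (hz : ‖z‖ < R * Real.exp (-(7 / 10))) : ‖grad (angular γ Λ R) z‖ = 0 := by
  have h1 : angular γ Λ R =ᶠ[𝓝 z] fun _ => 0 := by
    filter_upwards [(isOpen_lt continuous_norm continuous_const).mem_nhds hz] with w hw
    exact angular_eq_zero hγ0 hR (le_of_lt hw)
  have h2 : ‖grad (angular γ Λ R) z‖ ^ 2 = 0 := by
    rw [norm_grad_sq, dx, dy, h1.fderiv_eq]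
    simp
  exact pow_eq_zero_iff two_ne_zero |>.1 h2

theorem angular_rotate {α : ℝ} (hΛα : Function.Periodic Λ α)
    (hper : Function.Periodic Λ (2 * Real.pi)) (z : ℂ) :
    angular γ Λ R (Complex.exp (Complex.I * α) * z) = angular γ Λ R z := by
  by_cases h : z = 0
  · rw [h, mul_zero]
  · have hr : 0 < ‖z‖ := norm_pos_iff.2 h
    have e1 : z = ‖z‖ * Complex.exp (Complex.I * Complex.arg z) := by
      rw [mul_comm Complex.I, Complex.norm_mul_exp_arg_mul_I]
    have e2 : Complex.exp (Complex.I * α) * z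
        = ‖z‖ * Complex.exp (Complex.I * ((Complex.arg z + α : ℝ) : ℂ)) := by
      push_cast
      rw [mul_add, Complex.exp_add]
      nth_rewrite 1 [e1]
      ring
    rw [e2, angular_circle hper R hr, hΛα]
    rfl

theorem angular_conj (hΛc : ∀ θ, Λ (-θ) = starRingEnd ℂ (Λ θ))
    (hper : Function.Periodic Λ (2 * Real.pi)) (z : ℂ) :
    angular γ Λ R (starRingEnd ℂ z) = starRingEnd ℂ (angular γ Λ R z) := by
  by_cases h : z = 0
  · have h0 : starRingEnd ℂ (Λ 0) = Λ 0 := by rw [← hΛc, neg_zero]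
    rw [h, map_zero]
    unfold angular
    rw [Complex.arg_zero, Complex.real_smul, map_mul, h0, Complex.conj_ofReal]
  · have hr : 0 < ‖z‖ := norm_pos_iff.2 h
    have e1 : z = ‖z‖ * Complex.exp (Complex.I * Complex.arg z) := by
      rw [mul_comm Complex.I, Complex.norm_mul_exp_arg_mul_I]
    have e2 : starRingEnd ℂ z = ‖z‖ * Complex.exp (Complex.I * ((-Complex.arg z : ℝ) : ℂ)) := by
      nth_rewrite 1 [e1]
      rw [map_mul, Complex.conj_ofReal, ← Complex.exp_conj]
      simp
    rw [e2, angular_circle hper R hr, hΛc]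
    unfold angular
    rw [Complex.real_smul, Complex.real_smul, map_mul, Complex.conj_ofReal]

end

/-! ### Boundary values of u relative to the model. -/

/-- On the circle of radius `R`, the map `u` is the product of the constant `c`, the model map and
`exp Λ`, where `Λ` has the symmetries of the dihedral group. -/
structure IsBoundaryPhase (p : ℕ) (k : ℤ) (R : ℝ) (u : ℂ → ℂ) (c : ℂ) (Λ : ℝ → ℂ) : Prop where
  smooth : ContDiff ℝ ∞ Λ
  periodic : Function.Periodic Λ (Real.pi / (p + 1))
  conj : ∀ θ, Λ (-θ) = starRingEnd ℂ (Λ θ)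
  norm_c : ‖c‖ = 1
  eq : ∀ θ : ℝ, u (R * Complex.exp (Complex.I * θ))
    = c * (model p k R (R * Complex.exp (Complex.I * θ)) * Complex.exp (Λ θ))

/-- Λ is the difference of lifts of u and of the model, made symmetric by moving the constant phase
Im L(0) into c. Equal winding makes Λ periodic, and the relation between c and its conjugate carries
the sign s to the competitor. -/
theorem exists_isBoundaryPhase {p : ℕ} {k : ℤ} {R : ℝ} (hR : 0 < R) {u : ℂ → ℂ} {s : ℤˣ}
    (hue : ∀ z, u (starRingEnd ℂ z) = ((s : ℤ) : ℂ) * starRingEnd ℂ (u z))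
    {L : ℝ → ℂ} (hL : ContDiff ℝ ∞ L)
    (hexp : ∀ θ : ℝ, Complex.exp (L θ) = u (R * Complex.exp (Complex.I * θ)))
    (hshift : ∀ θ, L (θ + Real.pi / (p + 1))
      = L θ + Complex.I * (Real.pi / (p + 1) * (-p) + 2 * Real.pi * k)) :
    ∃ c Λ, IsBoundaryPhase p k R u c Λ ∧ c = ((s : ℤ) : ℂ) * starRingEnd ℂ c := by
  obtain ⟨B, hBs, hBe, hBt, hBc⟩ := exists_lift_model p k hR
  have hLd : Differentiable ℝ L := hL.differentiable (by simp)
  have hcd : Differentiable ℝ fun θ => L (-θ) - starRingEnd ℂ (L θ) :=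
    (hLd.comp differentiable_neg).sub
      ((Complex.conjCLE : ℂ →L[ℝ] ℂ).differentiable.comp hLd)
  have hconst : ∀ θ, Complex.exp (L (-θ) - starRingEnd ℂ (L θ)) = ((s : ℤ) : ℂ) := by
    intro θ
    have hne : starRingEnd ℂ (u (R * Complex.exp (Complex.I * θ))) ≠ 0 := by
      rw [← hexp]; simp
    have h1 : (R : ℂ) * Complex.exp (Complex.I * ((-θ : ℝ) : ℂ))
        = starRingEnd ℂ (R * Complex.exp (Complex.I * θ)) := by
      rw [map_mul, Complex.conj_ofReal, ← Complex.exp_conj]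
      simp
    rw [Complex.exp_sub, Complex.exp_conj, hexp, hexp, h1, hue]
    field_simp
  -- L(-θ) - conj L(θ) has constant exponential s, so it is constant and equals its value 2i Im L(0)
  -- at θ = 0.
  have hsym : ∀ θ, L (-θ) = starRingEnd ℂ (L θ) + 2 * ((L 0).im : ℂ) * Complex.I := by
    intro θ
    have h1 := eq_of_exp_const hcd hconst θ 0
    rw [neg_zero, Complex.sub_conj] at h1
    rw [sub_eq_iff_eq_add] at h1
    rw [h1]
    push_cast
    ring
  set c := Complex.exp (((L 0).im : ℂ) * Complex.I) with hc
  have hcs : c = ((s : ℤ) : ℂ) * starRingEnd ℂ c := by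
    have h1 := hconst 0
    rw [neg_zero, Complex.sub_conj] at h1
    rw [← h1, hc, ← Complex.exp_conj, ← Complex.exp_add]
    congr 1
    simp
    ring
  refine ⟨c, fun θ => L θ - ((L 0).im : ℂ) * Complex.I - B θ, ⟨(hL.sub contDiff_const).sub hBs,
    fun θ => ?_, fun θ => ?_, Complex.norm_exp_ofReal_mul_I _, fun θ => ?_⟩, hcs⟩
  · simp only [hshift, hBt]
    ring
  · simp only [hsym, hBc, map_sub, map_mul, Complex.conj_ofReal, Complex.conj_I]
    ring
  · rw [← hBe, ← hexp, hc, ← Complex.exp_add, ← Complex.exp_add]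
    congr 1
    ring

/-- Scaling the exponent by g ∈ [0,1] moves e^{2x} towards 1, so the potential in the layer is
bounded by that on the circle. -/
theorem abs_one_sub_exp_le {g x : ℝ} (hg0 : 0 ≤ g) (hg1 : g ≤ 1) :
    (1 - Real.exp (2 * (g * x))) ^ 2 ≤ (1 - Real.exp (2 * x)) ^ 2 := by
  rcases le_total 0 x with h | h
  · have h1 : 0 ≤ g * x := mul_nonneg hg0 h
    have h2 : g * x ≤ x := by nlinarith
    have h3 : Real.exp (2 * (g * x)) ≤ Real.exp (2 * x) := Real.exp_le_exp.2 (by linarith)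
    have h4 : 1 ≤ Real.exp (2 * (g * x)) := Real.one_le_exp (by linarith)
    nlinarith
  · have h1 : g * x ≤ 0 := mul_nonpos_of_nonneg_of_nonpos hg0 h
    have h2 : x ≤ g * x := by nlinarith
    have h3 : Real.exp (2 * x) ≤ Real.exp (2 * (g * x)) := Real.exp_le_exp.2 (by linarith)
    have h4 : Real.exp (2 * (g * x)) ≤ 1 := Real.exp_le_one_iff.2 (by linarith)
    nlinarith

theorem sq_le_one_sub_exp_sq {x : ℝ} (hx : 99 / 100 ≤ Real.exp (2 * x)) :
    x ^ 2 ≤ (1 - Real.exp (2 * x)) ^ 2 := by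
  rcases le_total 0 x with h | h
  · have := Real.add_one_le_exp (2 * x)
    nlinarith
  · have h1 := Real.add_one_le_exp (-(2 * x))
    have h2 : Real.exp (2 * x) * Real.exp (-(2 * x)) = 1 := by
      rw [← Real.exp_add]; simp
    have h3 : Real.exp (2 * x) ≤ 1 := Real.exp_le_one_iff.2 (by linarith)
    have h4 : Real.exp (2 * x) * (1 - 2 * x) ≤ 1 := by nlinarith
    have h5 : -(1 / 2) ≤ x := by nlinarith
    have h6 : -x ≤ 1 - Real.exp (2 * x) := by nlinarith
    nlinarith

section

variable {p : ℕ} {k : ℤ} {R : ℝ} {u : ℂ → ℂ} {c : ℂ} {Λ : ℝ → ℂ}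

theorem IsBoundaryPhase.periodic_two_pi (h : IsBoundaryPhase p k R u c Λ) :
    Function.Periodic Λ (2 * Real.pi) := by
  have h1 := h.periodic.nat_mul (2 * (p + 1))
  have h2 : ((2 * (p + 1) : ℕ) : ℝ) * (Real.pi / (p + 1)) = 2 * Real.pi := by
    push_cast; field_simp
  rwa [h2] at h1

theorem norm_model_sq_ge (hR : 1 ≤ R) (hRK : 1000 * (36 * ((p : ℝ) + k.natAbs)) ≤ R ^ 2) {z : ℂ}
    (hz : R / 3 ≤ ‖z‖) : 999 / 1000 ≤ ‖model p k R z‖ ^ 2 := by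
  have h1 := one_sub_norm_model_sq_le_outer p k (by linarith : 0 < R) hz
  have h2 : 36 * ((p : ℝ) + k.natAbs) / R ^ 2 ≤ 1 / 1000 := by
    rw [div_le_iff₀ (by positivity)]; linarith
  linarith

theorem IsBoundaryPhase.norm_eq (h : IsBoundaryPhase p k R u c Λ) (θ : ℝ) :
    ‖u (R * Complex.exp (Complex.I * θ))‖ ^ 2
      = ‖model p k R (R * Complex.exp (Complex.I * θ))‖ ^ 2 * Real.exp (2 * (Λ θ).re) := by
  rw [h.eq, norm_mul, norm_mul, h.norm_c, Complex.norm_exp, one_mul, mul_pow, ← Real.exp_nat_mul]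
  norm_num

/-- e^{2 Re Λ} = |u|²/|model|², and the model has modulus 1 + O(R⁻²). The factor 102/25 slightly
exceeds the 4 in (1-|u|²)² = 4W, to pay for the model's defect with a small weight. -/
theorem IsBoundaryPhase.one_sub_exp_sq_le (h : IsBoundaryPhase p k R u c Λ) (hR : 1 ≤ R)
    (hRK : 1000 * (36 * ((p : ℝ) + k.natAbs)) ≤ R ^ 2) (θ : ℝ) :
    (1 - Real.exp (2 * (Λ θ).re)) ^ 2 ≤ 102 / 25 * W (u (R * Complex.exp (Complex.I * θ)))
      + 103 * (36 * ((p : ℝ) + k.natAbs) / R ^ 2) ^ 2 := by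
  have hz : ‖(R : ℂ) * Complex.exp (Complex.I * θ)‖ = R := norm_circle (by linarith) θ
  have h1 := h.norm_eq θ
  have h2 := norm_model_sq_ge hR hRK (z := R * Complex.exp (Complex.I * θ)) (by rw [hz]; linarith)
  have h3 := one_sub_norm_model_sq_le_outer p k (by linarith : 0 < R)
    (z := R * Complex.exp (Complex.I * θ)) (by rw [hz]; linarith)
  have h4 := norm_model_le_one p k (by linarith : 0 < R) (R * Complex.exp (Complex.I * θ))
  have h5 : ‖model p k R (R * Complex.exp (Complex.I * θ))‖ ^ 2 ≤ 1 :=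
    pow_le_one₀ (norm_nonneg _) h4
  unfold W
  set b := ‖model p k R (R * Complex.exp (Complex.I * θ))‖ ^ 2
  set m := ‖u (R * Complex.exp (Complex.I * θ))‖ ^ 2
  set y := Real.exp (2 * (Λ θ).re)
  set K := 36 * ((p : ℝ) + k.natAbs) / R ^ 2
  have h6 : b * (1 - y) = (1 - m) - (1 - b) := by rw [h1]; ring
  have h7 : (b * (1 - y)) ^ 2 ≤ 101 / 100 * (1 - m) ^ 2 + 101 * (1 - b) ^ 2 := by
    rw [h6]; nlinarith [sq_nonneg ((1 - m) + 100 * (1 - b))]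
  have h8 : (1 - b) ^ 2 ≤ K ^ 2 := by
    have : 0 ≤ 1 - b := by linarith
    gcongr
  have h9 : (999 / 1000) ^ 2 * (1 - y) ^ 2 ≤ b ^ 2 * (1 - y) ^ 2 := by gcongr
  nlinarith [sq_nonneg (1 - m), sq_nonneg K]

theorem IsBoundaryPhase.exp_bounds (h : IsBoundaryPhase p k R u c Λ) (hR : 1 ≤ R)
    (hRK : 1000 * (36 * ((p : ℝ) + k.natAbs)) ≤ R ^ 2) {θ : ℝ}
    (hu1 : 999 / 1000 ≤ ‖u (R * Complex.exp (Complex.I * θ))‖)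
    (hu2 : ‖u (R * Complex.exp (Complex.I * θ))‖ ≤ 1001 / 1000) :
    99 / 100 ≤ Real.exp (2 * (Λ θ).re) ∧ Real.exp (2 * (Λ θ).re) ≤ 1005 / 1000 := by
  have hz : ‖(R : ℂ) * Complex.exp (Complex.I * θ)‖ = R := norm_circle (by linarith) θ
  have h1 := h.norm_eq θ
  have h2 := norm_model_sq_ge hR hRK (z := R * Complex.exp (Complex.I * θ)) (by rw [hz]; linarith)
  have h4 := norm_model_le_one p k (by linarith : 0 < R) (R * Complex.exp (Complex.I * θ))
  have h5 : ‖model p k R (R * Complex.exp (Complex.I * θ))‖ ^ 2 ≤ 1 :=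
    pow_le_one₀ (norm_nonneg _) h4
  have hy := Real.exp_pos (2 * (Λ θ).re)
  constructor <;> nlinarith

theorem IsBoundaryPhase.norm_deriv_sq_le (h : IsBoundaryPhase p k R u c Λ)
    (hu : ContDiff ℝ ∞ u) (hR : 1 ≤ R)
    (hRK : 1000 * (36 * ((p : ℝ) + k.natAbs)) ≤ R ^ 2) {θ : ℝ}
    (hu1 : 999 / 1000 ≤ ‖u (R * Complex.exp (Complex.I * θ))‖) :
    ‖deriv Λ θ‖ ^ 2 ≤ 10125 / 10000 * ‖tang u R θ‖ ^ 2
      + 102 * (32 * p + 64 * (p + 1) * k.natAbs) ^ 2 := by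
  have hR0 : 0 < R := by linarith
  set z : ℂ := R * Complex.exp (Complex.I * θ) with hz'
  have hz : ‖z‖ = R := norm_circle hR0.le θ
  set G : ℝ := 32 * p + 64 * (p + 1) * k.natAbs with hG
  have hG0 : 0 ≤ G := by positivity
  have hΛd := (h.smooth.differentiable (by simp) θ).hasDerivAt
  have hB := hasDerivAt_comp_circle (contDiff_model p k hR0) R θ
  have hU := hasDerivAt_comp_circle hu R θ
  have hprod := (hB.fun_mul hΛd.cexp).const_mul c
  have hfun : (fun θ : ℝ => u (R * Complex.exp (Complex.I * θ)))
      = fun θ : ℝ => c * (model p k R (R * Complex.exp (Complex.I * θ)) * Complex.exp (Λ θ)) :=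
    funext h.eq
  rw [hfun] at hU
  have heq := hU.unique hprod
  have hb2 := norm_model_sq_ge hR hRK (z := z) (by rw [hz]; linarith)
  have hb1 := norm_model_le_one p k hR0 z
  have hb : 999 / 1000 ≤ ‖model p k R z‖ := by nlinarith [norm_nonneg (model p k R z)]
  have htB : ‖tang (model p k R) R θ‖ ≤ G := by
    have h1 := norm_tang_sq_le (model p k R) hR0.le θ
    have h2 := norm_grad_model_le_outer p k hR0 (z := z) (by rw [hz]; linarith)
    rw [← hG, le_div_iff₀ hR0] at h2
    rw [← mul_pow] at h1
    have h3 := abs_le_of_sq_le_sq' h1 (by positivity)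
    rw [← hz'] at h3
    linarith [h3.2]
  have hne : model p k R z ≠ 0 := by
    intro h0; rw [h0, norm_zero] at hb; norm_num at hb
  have hune : u z ≠ 0 := by
    intro h0; rw [h0, norm_zero] at hu1; norm_num at hu1
  -- The logarithmic derivative of u = c·model·e^Λ. The model's term is bounded on the circle, so in
  -- the square it adds a constant while the coefficient of |∂_θ u|² stays near 1.
  have hΛ' : deriv Λ θ = tang u R θ / u z - tang (model p k R) R θ / model p k R z := by
    have h1 := h.eq θ
    rw [← hz'] at h1 heq
    have hcne : c * (model p k R z * Complex.exp (Λ θ)) ≠ 0 := by rw [← h1]; exact hune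
    rw [heq, h1]
    have hcn : c ≠ 0 := fun h0 => hcne (by rw [h0, zero_mul])
    have hen := Complex.exp_ne_zero (Λ θ)
    field_simp
    ring
  set a := ‖tang u R θ‖ with ha
  have ha0 : 0 ≤ a := norm_nonneg _
  have hle : ‖deriv Λ θ‖ ≤ (a + G) / (999 / 1000) := by
    rw [hΛ', add_div]
    refine (norm_sub_le _ _).trans (add_le_add ?_ ?_)
    · rw [norm_div]; gcongr
    · rw [norm_div]; gcongr
  calc ‖deriv Λ θ‖ ^ 2 ≤ ((a + G) / (999 / 1000)) ^ 2 := by gcongr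
    _ ≤ _ := by
        rw [div_pow, div_le_iff₀ (by norm_num)]
        nlinarith [sq_nonneg (a - 100 * G), sq_nonneg a, sq_nonneg G]

end

/-! ### Energy of the competitor. -/

/-- The properties of the radial transition profile used by the competitor. -/
structure IsTransition (γ : ℝ → ℝ) : Prop where
  smooth : ContDiff ℝ ∞ γ
  eq_zero : ∀ t, t ≤ -(7 / 10) → γ t = 0
  at_zero : γ 0 = 1
  nonneg : ∀ t, 0 ≤ γ t
  le_one : ∀ t, γ t ≤ 1
  le_linear : ∀ t, -(7 / 10) ≤ t → γ t ≤ 3 / 2 * (t + 7 / 10)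
  deriv_le : ∀ t, |deriv γ t| ≤ 3 / 2

section

variable {γ : ℝ → ℝ} {Λ : ℝ → ℂ} {R : ℝ}

theorem integral_norm_grad_angular_sq_le (hγ : IsTransition γ) (hΛ : ContDiff ℝ ∞ Λ)
    (hper : Function.Periodic Λ (2 * Real.pi)) (hR : 3 ≤ R) :
    ∫ z in Metric.ball (0 : ℂ) R, ‖grad (angular γ Λ R) z‖ ^ 2
      ≤ 9 / 4 * (7 / 10 * (∫ θ in (-Real.pi)..Real.pi, ‖Λ θ‖ ^ 2)
        + 343 / 3000 * ∫ θ in (-Real.pi)..Real.pi, ‖deriv Λ θ‖ ^ 2) := by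
  have hR0 : 0 < R := by linarith
  have hpi := Real.pi_pos
  set P := ∫ θ in (-Real.pi)..Real.pi, ‖Λ θ‖ ^ 2 with hP
  set P' := ∫ θ in (-Real.pi)..Real.pi, ‖deriv Λ θ‖ ^ 2 with hP'
  have hP0 : 0 ≤ P := intervalIntegral.integral_nonneg (by linarith) fun _ _ => sq_nonneg _
  have hP'0 : 0 ≤ P' := intervalIntegral.integral_nonneg (by linarith) fun _ _ => sq_nonneg _
  have hs := contDiff_angular hγ.smooth hγ.eq_zero hΛ hper hR
  have hfc : Continuous fun z => ‖grad (angular γ Λ R) z‖ ^ 2 := (continuous_norm_grad hs).pow 2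
  have hΛc := hΛ.continuous
  have hdc : Continuous (deriv Λ) := (contDiff_infty_iff_deriv.1 hΛ).2.continuous
  set r₀ := R * Real.exp (-(7 / 10)) with hr₀
  have hr₀0 : 0 < r₀ := by have := Real.exp_pos (-(7 / 10)); positivity
  have hr₀R : r₀ ≤ R := by
    have : Real.exp (-(7 / 10)) ≤ 1 := Real.exp_le_one_iff.2 (by norm_num)
    nlinarith
  have hlog0 : Real.log r₀ = Real.log R - 7 / 10 := by
    rw [hr₀, Real.log_mul hR0.ne' (Real.exp_pos _).ne', Real.log_exp]; ring
  rw [integral_ball_eq_polar hfc hR0.le]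
  have hhc : Continuous fun r : ℝ => r * ∫ θ in (-Real.pi)..Real.pi,
      ‖grad (angular γ Λ R) (r * Complex.exp (Complex.I * θ))‖ ^ 2 :=
    continuous_id.mul (continuous_circle_integral hfc)
  rw [← intervalIntegral.integral_add_adjacent_intervals (hhc.intervalIntegrable 0 r₀)
    (hhc.intervalIntegrable r₀ R)]
  have hin : ∫ r in (0 : ℝ)..r₀, r * ∫ θ in (-Real.pi)..Real.pi,
      ‖grad (angular γ Λ R) (r * Complex.exp (Complex.I * θ))‖ ^ 2 ≤ 0 := by
    have h1 : ∫ r in (0 : ℝ)..r₀, r * ∫ θ in (-Real.pi)..Real.pi,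
        ‖grad (angular γ Λ R) (r * Complex.exp (Complex.I * θ))‖ ^ 2
        ≤ ∫ _ in (0 : ℝ)..r₀, (0 : ℝ) := by
      refine intervalIntegral.integral_mono_on_of_le_Ioo hr₀0.le (hhc.intervalIntegrable _ _)
        (by simp) fun r hr => ?_
      have h2 : ∀ θ : ℝ, ‖grad (angular γ Λ R) (r * Complex.exp (Complex.I * θ))‖ ^ 2 = 0 := by
        intro θ
        rw [grad_angular_eq_zero hγ.eq_zero hR (by rw [norm_circle hr.1.le]; exact hr.2)]
        norm_num
      simp [h2]
    simpa using h1
  -- With s = log(r/R) + 7/10 running over [0, 7/10], γ'² ≤ 9/4 and γ² ≤ (9/4)s². The integrals of 1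
  -- and s² give the constants 7/10 and 343/3000.
  have hG : ∀ r ∈ Set.uIcc r₀ R, HasDerivAt
      (fun r => 9 / 4 * (P * Real.log r + P' / 3 * (Real.log r - Real.log R + 7 / 10) ^ 3))
      (9 / 4 * (P + P' * (Real.log r - Real.log R + 7 / 10) ^ 2) / r) r := by
    intro r hr
    rw [Set.uIcc_of_le hr₀R] at hr
    have hr0 : 0 < r := lt_of_lt_of_le hr₀0 hr.1
    have hl := Real.hasDerivAt_log hr0.ne'
    have h1 := ((hl.sub_const (Real.log R)).add_const (7 / 10)).fun_pow 3
    refine (((hl.const_mul P).fun_add (h1.const_mul (P' / 3))).const_mul (9 / 4)).congr_deriv ?_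
    field_simp
    norm_num
    ring
  have hGi : IntervalIntegrable
      (fun r => 9 / 4 * (P + P' * (Real.log r - Real.log R + 7 / 10) ^ 2) / r) volume r₀ R := by
    apply ContinuousOn.intervalIntegrable
    rw [Set.uIcc_of_le hr₀R]
    have hne : ∀ r ∈ Set.Icc r₀ R, r ≠ 0 := fun r hr => (lt_of_lt_of_le hr₀0 hr.1).ne'
    have hlogc : ContinuousOn Real.log (Set.Icc r₀ R) := Real.continuousOn_log.mono hne
    refine ContinuousOn.div ?_ continuousOn_id hne
    fun_prop
  have hout : ∫ r in r₀..R, r * ∫ θ in (-Real.pi)..Real.pi,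
      ‖grad (angular γ Λ R) (r * Complex.exp (Complex.I * θ))‖ ^ 2
      ≤ ∫ r in r₀..R, 9 / 4 * (P + P' * (Real.log r - Real.log R + 7 / 10) ^ 2) / r := by
    refine intervalIntegral.integral_mono_on hr₀R (hhc.intervalIntegrable _ _) hGi fun r hr => ?_
    have hr0 : 0 < r := lt_of_lt_of_le hr₀0 hr.1
    set t := Real.log r - Real.log R with ht
    have ht0 : -(7 / 10) ≤ t := by
      have := Real.log_le_log hr₀0 hr.1
      rw [hlog0] at this
      linarith
    have h1 : ∀ θ : ℝ, ‖grad (angular γ Λ R) (r * Complex.exp (Complex.I * θ))‖ ^ 2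
        = (deriv γ t ^ 2 * ‖Λ θ‖ ^ 2 + γ t ^ 2 * ‖deriv Λ θ‖ ^ 2) / r ^ 2 := by
      intro θ
      rw [← norm_grad_angular_sq hγ.smooth hγ.eq_zero hΛ hper hR hr0 θ]
      field_simp
    simp_rw [h1]
    rw [intervalIntegral.integral_div, intervalIntegral.integral_add
      (by apply Continuous.intervalIntegrable; fun_prop)
      (by apply Continuous.intervalIntegrable; fun_prop),
      intervalIntegral.integral_const_mul, intervalIntegral.integral_const_mul, ← hP, ← hP']
    have h2 : deriv γ t ^ 2 ≤ 9 / 4 := by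
      rw [← sq_abs]
      have := hγ.deriv_le t
      nlinarith [abs_nonneg (deriv γ t)]
    have h3 : γ t ^ 2 ≤ 9 / 4 * (t + 7 / 10) ^ 2 := by
      have h4 := hγ.le_linear t ht0
      have h5 := hγ.nonneg t
      calc γ t ^ 2 ≤ (3 / 2 * (t + 7 / 10)) ^ 2 := by gcongr
        _ = _ := by ring
    have h6 : r * ((deriv γ t ^ 2 * P + γ t ^ 2 * P') / r ^ 2)
        = (deriv γ t ^ 2 * P + γ t ^ 2 * P') / r := by field_simp
    rw [h6]
    gcongr
    nlinarith [mul_le_mul_of_nonneg_right h2 hP0, mul_le_mul_of_nonneg_right h3 hP'0]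
  rw [intervalIntegral.integral_eq_sub_of_hasDerivAt hG hGi, hlog0] at hout
  refine (add_le_add hin hout).trans_eq ?_
  ring

theorem integral_one_sub_exp_angular_le (hγ : IsTransition γ) (hΛ : ContDiff ℝ ∞ Λ)
    (hper : Function.Periodic Λ (2 * Real.pi)) (hR : 3 ≤ R) :
    ∫ z in Metric.ball (0 : ℂ) R, (1 - Real.exp (2 * (angular γ Λ R z).re)) ^ 2
      ≤ R ^ 2 / 2 * ∫ θ in (-Real.pi)..Real.pi, (1 - Real.exp (2 * (Λ θ).re)) ^ 2 := by
  have hR0 : 0 < R := by linarith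
  have hpi := Real.pi_pos
  have hs := (contDiff_angular hγ.smooth hγ.eq_zero hΛ hper hR).continuous
  have hΛc := hΛ.continuous
  have hfc : Continuous fun z => (1 - Real.exp (2 * (angular γ Λ R z).re)) ^ 2 :=
    (continuous_const.sub (Real.continuous_exp.comp
      (continuous_const.mul (Complex.continuous_re.comp hs)))).pow 2
  set S := ∫ θ in (-Real.pi)..Real.pi, (1 - Real.exp (2 * (Λ θ).re)) ^ 2 with hS
  rw [integral_ball_eq_polar hfc hR0.le]
  have hhc := continuous_id.mul (continuous_circle_integral hfc)
  have h1 : ∫ r in (0 : ℝ)..R, r * ∫ θ in (-Real.pi)..Real.pi,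
      (1 - Real.exp (2 * (angular γ Λ R (r * Complex.exp (Complex.I * θ))).re)) ^ 2
      ≤ ∫ r in (0 : ℝ)..R, r * S := by
    refine intervalIntegral.integral_mono_on_of_le_Ioo hR0.le (hhc.intervalIntegrable _ _)
      (by apply Continuous.intervalIntegrable; fun_prop) fun r hr => ?_
    refine mul_le_mul_of_nonneg_left ?_ hr.1.le
    refine intervalIntegral.integral_mono_on (by linarith)
      ((hfc.comp (by fun_prop : Continuous fun θ : ℝ =>
        (r : ℂ) * Complex.exp (Complex.I * θ))).intervalIntegrable _ _)
      (by apply Continuous.intervalIntegrable; fun_prop) fun θ _ => ?_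
    rw [angular_circle hper R hr.1, Complex.smul_re, smul_eq_mul]
    exact abs_one_sub_exp_le (hγ.nonneg _) (hγ.le_one _)
  refine h1.trans_eq ?_
  rw [intervalIntegral.integral_mul_const, integral_id]
  ring

end

/-- Only Im Λ is odd under reflection, so the Poincaré inequality applies to it alone. Re Λ is kept,
to be bounded by W(u). -/
theorem IsBoundaryPhase.integral_norm_sq_le {p : ℕ} (hp : 1 ≤ p) {k : ℤ} {R : ℝ} {u : ℂ → ℂ}
    {c : ℂ} {Λ : ℝ → ℂ} (h : IsBoundaryPhase p k R u c Λ) :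
    ∫ θ in (-Real.pi)..Real.pi, ‖Λ θ‖ ^ 2
      ≤ (∫ θ in (-Real.pi)..Real.pi, (Λ θ).re ^ 2)
        + 15425 / 100000 * ∫ θ in (-Real.pi)..Real.pi, ‖deriv Λ θ‖ ^ 2 := by
  have hpi := Real.pi_pos
  have hΛc := h.smooth.continuous
  have hdc : Continuous (deriv Λ) := (contDiff_infty_iff_deriv.1 h.smooth).2.continuous
  have hχs : ContDiff ℝ ∞ fun θ => (Λ θ).im := Complex.imCLM.contDiff.comp h.smooth
  have hder : ∀ θ, deriv (fun θ => (Λ θ).im) θ = (deriv Λ θ).im := fun θ =>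
    (Complex.imCLM.hasFDerivAt.comp_hasDerivAt θ
      (h.smooth.differentiable (by simp) θ).hasDerivAt).deriv
  have h1 := integral_sq_le_of_odd_periodic hχs (fun θ => by rw [h.conj, Complex.conj_im])
    (n := p + 1) (by omega) (fun θ => by
      have := h.periodic θ
      push_cast
      simp only [this])
  simp only [hder] at h1
  have h2 : ∀ θ, ‖Λ θ‖ ^ 2 = (Λ θ).re ^ 2 + (Λ θ).im ^ 2 := by
    intro θ; rw [← Complex.normSq_eq_norm_sq, Complex.normSq_apply]; ring
  simp_rw [h2]
  rw [intervalIntegral.integral_add (by apply Continuous.intervalIntegrable; fun_prop)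
    (by apply Continuous.intervalIntegrable; fun_prop)]
  refine add_le_add le_rfl (h1.trans ?_)
  -- p ≥ 1 gives at least n = 2, and (π/2)²/16 is just below this constant.
  have h3 : (Real.pi / ((p + 1 : ℕ) : ℝ)) ^ 2 / 16 ≤ 15425 / 100000 := by
    have h4 : Real.pi / ((p + 1 : ℕ) : ℝ) ≤ 3.1416 / 2 := by
      have h5 : (2 : ℝ) ≤ ((p + 1 : ℕ) : ℝ) := by exact_mod_cast (by omega : 2 ≤ p + 1)
      have h6 := Real.pi_lt_d4
      gcongr
    have h7 : 0 ≤ Real.pi / ((p + 1 : ℕ) : ℝ) := by positivity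
    nlinarith
  have h8 : ∫ θ in (-Real.pi)..Real.pi, (deriv Λ θ).im ^ 2
      ≤ ∫ θ in (-Real.pi)..Real.pi, ‖deriv Λ θ‖ ^ 2 := by
    refine intervalIntegral.integral_mono_on (by linarith)
      (by apply Continuous.intervalIntegrable; fun_prop)
      (by apply Continuous.intervalIntegrable; fun_prop) fun θ _ => ?_
    rw [← Complex.normSq_eq_norm_sq, Complex.normSq_apply]
    nlinarith [sq_nonneg (deriv Λ θ).re]
  have h9 : 0 ≤ ∫ θ in (-Real.pi)..Real.pi, (deriv Λ θ).im ^ 2 :=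
    intervalIntegral.integral_nonneg (by linarith) fun _ _ => sq_nonneg _
  exact mul_le_mul h3 h8 h9 (by norm_num)

/-- The competitor: the model map, deformed near the circle of radius `R` to match the boundary
values. -/
def competitor (p : ℕ) (k : ℤ) (γ : ℝ → ℝ) (Λ : ℝ → ℂ) (c : ℂ) (R : ℝ) (z : ℂ) : ℂ :=
  c * (model p k R z * Complex.exp (angular γ Λ R z))

section

variable {p : ℕ} {k : ℤ} {R : ℝ} {u : ℂ → ℂ} {c : ℂ} {Λ : ℝ → ℂ} {γ : ℝ → ℝ}

theorem contDiff_competitor (hγ : IsTransition γ) (h : IsBoundaryPhase p k R u c Λ)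
    (hR : 3 ≤ R) : ContDiff ℝ ∞ (competitor p k γ Λ c R) :=
  contDiff_const.mul ((contDiff_model p k (by linarith)).mul
    (contDiff_angular hγ.smooth hγ.eq_zero h.smooth h.periodic_two_pi hR).cexp)

theorem competitor_eq_on_sphere (hγ : IsTransition γ) (h : IsBoundaryPhase p k R u c Λ)
    (hR : 3 ≤ R) {z : ℂ} (hz : ‖z‖ = R) : competitor p k γ Λ c R z = u z := by
  have hR0 : 0 < R := by linarith
  have e : z = R * Complex.exp (Complex.I * Complex.arg z) := by
    rw [mul_comm Complex.I, ← hz, Complex.norm_mul_exp_arg_mul_I]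
  rw [e]
  unfold competitor
  rw [h.eq, angular_circle h.periodic_two_pi R hR0, sub_self, hγ.at_zero, one_smul]

theorem isEquivariant_competitor {s : ℤˣ} (h : IsBoundaryPhase p k R u c Λ)
    (hc : c = ((s : ℤ) : ℂ) * starRingEnd ℂ c) :
    IsEquivariant (-(p : ℤ)) s (competitor p k γ Λ c R) := by
  have hcast : (Real.pi / (1 - ((-(p : ℤ) : ℤ) : ℂ)) : ℂ) = Real.pi / (p + 1) := by
    push_cast; ring
  refine ⟨fun z => ?_, fun z => ?_⟩
  · rw [hcast]
    unfold competitor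
    have h1 := angular_rotate (γ := γ) (R := R) h.periodic h.periodic_two_pi z
    push_cast at h1
    rw [model_rotate, h1]
    ring
  · unfold competitor
    rw [model_conj, angular_conj h.conj h.periodic_two_pi, Complex.exp_conj, map_mul, map_mul]
    nth_rewrite 1 [hc]
    ring

theorem exp_re_angular_le (hγ : IsTransition γ)
    (hΛ : ∀ θ, Real.exp (2 * (Λ θ).re) ≤ 1005 / 1000) (z : ℂ) :
    Real.exp (2 * (angular γ Λ R z).re) ≤ 1005 / 1000 := by
  unfold angular
  rw [Complex.smul_re, smul_eq_mul]
  set g := γ (Real.log ‖z‖ - Real.log R)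
  have hg0 : 0 ≤ g := hγ.nonneg _
  have hg1 : g ≤ 1 := hγ.le_one _
  set x := (Λ z.arg).re
  rcases le_total 0 x with h | h
  · refine le_trans (Real.exp_le_exp.2 ?_) (hΛ z.arg)
    nlinarith
  · have : Real.exp (2 * (g * x)) ≤ 1 := by
      rw [Real.exp_le_one_iff]
      nlinarith
    linarith

theorem norm_grad_competitor_sq_le (hγ : IsTransition γ) (h : IsBoundaryPhase p k R u c Λ)
    (hR : 3 ≤ R) (hΛ : ∀ θ, Real.exp (2 * (Λ θ).re) ≤ 1005 / 1000) (z : ℂ) :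
    ‖grad (competitor p k γ Λ c R) z‖ ^ 2 ≤ ‖grad (model p k R) z‖ ^ 2
      + 102 / 100 * ‖grad (angular γ Λ R) z‖ ^ 2
      + 102 * ((32 * p + 64 * (p + 1) * k.natAbs) / R) ^ 2 := by
  have hR0 : 0 < R := by linarith
  have dB : DifferentiableAt ℝ (model p k R) z :=
    (contDiff_model p k hR0).differentiable (by simp) z
  have dM : DifferentiableAt ℝ (angular γ Λ R) z :=
    (contDiff_angular hγ.smooth hγ.eq_zero h.smooth h.periodic_two_pi hR).differentiable
      (by simp) z
  have hle : ‖grad (competitor p k γ Λ c R) z‖ ≤ Real.exp (angular γ Λ R z).re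
      * (‖grad (model p k R) z‖ + ‖grad (angular γ Λ R) z‖) := by
    have e : competitor p k γ Λ c R
        = fun z => c * (fun z => model p k R z * (fun z => Complex.exp (angular γ Λ R z)) z) z := rfl
    rw [e, grad_const_mul (dB.fun_mul dM.cexp), grad_mul dB dM.cexp, grad_cexp dM, norm_smul,
      h.norm_c, one_mul]
    refine (norm_add_le _ _).trans ?_
    rw [norm_smul, norm_smul, norm_smul, Complex.norm_exp]
    have hb := norm_model_le_one p k hR0 z
    have h1 : ‖model p k R z‖ * (Real.exp (angular γ Λ R z).re * ‖grad (angular γ Λ R) z‖)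
        ≤ 1 * (Real.exp (angular γ Λ R z).re * ‖grad (angular γ Λ R) z‖) := by gcongr
    linarith
  have hexp : Real.exp (angular γ Λ R z).re ^ 2 = Real.exp (2 * (angular γ Λ R z).re) := by
    rw [← Real.exp_nat_mul]; norm_num
  have hsq : ‖grad (competitor p k γ Λ c R) z‖ ^ 2 ≤ Real.exp (2 * (angular γ Λ R z).re)
      * (‖grad (model p k R) z‖ + ‖grad (angular γ Λ R) z‖) ^ 2 := by
    rw [← hexp, ← mul_pow]
    gcongr
  -- Below the layer the competitor is a unit multiple of the model, so the coefficient 1 of the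
  -- model's gradient is exact there and the leading log R term is not inflated. In the layer the
  -- model's gradient is O(1/R) and can afford the factor 102.
  rcases lt_or_ge ‖z‖ (R * Real.exp (-(7 / 10))) with hz | hz
  · rw [angular_eq_zero hγ.eq_zero hR hz.le, grad_angular_eq_zero hγ.eq_zero hR hz] at hsq
    rw [grad_angular_eq_zero hγ.eq_zero hR hz]
    simp only [Complex.zero_re, mul_zero, Real.exp_zero, one_mul, add_zero] at hsq
    have : 0 ≤ 102 * ((32 * (p : ℝ) + 64 * (p + 1) * k.natAbs) / R) ^ 2 := by positivity
    linarith
  · have h3 : (1 : ℝ) / 3 ≤ Real.exp (-(7 / 10)) := by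
      have h4 : Real.exp (7 / 10) ≤ 3 := by
        have h5 : Real.exp (7 / 10) ≤ Real.exp 1 := Real.exp_le_exp.2 (by norm_num)
        linarith [Real.exp_one_lt_d9]
      rw [Real.exp_neg, one_div]
      exact inv_anti₀ (Real.exp_pos _) h4
    have hz3 : R / 3 ≤ ‖z‖ := by nlinarith
    have hG := norm_grad_model_le_outer p k hR0 hz3
    set G := (32 * (p : ℝ) + 64 * (p + 1) * k.natAbs) / R
    set x := ‖grad (model p k R) z‖
    set y := ‖grad (angular γ Λ R) z‖
    have hx0 : 0 ≤ x := norm_nonneg _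
    have hE := exp_re_angular_le (R := R) hγ hΛ z
    have h5 : (x + y) ^ 2 ≤ 101 / 100 * y ^ 2 + 101 * x ^ 2 := by
      nlinarith [sq_nonneg (y - 100 * x)]
    have h6 : x ^ 2 ≤ G ^ 2 := by gcongr
    calc _ ≤ 1005 / 1000 * (101 / 100 * y ^ 2 + 101 * x ^ 2) :=
          hsq.trans (mul_le_mul hE h5 (sq_nonneg _) (by norm_num))
      _ ≤ _ := by nlinarith [sq_nonneg x, sq_nonneg y]

/-- The large factor falls on W(model), whose integral is bounded in R. The boundary term keeps a
constant close to 1/4. -/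
theorem W_competitor_le (h : IsBoundaryPhase p k R u c Λ) (hR : 0 < R) (z : ℂ) :
    W (competitor p k γ Λ c R z) ≤ 101 * W (model p k R z)
      + 101 / 400 * (1 - Real.exp (2 * (angular γ Λ R z).re)) ^ 2 := by
  have hn : ‖competitor p k γ Λ c R z‖ ^ 2
      = ‖model p k R z‖ ^ 2 * Real.exp (2 * (angular γ Λ R z).re) := by
    unfold competitor
    rw [norm_mul, norm_mul, h.norm_c, one_mul, Complex.norm_exp, mul_pow, ← Real.exp_nat_mul]
    norm_num
  have hb : ‖model p k R z‖ ^ 2 ≤ 1 := pow_le_one₀ (norm_nonneg _) (norm_model_le_one p k hR z)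
  have hb0 : 0 ≤ ‖model p k R z‖ ^ 2 := by positivity
  unfold W
  rw [hn]
  set b := ‖model p k R z‖ ^ 2
  set y := Real.exp (2 * (angular γ Λ R z).re)
  have e : 1 - b * y = (1 - b) + b * (1 - y) := by ring
  have h1 : (1 - b * y) ^ 2 ≤ 101 * (1 - b) ^ 2 + 101 / 100 * (b * (1 - y)) ^ 2 := by
    rw [e]; nlinarith [sq_nonneg (100 * (1 - b) - b * (1 - y))]
  have h2 : (b * (1 - y)) ^ 2 ≤ (1 - y) ^ 2 := by
    rw [mul_pow]
    have : b ^ 2 ≤ 1 := pow_le_one₀ hb0 hb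
    nlinarith [sq_nonneg (1 - y)]
  linarith

end

theorem setIntegral_ball_linear_le {f₁ f₂ f₃ f₄ : ℂ → ℝ} (h₁ : Continuous f₁) (h₂ : Continuous f₂)
    (h₃ : Continuous f₃) (h₄ : Continuous f₄) {a b₁ b₂ b₃ e R : ℝ} (ha : 0 ≤ a) (hR : 0 ≤ R) :
    ∫ z in Metric.ball (0 : ℂ) R, (a * (f₁ z + b₁ * f₂ z + e) + (b₂ * f₃ z + b₃ * f₄ z))
      ≤ a * ((∫ z in Metric.ball (0 : ℂ) R, f₁ z) + b₁ * (∫ z in Metric.ball (0 : ℂ) R, f₂ z)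
          + e * (Real.pi * R ^ 2))
        + (b₂ * (∫ z in Metric.ball (0 : ℂ) R, f₃ z)
          + b₃ * ∫ z in Metric.ball (0 : ℂ) R, f₄ z) := by
  have he := setIntegral_ball_le_const (f := fun _ : ℂ => e) continuous_const hR
    (fun z _ => le_rfl)
  rw [integral_add (integrableOn_ball (by fun_prop) R) (integrableOn_ball (by fun_prop) R),
    integral_const_mul,
    integral_add (integrableOn_ball (by fun_prop) R) (integrableOn_ball (by fun_prop) R),
    integral_add (integrableOn_ball (by fun_prop) R) (integrableOn_ball (by fun_prop) R),
    integral_add (integrableOn_ball (by fun_prop) R) (integrableOn_ball (by fun_prop) R),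
    integral_const_mul b₁, integral_const_mul b₂, integral_const_mul b₃]
  gcongr

/-- The arithmetic that combines the bounds on the parts of the energy of the competitor. -/
theorem competitor_energy_arithmetic {δ R E EB EM WB X A V L CB CW C₁ C₂ g : ℝ} (hδ0 : 0 ≤ δ)
    (hδ1 : δ < 1) (hq : 1 + 3 * δ ≤ 17321 / 10000 * (1 - δ)) (hR : 10 ≤ R) (hA : 0 ≤ A)
    (hV : 0 ≤ V) (hE : E ≤ (1 + 3 * δ) / 2 * (EB + 102 / 100 * EM + g) + (101 * WB + 101 / 400 * X))
    (hEB : EB ≤ 2 * L + CB) (hWB : WB ≤ CW)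
    (hEM : EM ≤ 50025 / 100000 * (10125 / 10000 * A + C₁) + 63 / 40 * (102 / 25 * V + C₂))
    (hX : X ≤ 51 / 25 * (R ^ 2 * V) + C₂ / 2) :
    E ≤ 9 / 10 * ((1 - δ) / 2 * A + R ^ 2 * V) + (1 + 3 * δ) * L
      + ((1 + 3 * δ) / 2 * (CB + 102 / 100 * (50025 / 100000 * C₁ + 63 / 40 * C₂) + g)
        + 101 * CW + 101 / 800 * C₂) := by
  -- The Dirichlet energy of the layer produces a multiple of V without R². For R ≥ 10 it fits into
  -- the slack of the R²V term.
  have hRV : 100 * V ≤ R ^ 2 * V := mul_le_mul_of_nonneg_right (by nlinarith) hV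
  have t1 := mul_le_mul_of_nonneg_left hEB (by linarith : 0 ≤ (1 + 3 * δ) / 2)
  have t2 := mul_le_mul_of_nonneg_left hEM (by linarith : 0 ≤ (1 + 3 * δ) / 2)
  -- The coefficient of (1-δ)/2·A is at most 1.02·0.50025·1.0125·1.7321 < 0.9. This is where the
  -- restriction by 2/√3 - 1 is needed.
  have t3 := mul_le_mul_of_nonneg_right hq hA
  have t4 : (1 + 3 * δ) / 2 * V ≤ 2 * V := mul_le_mul_of_nonneg_right (by linarith) hV
  have t5 : 0 ≤ (1 - δ) * A := mul_nonneg (by linarith) hA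
  linarith

/-- Comparison of the energy in a disk with the energy on its boundary circle: the upper bound. -/
theorem exists_diskEnergy_competitor_le {p : ℕ} (hp : 1 ≤ p) (k : ℤ) {δ : ℝ} (hδ0 : 0 ≤ δ)
    (hδ1 : δ < 1) (hq : 1 + 3 * δ ≤ 17321 / 10000 * (1 - δ)) {η : ℝ} (hη : 0 < η)
    {u : ℂ → ℂ} (hu : ContDiff ℝ ∞ u) {γ : ℝ → ℝ} (hγ : IsTransition γ) :
    ∃ C R₁ : ℝ, 3 ≤ R₁ ∧ ∀ R, R₁ ≤ R → ∀ c Λ, IsBoundaryPhase p k R u c Λ →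
      (∀ θ : ℝ, 999 / 1000 ≤ ‖u (R * Complex.exp (Complex.I * θ))‖ ∧
        ‖u (R * Complex.exp (Complex.I * θ))‖ ≤ 1001 / 1000) →
      diskEnergy δ (competitor p k γ Λ c R) R
        ≤ 9 / 10 * ((1 - δ) / 2 * (∫ θ in (-Real.pi)..Real.pi, ‖tang u R θ‖ ^ 2)
          + R ^ 2 * ∫ θ in (-Real.pi)..Real.pi, W (u (R * Complex.exp (Complex.I * θ))))
        + (1 + 3 * δ) * Real.pi * ((p : ℝ) ^ 2 + 2 * (p + 1) * (k.natAbs : ℝ) ^ 2 + η)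
          * Real.log R + C := by
  obtain ⟨CB, hCB⟩ := exists_integral_norm_grad_model_le p k hη
  obtain ⟨CW, hCW⟩ := exists_integral_W_model_le p k
  set G : ℝ := 32 * p + 64 * (p + 1) * k.natAbs with hG
  set K : ℝ := 36 * ((p : ℝ) + k.natAbs) with hK
  have hK0 : 0 ≤ K := by positivity
  have hpi := Real.pi_pos
  set C₁ : ℝ := 2 * Real.pi * (102 * G ^ 2) with hC₁
  set C₂ : ℝ := 2 * Real.pi * (103 * K ^ 2) with hC₂
  refine ⟨(1 + 3 * δ) / 2 * (CB + 102 / 100 * (50025 / 100000 * C₁ + 63 / 40 * C₂)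
      + 102 * G ^ 2 * Real.pi) + 101 * CW + 101 / 800 * C₂,
    max 10 (1000 * K), le_trans (by norm_num) (le_max_left _ _), ?_⟩
  intro R hRR c Λ h hunit
  have hR10 : 10 ≤ R := (le_max_left _ _).trans hRR
  have hRK' : 1000 * K ≤ R := (le_max_right _ _).trans hRR
  have hR3 : 3 ≤ R := by linarith
  have hR1 : 1 ≤ R := by linarith
  have hR0 : 0 < R := by linarith
  have hRK : 1000 * (36 * ((p : ℝ) + k.natAbs)) ≤ R ^ 2 := by rw [← hK]; nlinarith
  have hΛb := fun θ => h.exp_bounds hR1 hRK (hunit θ).1 (hunit θ).2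
  have hΛc := h.smooth.continuous
  have hdc : Continuous (deriv Λ) := (contDiff_infty_iff_deriv.1 h.smooth).2.continuous
  have htc : Continuous fun θ : ℝ => tang u R θ :=
    (continuous_tang hu).comp (by fun_prop : Continuous fun θ : ℝ => (R, θ))
  have hWc : Continuous fun θ : ℝ => W (u (R * Complex.exp (Complex.I * θ))) :=
    continuous_W.comp (hu.continuous.comp (by fun_prop))
  have hs := contDiff_competitor hγ h hR3
  have hMs := contDiff_angular hγ.smooth hγ.eq_zero h.smooth h.periodic_two_pi hR3
  have cB : Continuous fun z => ‖grad (model p k R) z‖ :=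
    continuous_norm_grad (contDiff_model p k hR0)
  have cM : Continuous fun z => ‖grad (angular γ Λ R) z‖ := continuous_norm_grad hMs
  have cW : Continuous fun z => W (model p k R z) :=
    continuous_W.comp (contDiff_model p k hR0).continuous
  have cE : Continuous fun z => (1 - Real.exp (2 * (angular γ Λ R z).re)) ^ 2 :=
    (continuous_const.sub (Real.continuous_exp.comp
      (continuous_const.mul (Complex.continuous_re.comp hMs.continuous)))).pow 2
  set A := ∫ θ in (-Real.pi)..Real.pi, ‖tang u R θ‖ ^ 2 with hA
  set V := ∫ θ in (-Real.pi)..Real.pi, W (u (R * Complex.exp (Complex.I * θ))) with hV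
  set P' := ∫ θ in (-Real.pi)..Real.pi, ‖deriv Λ θ‖ ^ 2 with hP'
  set S := ∫ θ in (-Real.pi)..Real.pi, (1 - Real.exp (2 * (Λ θ).re)) ^ 2 with hS
  set EB := ∫ z in Metric.ball (0 : ℂ) R, ‖grad (model p k R) z‖ ^ 2 with hEB
  set EM := ∫ z in Metric.ball (0 : ℂ) R, ‖grad (angular γ Λ R) z‖ ^ 2 with hEM
  set WB := ∫ z in Metric.ball (0 : ℂ) R, W (model p k R z) with hWB
  set X := ∫ z in Metric.ball (0 : ℂ) R, (1 - Real.exp (2 * (angular γ Λ R z).re)) ^ 2 with hX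
  have hA0 : 0 ≤ A := intervalIntegral.integral_nonneg (by linarith) fun _ _ => sq_nonneg _
  have hP'0 : 0 ≤ P' := intervalIntegral.integral_nonneg (by linarith) fun _ _ => sq_nonneg _
  have hV0 : 0 ≤ V := intervalIntegral.integral_nonneg (by linarith) fun _ _ => W_nonneg _
  have hlen : (Real.pi - -Real.pi) = 2 * Real.pi := by ring
  have bP' : P' ≤ 10125 / 10000 * A + C₁ := by
    calc P' ≤ ∫ θ in (-Real.pi)..Real.pi, (10125 / 10000 * ‖tang u R θ‖ ^ 2 + 102 * G ^ 2) := by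
          refine intervalIntegral.integral_mono_on (by linarith)
            (by apply Continuous.intervalIntegrable; fun_prop)
            (by apply Continuous.intervalIntegrable; fun_prop) fun θ _ => ?_
          exact h.norm_deriv_sq_le hu hR1 hRK (hunit θ).1
      _ = _ := by
          rw [intervalIntegral.integral_add (by apply Continuous.intervalIntegrable; fun_prop)
            (by simp), intervalIntegral.integral_const_mul, intervalIntegral.integral_const,
            smul_eq_mul, hlen]
  have bS : S ≤ 102 / 25 * V + C₂ / R ^ 2 := by
    have h1 : S ≤ 102 / 25 * V + 2 * Real.pi * (103 * (K / R ^ 2) ^ 2) := by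
      calc S ≤ ∫ θ in (-Real.pi)..Real.pi,
            (102 / 25 * W (u (R * Complex.exp (Complex.I * θ))) + 103 * (K / R ^ 2) ^ 2) := by
            refine intervalIntegral.integral_mono_on (by linarith)
              (by apply Continuous.intervalIntegrable; fun_prop)
              (by apply Continuous.intervalIntegrable; fun_prop) fun θ _ => ?_
            exact h.one_sub_exp_sq_le hR1 hRK θ
        _ = _ := by
            rw [intervalIntegral.integral_add (by apply Continuous.intervalIntegrable; fun_prop)
              (by simp), intervalIntegral.integral_const_mul, intervalIntegral.integral_const,
              smul_eq_mul, hlen]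
    have h2 : (K / R ^ 2) ^ 2 ≤ K ^ 2 / R ^ 2 := by
      rw [div_pow]
      gcongr
      nlinarith
    have h3 : C₂ / R ^ 2 = 2 * Real.pi * (103 * (K ^ 2 / R ^ 2)) := by rw [hC₂]; ring
    rw [h3]
    refine h1.trans ?_
    gcongr
  have bQ : ∫ θ in (-Real.pi)..Real.pi, (Λ θ).re ^ 2 ≤ S := by
    refine intervalIntegral.integral_mono_on (by linarith)
      (by apply Continuous.intervalIntegrable; fun_prop)
      (by apply Continuous.intervalIntegrable; fun_prop) fun θ _ => ?_
    exact sq_le_one_sub_exp_sq (hΛb θ).1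
  have bP := h.integral_norm_sq_le hp
  have bEM := integral_norm_grad_angular_sq_le hγ h.smooth h.periodic_two_pi hR3
  have bX := integral_one_sub_exp_angular_le hγ h.smooth h.periodic_two_pi hR3
  have bEB := hCB R hR1
  have bWB : WB ≤ CW := hCW R hR1
  have hE : diskEnergy δ (competitor p k γ Λ c R) R
      ≤ (1 + 3 * δ) / 2 * (EB + 102 / 100 * EM + 102 * G ^ 2 * Real.pi)
        + (101 * WB + 101 / 400 * X) := by
    have h1 : diskEnergy δ (competitor p k γ Λ c R) R ≤ ∫ z in Metric.ball (0 : ℂ) R,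
        ((1 + 3 * δ) / 2 * (‖grad (model p k R) z‖ ^ 2 + 102 / 100 * ‖grad (angular γ Λ R) z‖ ^ 2
          + 102 * (G / R) ^ 2) + (101 * W (model p k R z)
          + 101 / 400 * (1 - Real.exp (2 * (angular γ Λ R z).re)) ^ 2)) := by
      refine setIntegral_mono_on (integrableOn_ball (continuous_density δ hs) R)
        (integrableOn_ball (by fun_prop) R) Metric.isOpen_ball.measurableSet fun z _ => ?_
      refine (density_le hδ0 _ z).trans (add_le_add ?_ (W_competitor_le h hR0 z))
      refine mul_le_mul_of_nonneg_left ?_ (by linarith)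
      exact norm_grad_competitor_sq_le hγ h hR3 (fun θ => (hΛb θ).2) z
    have h2 := setIntegral_ball_linear_le (a := (1 + 3 * δ) / 2) (b₁ := 102 / 100) (b₂ := 101)
      (b₃ := 101 / 400) (e := 102 * (G / R) ^ 2) (cB.pow 2) (cM.pow 2) cW cE
      (by linarith) hR0.le
    have h3 : 102 * (G / R) ^ 2 * (Real.pi * R ^ 2) = 102 * G ^ 2 * Real.pi := by field_simp
    rw [h3] at h2
    exact h1.trans h2
  have bS' : S ≤ 102 / 25 * V + C₂ := by
    have : C₂ / R ^ 2 ≤ C₂ := by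
      apply div_le_self (by positivity)
      nlinarith
    linarith
  have bEM' : EM ≤ 50025 / 100000 * (10125 / 10000 * A + C₁) + 63 / 40 * (102 / 25 * V + C₂) := by
    have h1 : EM ≤ 63 / 40 * (S + 15425 / 100000 * P') + 1029 / 4000 * P' := by linarith
    linarith
  have bX' : X ≤ 51 / 25 * (R ^ 2 * V) + C₂ / 2 := by
    have h1 : R ^ 2 / 2 * S ≤ R ^ 2 / 2 * (102 / 25 * V + C₂ / R ^ 2) := by gcongr
    have h2 : R ^ 2 / 2 * (102 / 25 * V + C₂ / R ^ 2) = 51 / 25 * (R ^ 2 * V) + C₂ / 2 := by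
      field_simp
      ring
    linarith
  clear_value A V P' S EB EM WB X C₁ C₂ G K
  have hEB' : EB ≤ 2 * (Real.pi * ((p : ℝ) ^ 2 + 2 * (p + 1) * (k.natAbs : ℝ) ^ 2 + η)
      * Real.log R) + CB := by linarith
  refine (competitor_energy_arithmetic hδ0 hδ1 hq hR10 hA0 hV0 hE hEB' bWB bEM' bX').trans_eq ?_
  ring

/-! ### Differential inequalities for the energy in t = log R. -/

theorem hasDerivAt_diskEnergy_exp {δ : ℝ} {u : ℂ → ℂ} (hu : ContDiff ℝ ∞ u) (t : ℝ) :
    HasDerivAt (fun t => diskEnergy δ u (Real.exp t))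
      (Real.exp t ^ 2 * ∫ θ in (-Real.pi)..Real.pi,
        density δ u ((Real.exp t : ℝ) * Complex.exp (Complex.I * θ))) t := by
  have hc := continuous_density δ hu
  have hcr : Continuous fun r : ℝ => r * ∫ θ in (-Real.pi)..Real.pi,
      density δ u (r * Complex.exp (Complex.I * θ)) :=
    continuous_id.mul (continuous_circle_integral hc)
  have h1 := (hcr.integral_hasStrictDerivAt 0 (Real.exp t)).hasDerivAt.comp t (Real.hasDerivAt_exp t)
  have h2 : (fun t => diskEnergy δ u (Real.exp t)) = (fun R : ℝ => ∫ r in (0 : ℝ)..R,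
      r * ∫ θ in (-Real.pi)..Real.pi, density δ u (r * Complex.exp (Complex.I * θ))) ∘ Real.exp := by
    ext t
    exact integral_ball_eq_polar hc (Real.exp_pos t).le
  rw [h2]
  exact h1.congr_deriv (by ring)

theorem circle_energy_ge {δ : ℝ} (hδ0 : 0 ≤ δ) (hδ1 : δ ≤ 1) {u : ℂ → ℂ} (hu : ContDiff ℝ ∞ u)
    {R : ℝ} (hR : 0 ≤ R) :
    (1 - δ) / 2 * (∫ θ in (-Real.pi)..Real.pi, ‖tang u R θ‖ ^ 2)
        + R ^ 2 * ∫ θ in (-Real.pi)..Real.pi, W (u (R * Complex.exp (Complex.I * θ)))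
      ≤ R ^ 2 * ∫ θ in (-Real.pi)..Real.pi, density δ u (R * Complex.exp (Complex.I * θ)) := by
  have htc : Continuous fun θ : ℝ => tang u R θ :=
    (continuous_tang hu).comp (by fun_prop : Continuous fun θ : ℝ => (R, θ))
  have hWc : Continuous fun θ : ℝ => W (u (R * Complex.exp (Complex.I * θ))) :=
    continuous_W.comp (hu.continuous.comp (by fun_prop))
  have hdc : Continuous fun θ : ℝ => density δ u (R * Complex.exp (Complex.I * θ)) :=
    (continuous_density δ hu).comp (by fun_prop)
  rw [← intervalIntegral.integral_const_mul, ← intervalIntegral.integral_const_mul,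
    ← intervalIntegral.integral_const_mul, ← intervalIntegral.integral_add
      (by apply Continuous.intervalIntegrable; fun_prop)
      (by apply Continuous.intervalIntegrable; fun_prop)]
  refine intervalIntegral.integral_mono_on (by linarith [Real.pi_pos])
    (by apply Continuous.intervalIntegrable; fun_prop)
    (by apply Continuous.intervalIntegrable; fun_prop) fun θ _ => ?_
  have h1 := mul_le_mul_of_nonneg_left
    (le_density hδ0 u (R * Complex.exp (Complex.I * θ))) (sq_nonneg R)
  have h2 := mul_le_mul_of_nonneg_left (norm_tang_sq_le u hR θ)
    (by linarith : 0 ≤ (1 - δ) / 2)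
  linarith

/-- A function of at most exponential growth that satisfies `F ≤ c F' + C₁ t + C₂` with `c < 1`
grows at most linearly, with slope `C₁`. -/
theorem le_linear_of_le_mul_deriv {F F' : ℝ → ℝ} (hF : ∀ t, HasDerivAt F (F' t) t)
    {c C C₁ C₂ t₁ : ℝ} (hc : 0 < c) (hc1 : c < 1)
    (h : ∀ t, t₁ ≤ t → F t ≤ c * F' t + C₁ * t + C₂) (hg : ∀ t, t₁ ≤ t → F t ≤ C * Real.exp t)
    {t : ℝ} (ht : t₁ ≤ t) : F t ≤ C₁ * t + C₂ + c * C₁ := by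
  -- Integrating factor e^{-t/c}: the hypothesis says that H is nondecreasing. Since 1/c > 1, the
  -- growth bound C e^t forces the limit of an upper bound for H to be 0, so H ≤ 0.
  set H : ℝ → ℝ := fun t => (F t - C₁ * t - C₂ - c * C₁) * Real.exp (-(c⁻¹ * t)) with hH
  have hd : ∀ t, HasDerivAt H ((F' t - C₁) * Real.exp (-(c⁻¹ * t))
      + (F t - C₁ * t - C₂ - c * C₁) * (Real.exp (-(c⁻¹ * t)) * (-c⁻¹))) t := by
    intro t
    have h1 : HasDerivAt (fun t => F t - C₁ * t - C₂ - c * C₁) (F' t - C₁) t := by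
      simpa using (((hF t).sub ((hasDerivAt_id t).const_mul C₁)).sub_const C₂).sub_const (c * C₁)
    have h2 : HasDerivAt (fun t : ℝ => -(c⁻¹ * t)) (-c⁻¹) t := by
      simpa using ((hasDerivAt_id t).const_mul c⁻¹).fun_neg
    exact h1.mul h2.exp
  have hmono : MonotoneOn H (Set.Ici t₁) := by
    refine monotoneOn_of_deriv_nonneg (convex_Ici t₁)
      (fun t _ => (hd t).continuousAt.continuousWithinAt)
      (fun t _ => (hd t).differentiableAt.differentiableWithinAt) fun t ht' => ?_
    rw [interior_Ici] at ht'
    rw [(hd t).deriv]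
    have h1 := h t (le_of_lt ht')
    have h2 : (F t - C₁ * t - C₂ - c * C₁) * c⁻¹ ≤ F' t - C₁ := by
      rw [← div_eq_mul_inv, div_le_iff₀ hc]
      linarith
    have h3 := mul_le_mul_of_nonneg_right h2 (Real.exp_pos (-(c⁻¹ * t))).le
    linarith
  have hci : 0 < c⁻¹ - 1 := sub_pos.2 ((one_lt_inv₀ hc).2 hc1)
  have hlim : Tendsto (fun τ : ℝ => C * Real.exp (-((c⁻¹ - 1) * τ))
      - C₁ * (τ ^ (1 : ℕ) * Real.exp (-(c⁻¹ * τ))) - (C₂ + c * C₁) * Real.exp (-(c⁻¹ * τ)))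
      atTop (𝓝 (C * 0 - C₁ * 0 - (C₂ + c * C₁) * 0)) := by
    have e : ∀ a : ℝ, 0 < a → Tendsto (fun τ : ℝ => Real.exp (-(a * τ))) atTop (𝓝 0) :=
      fun a ha => Real.tendsto_exp_neg_atTop_nhds_zero.comp (tendsto_id.const_mul_atTop ha)
    have e2 : Tendsto (fun τ : ℝ => τ ^ (1 : ℕ) * Real.exp (-(c⁻¹ * τ))) atTop (𝓝 0) := by
      have h0 := ((Real.tendsto_pow_mul_exp_neg_atTop_nhds_zero 1).comp
        (tendsto_id.const_mul_atTop (inv_pos.2 hc))).const_mul c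
      rw [mul_zero] at h0
      refine h0.congr fun τ => ?_
      simp only [Function.comp_apply, id, pow_one]
      rw [← mul_assoc, ← mul_assoc, mul_inv_cancel₀ hc.ne', one_mul]
    exact (((e _ hci).const_mul C).sub (e2.const_mul C₁)).sub
      ((e _ (inv_pos.2 hc)).const_mul _)
  have hle : H t ≤ C * 0 - C₁ * 0 - (C₂ + c * C₁) * 0 := by
    refine ge_of_tendsto hlim ((eventually_ge_atTop t).mono fun τ hτ => ?_)
    refine (hmono ht (ht.trans hτ : t₁ ≤ τ) hτ).trans ?_
    have h1 := mul_le_mul_of_nonneg_right (hg τ (ht.trans hτ)) (Real.exp_pos (-(c⁻¹ * τ))).le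
    have h2 : C * Real.exp (-((c⁻¹ - 1) * τ)) = C * Real.exp τ * Real.exp (-(c⁻¹ * τ)) := by
      rw [mul_assoc, ← Real.exp_add]
      ring_nf
    rw [h2]
    simp only [hH, pow_one]
    linarith
  have := Real.exp_pos (-(c⁻¹ * t))
  by_contra! hcon
  have : 0 < H t := mul_pos (by linarith) this
  linarith

theorem le_of_le_deriv {F F' : ℝ → ℝ} (hF : ∀ t, HasDerivAt F (F' t) t) {c t₁ : ℝ}
    (h : ∀ t, t₁ ≤ t → c ≤ F' t) {t : ℝ} (ht : t₁ ≤ t) : F t₁ + c * (t - t₁) ≤ F t := by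
  have hd : ∀ t, HasDerivAt (fun t => F t - c * t) (F' t - c) t := fun t => by
    simpa using (hF t).fun_sub ((hasDerivAt_id t).const_mul c)
  have hmono : MonotoneOn (fun t => F t - c * t) (Set.Ici t₁) := by
    refine monotoneOn_of_deriv_nonneg (convex_Ici t₁)
      (fun t _ => (hd t).continuousAt.continuousWithinAt)
      (fun t _ => (hd t).differentiableAt.differentiableWithinAt) fun t ht' => ?_
    rw [interior_Ici] at ht'
    rw [(hd t).deriv]
    linarith [h t (le_of_lt ht')]
  have := hmono (le_refl t₁ : t₁ ∈ Set.Ici t₁) ht ht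
  simp only at this
  linarith

/-! ### The two bounds on δ and the contradiction. -/

/-- At δ = 2/√3 - 1 the ratio (1+3δ)/(1-δ) equals √3, rounded up here to 1.7321. -/
theorem anisotropy_le {δ : ℝ} (h : δ < 2 / Real.sqrt 3 - 1) :
    1 + 3 * δ ≤ 17321 / 10000 * (1 - δ) := by
  have h1 : 173205 / 100000 ≤ Real.sqrt 3 := Real.le_sqrt_of_sq_le (by norm_num)
  have h2 : 2 / Real.sqrt 3 ≤ 2 / (173205 / 100000) := by gcongr
  norm_num at h2
  linarith

/-- Splitting off vortices of degree `k ≠ 0` costs less than what the circles at infinity pay. -/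
theorem vortex_cost_lt {p : ℕ} {k : ℤ} (hk : k ≠ 0) (hp : 1 ≤ p) {δ : ℝ} (hδ1 : δ < 1)
    (h : δ < (2 + 2 * (p : ℝ)) / (4 * (p : ℝ) ^ 2 + 10 + 10 * p)) :
    (1 + 3 * δ) * ((p : ℝ) ^ 2 + 2 * (p + 1) * (k : ℝ) ^ 2)
      < (1 - δ) * (-p + 2 * (p + 1) * (k : ℝ)) ^ 2 := by
  have hp0 : (1 : ℝ) ≤ p := by exact_mod_cast hp
  set n : ℝ := p + 1 with hn
  have hpn : (p : ℝ) = n - 1 := by rw [hn]; ring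
  have hn2 : 2 ≤ n := by linarith
  rw [lt_div_iff₀ (by positivity)] at h
  -- This is the case k = 1, where the vortex cost is n² + 1 and the degree n + 1. It is equivalent
  -- to the bound on δ.
  have h1 : (1 + 3 * δ) * (n ^ 2 + 1) < (1 - δ) * (n + 1) ^ 2 := by
    rw [hpn] at h
    nlinarith
  rw [hpn]
  have hkk : 0 ≤ ((k : ℝ) - 1) * ((2 * n ^ 2 + n + 1) * k + (n - 1)) := by
    rcases lt_or_gt_of_ne hk with hk | hk
    · have : (k : ℝ) ≤ -1 := by exact_mod_cast Int.le_sub_one_of_lt hk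
      refine mul_nonneg_of_nonpos_of_nonpos (by linarith) ?_
      nlinarith [mul_le_mul_of_nonneg_left this (by positivity : 0 ≤ 2 * n ^ 2 + n + 1)]
    · have : (1 : ℝ) ≤ k := by exact_mod_cast hk
      refine mul_nonneg (by linarith) ?_
      have : 0 ≤ (2 * n ^ 2 + n + 1) * (k : ℝ) := by positivity
      linarith
  -- Among nonzero k the ratio of degree squared to vortex cost is smallest at k = 1. The difference
  -- of the two sides factors as 2n(n-1)(k-1)((2n²+n+1)k + n - 1).
  have h2 : (n + 1) ^ 2 * ((n - 1) ^ 2 + 2 * n * (k : ℝ) ^ 2)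
      ≤ (n ^ 2 + 1) * (-(n - 1) + 2 * n * k) ^ 2 := by
    have : 0 ≤ 2 * n * (n - 1) * (((k : ℝ) - 1) * ((2 * n ^ 2 + n + 1) * k + (n - 1))) :=
      mul_nonneg (by nlinarith) hkk
    linarith
  have hY : 0 < (n - 1) ^ 2 + 2 * n * (k : ℝ) ^ 2 := by
    have : 0 < (n - 1) ^ 2 := by
      have : 0 < n - 1 := by linarith
      positivity
    positivity
  have h3 := mul_lt_mul_of_pos_right h1 hY
  have h4 := mul_le_mul_of_nonneg_left h2 (by linarith : 0 ≤ 1 - δ)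
  have h5 : 0 < n ^ 2 + 1 := by positivity
  refine lt_of_mul_lt_mul_left ?_ h5.le
  linarith

/-- Room for an error in a strict inequality. -/
theorem exists_margin {a b Y D : ℝ} (h : a * Y < b * D) :
    ∃ η m : ℝ, 0 < η ∧ 0 < m ∧ m < 1 ∧ a * (Y + η) < b * (m ^ 2 * D) := by
  have h1 : ∀ᶠ x : ℝ in 𝓝 0, a * (Y + x) < b * ((1 - x) ^ 2 * D) := by
    have hl : ContinuousAt (fun x : ℝ => a * (Y + x)) 0 := by fun_prop
    have hr : ContinuousAt (fun x : ℝ => b * ((1 - x) ^ 2 * D)) 0 := by fun_prop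
    exact hl.eventually_lt hr (by simpa using h)
  have h2 : ∀ᶠ x : ℝ in 𝓝[>] 0, a * (Y + x) < b * ((1 - x) ^ 2 * D) ∧ 0 < x ∧ x < 1 :=
    (h1.filter_mono nhdsWithin_le_nhds).and
      ((eventually_mem_nhdsWithin.mono fun _ hx => hx).and
        ((eventually_lt_nhds zero_lt_one).filter_mono nhdsWithin_le_nhds))
  obtain ⟨x, hx, hx0, hx1⟩ := h2.exists
  exact ⟨x, 1 - x, hx0, by linarith, by linarith, hx⟩

theorem exists_norm_mem_of_tendsto {u : ℂ → ℂ} (h : Tendsto (fun z => ‖u z‖) (cocompact ℂ) (𝓝 1))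
    {a b : ℝ} (ha : a < 1) (hb : 1 < b) :
    ∃ r₀ : ℝ, 0 ≤ r₀ ∧ ∀ z, r₀ ≤ ‖z‖ → a ≤ ‖u z‖ ∧ ‖u z‖ ≤ b := by
  have h1 : ∀ᶠ z in cocompact ℂ, ‖u z‖ ∈ Set.Icc a b := h (Icc_mem_nhds ha hb)
  rw [← Metric.cobounded_eq_cocompact, ← comap_norm_atTop, eventually_comap] at h1
  obtain ⟨r₀, hr₀⟩ := eventually_atTop.1 h1
  exact ⟨max r₀ 0, le_max_right _ _, fun z hz => hr₀ _ ((le_max_left _ _).trans hz) z rfl⟩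

/-- An entire minimizing solution cannot have extra winding at infinity. -/
theorem winding_eq_zero {p : ℕ} (hp : 1 ≤ p) {s : ℤˣ} {δ : ℝ} (hδ0 : 0 ≤ δ) (hδ1 : δ < 1)
    {u : ℂ → ℂ} (hu : IsEntireMinimizingSolution (-(p : ℤ)) s δ u)
    (hδa : δ < (2 + 2 * (p : ℝ)) / (4 * (p : ℝ) ^ 2 + 10 + 10 * p))
    (hδb : δ < 2 / Real.sqrt 3 - 1) {k : ℤ} {r₀ : ℝ}
    (hk : ∀ r, r₀ ≤ r → ∃ L : ℝ → ℂ, ContDiff ℝ ∞ L ∧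
      (∀ θ : ℝ, Complex.exp (L θ) = u (r * Complex.exp (Complex.I * θ))) ∧
      ∀ θ, L (θ + Real.pi / (1 - (-(p : ℤ) : ℤ)))
        = L θ + Complex.I * (Real.pi / (1 - (-(p : ℤ) : ℤ)) * (-(p : ℤ) : ℤ)
          + 2 * Real.pi * k)) : k = 0 := by
  by_contra hk0
  have hpi := Real.pi_pos
  have hd : -(p : ℤ) ≤ -1 := by omega
  obtain ⟨η, m, hη, hm0, hm1, hmη⟩ := exists_margin (vortex_cost_lt hk0 hp hδ1 hδa)
  obtain ⟨γ, g1, g2, g3, g4, g5, g6, g7⟩ := exists_transition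
  have hγ : IsTransition γ := ⟨g1, g2, g3, g4, g5, g6, g7⟩
  obtain ⟨C, R₁, hR₁, hcomp⟩ := exists_diskEnergy_competitor_le hp k hδ0 hδ1 (anisotropy_le hδb)
    hη hu.smooth hγ
  obtain ⟨C', hlin⟩ := exists_diskEnergy_le_linear hδ0 hδ1 hu
  obtain ⟨r₁, -, hr₁⟩ := exists_norm_mem_of_tendsto hu.norm_tendsto
    (max_lt hm1 (by norm_num : (999 / 1000 : ℝ) < 1)) (by norm_num : (1 : ℝ) < 1001 / 1000)
  set Y : ℝ := (p : ℝ) ^ 2 + 2 * (p + 1) * (k : ℝ) ^ 2 with hY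
  set D : ℝ := -p + 2 * (p + 1) * (k : ℝ) with hD
  set C₁ : ℝ := (1 + 3 * δ) * Real.pi * (Y + η) with hC₁
  set c₀ : ℝ := (1 - δ) * Real.pi * (m ^ 2 * D ^ 2) with hc₀
  have hcc : C₁ < c₀ := by
    have := mul_lt_mul_of_pos_left hmη hpi
    rw [hC₁, hc₀]
    linarith
  have habs : ((k.natAbs : ℝ)) ^ 2 = (k : ℝ) ^ 2 := by
    rw [Nat.cast_natAbs, Int.cast_abs, sq_abs]
  rw [habs, ← hY] at hcomp
  set t₁ : ℝ := Real.log (max (max R₁ r₀) r₁) with ht₁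
  have hmax : 0 < max (max R₁ r₀) r₁ := by
    have := le_max_left R₁ r₀
    have := le_max_left (max R₁ r₀) r₁
    linarith
  have hexp : ∀ t, t₁ ≤ t → R₁ ≤ Real.exp t ∧ r₀ ≤ Real.exp t ∧ r₁ ≤ Real.exp t := by
    intro t ht
    have h1 : max (max R₁ r₀) r₁ ≤ Real.exp t := by rwa [← Real.log_le_iff_le_exp hmax]
    exact ⟨((le_max_left _ _).trans (le_max_left _ _)).trans h1,
      ((le_max_right _ _).trans (le_max_left _ _)).trans h1, (le_max_right _ _).trans h1⟩
  have hF := fun t => hasDerivAt_diskEnergy_exp (δ := δ) hu.smooth t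
  have hF'ge := fun t => circle_energy_ge hδ0 hδ1.le hu.smooth (Real.exp_pos t).le
  have hnorm : ∀ t, t₁ ≤ t → ∀ θ : ℝ,
      max m (999 / 1000) ≤ ‖u ((Real.exp t : ℝ) * Complex.exp (Complex.I * θ))‖ ∧
      ‖u ((Real.exp t : ℝ) * Complex.exp (Complex.I * θ))‖ ≤ 1001 / 1000 := by
    intro t ht θ
    refine hr₁ _ ?_
    rw [norm_circle (Real.exp_pos t).le]
    exact (hexp t ht).2.2
  -- Minimality against the competitor on D_R, R = e^t. The circle energy in its bound is at most
  -- F'(t).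
  have hode : ∀ t, t₁ ≤ t → diskEnergy δ u (Real.exp t) ≤ 9 / 10 * (Real.exp t ^ 2 *
      ∫ θ in (-Real.pi)..Real.pi, density δ u ((Real.exp t : ℝ) * Complex.exp (Complex.I * θ)))
      + C₁ * t + C := by
    intro t ht
    obtain ⟨L, hL, hLe, hLs⟩ := hk _ (hexp t ht).2.1
    have hR := (hexp t ht).1
    obtain ⟨c, Λ, hΛ, hc⟩ := exists_isBoundaryPhase (p := p) (k := k) (Real.exp_pos t)
      hu.equivariant.2 hL hLe (by
        intro θ
        have := hLs θ
        push_cast at this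
        simpa only [sub_neg_eq_add, add_comm (1 : ℝ), add_comm (1 : ℂ)] using this)
    have h1 := hcomp _ hR c Λ hΛ fun θ =>
      ⟨(le_max_right _ _).trans (hnorm t ht θ).1, (hnorm t ht θ).2⟩
    have h2 := diskEnergy_le_of_eq_on_sphere hδ0 hδ1.le hu.smooth hu.equivariant hu.minimizing
      (contDiff_competitor hγ hΛ (hR₁.trans hR)) (isEquivariant_competitor hΛ hc)
      (Real.exp_pos t) fun z hz => competitor_eq_on_sphere hγ hΛ (hR₁.trans hR) hz
    rw [Real.log_exp] at h1
    have h3 := mul_le_mul_of_nonneg_left (hF'ge t) (by norm_num : (0 : ℝ) ≤ 9 / 10)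
    linarith
  have hlow : ∀ t, t₁ ≤ t → c₀ ≤ Real.exp t ^ 2 *
      ∫ θ in (-Real.pi)..Real.pi, density δ u ((Real.exp t : ℝ) * Complex.exp (Complex.I * θ)) := by
    intro t ht
    obtain ⟨L, hL, hLe, hLs⟩ := hk _ (hexp t ht).2.1
    have h1 := integral_norm_tang_sq_ge hd hu.smooth hL hLe hLs hm0.le fun θ =>
      (le_max_left _ _).trans (hnorm t ht θ).1
    have hDD : (((-(p : ℤ) : ℤ) : ℝ) + 2 * (1 - ((-(p : ℤ) : ℤ) : ℝ)) * k) = D := by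
      rw [hD]; push_cast; ring
    rw [hDD] at h1
    have h2 := mul_le_mul_of_nonneg_left h1 (by linarith : 0 ≤ (1 - δ) / 2)
    have h3 : 0 ≤ Real.exp t ^ 2 * ∫ θ in (-Real.pi)..Real.pi,
        W (u ((Real.exp t : ℝ) * Complex.exp (Complex.I * θ))) :=
      mul_nonneg (sq_nonneg _)
        (intervalIntegral.integral_nonneg (by linarith) fun _ _ => W_nonneg _)
    have h4 : c₀ = (1 - δ) / 2 * (m ^ 2 * (2 * Real.pi * D ^ 2)) := by rw [hc₀]; ring
    linarith [hF'ge t]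
  have hgrow : ∀ t, t₁ ≤ t → diskEnergy δ u (Real.exp t) ≤ C' * Real.exp t := fun t ht =>
    hlin _ (by linarith [(hexp t ht).1])
  have hup : ∀ t, t₁ ≤ t → diskEnergy δ u (Real.exp t) ≤ C₁ * t + C + 9 / 10 * C₁ := fun t ht =>
    le_linear_of_le_mul_deriv hF (by norm_num) (by norm_num) hode hgrow ht
  have hdn : ∀ t, t₁ ≤ t → c₀ * (t - t₁) ≤ diskEnergy δ u (Real.exp t) := by
    intro t ht
    have h1 := le_of_le_deriv hF hlow ht
    have h2 : 0 ≤ diskEnergy δ u (Real.exp t₁) :=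
      integral_nonneg fun z => density_nonneg hδ0 hδ1.le u z
    linarith
  have hpos : 0 < c₀ - C₁ := by linarith
  -- A time beyond the crossing of the lower line of slope c₀ and the upper line of slope C₁.
  set t : ℝ := max t₁ ((C + 9 / 10 * C₁ + c₀ * t₁ + 1) / (c₀ - C₁)) with ht
  have h1 := hup t (le_max_left _ _)
  have h2 := hdn t (le_max_left _ _)
  have h3 : (C + 9 / 10 * C₁ + c₀ * t₁ + 1) / (c₀ - C₁) ≤ t := le_max_right _ _
  rw [div_le_iff₀ hpos] at h3
  linarith

end AnisotropicGL

end

theorem proposition4p1 (d : ℤ) (hd : d ≤ -1) (s : ℤˣ) (δ : ℝ) (hδ0 : 0 ≤ δ) (hδ1 : δ < 1)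
    (u : ℂ → ℂ) (hu : AnisotropicGL.IsEntireMinimizingSolution d s δ u)
    (hδ : δ < min ((2 - 2 * (d : ℝ)) / (4 * (d : ℝ) ^ 2 + 10 - 10 * (d : ℝ)))
      (2 / Real.sqrt 3 - 1)) :
    ∀ᶠ r : ℝ in Filter.atTop, AnisotropicGL.HasDegree u r d := by
  open AnisotropicGL in
  obtain ⟨r₀, hr₀, hur₀⟩ := exists_norm_mem_of_tendsto hu.norm_tendsto
    (by norm_num : (1 / 2 : ℝ) < 1) (by norm_num : (1 : ℝ) < 2)
  have hne : ∀ z, r₀ ≤ ‖z‖ → u z ≠ 0 := fun z hz h0 => by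
    have := (hur₀ z hz).1
    rw [h0, norm_zero] at this
    norm_num at this
  obtain ⟨k, hk⟩ := exists_winding_uniform hd hu.smooth hu.equivariant hr₀ hne
  have hlift : ∀ r, r₀ ≤ r → ∃ L : ℝ → ℂ, ContDiff ℝ ∞ L ∧
      (∀ θ : ℝ, Complex.exp (L θ) = u (r * Complex.exp (Complex.I * θ))) ∧
      ∀ θ, L (θ + Real.pi / (1 - d))
        = L θ + Complex.I * (Real.pi / (1 - d) * d + 2 * Real.pi * k) := by
    intro r hr
    obtain ⟨L, hL, hLe, -⟩ := exists_log_lift (w := fun θ : ℝ => u (r * Complex.exp (Complex.I * θ)))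
      (hu.smooth.comp (contDiff_circle r))
      (fun θ => hne _ (by rwa [norm_circle (hr₀.trans hr)]))
    exact ⟨L, hL, hLe, hk r hr L (hL.differentiable (by simp)) hLe⟩
  have hk0 : k = 0 := by
    obtain ⟨p, rfl⟩ : ∃ p : ℕ, d = -(p : ℤ) := ⟨(-d).toNat, by omega⟩
    refine winding_eq_zero (by omega) hδ0 hδ1 hu ?_ (hδ.trans_le (min_le_right _ _)) hlift
    refine (hδ.trans_le (min_le_left _ _)).trans_eq ?_
    push_cast
    ring
  subst hk0
  filter_upwards [eventually_ge_atTop r₀] with r hr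
  obtain ⟨L, hL, hLe, hLs⟩ := hlift r hr
  exact hasDegree_of_lift hd hL.continuous hLe hLs
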